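/- **Proposition 4.2 (Relation between $W$ and $\rho$).** Let $d,n,p\ge 1$ be integers with $p(d-2)<d$, and let $B\subset\mathbb R^d$ be a nonempty open set, bounded if $d\le 2$. Let $G:B\times B\to[0,\infty]$ be the Green function of standard Brownian motion killed on leaving $B$, i.e. $G(x,y)=\int_0^\infty p_s(x,y)\,ds$ with $p_s$ the transition sub-probability density of the killed motion, and write $\|h\|_E^2=\int_B\int_B h(x)G(x,y)h(y)\,dx\,dy$. Let $\mathcal M_1(B)$ be the set of probability measures on $B$ and $\mathbb S_n$ the unit simplex of all $\lambda\in[0,1]^n$ with $\sum_i\lambda_i=1$; put $I(\lambda)=\sum_i\lambda_i\log\lambda_i$ (with $0\log0=0$). Write $H(\mu\,|\,f)$ for the relative entropy of $\mu$ with respect to the measure $f(x)\,dx$ on $B$ ($=\infty$ if $\mu$ is not absolutely continuous with respect to it), and for $\mu\in\mathcal M_1(B)$ let $$\mathcal G(\mu)=\inf_{\nu}\int_B\int_B \nu(dx\,dy)\,\log\frac{\nu(dx\,dy)}{\mu(dx)\,\mu(dy)\,G(x,y)},$$ the infimum being over all probability measures $\nu$ on $B\times B$ both of whose marginals equal $\mu$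 (measures $\nu\not\ll\mu\otimes\mu$ contribute $\infty$). Let $\phi=(\phi_1,\dots,\phi_n)$ be nonnegative, bounded, Borel measurable functions with compact support in $B$. For $\lambda\in\mathbb S_n$ and $\mu_1,\dots,\mu_n\in\mathcal M_1(B)$ put $$J(\lambda,\mu)=p\,I(\lambda)+\sum_{i=1}^n\lambda_i H(\mu_i\,|\,\phi_i^{2p})+p\,\mathcal G\Big(\sum_{i=1}^n\lambda_i\mu_i\Big),$$ where $0\cdot\infty=0$ and $J(\lambda,\mu)=\infty$ whenever $\sum_i\lambda_iH(\mu_i\,|\,\phi_i^{2p})=\infty$. Define $$W(\phi)=-\inf_{\lambda\in\mathbb S_n}\ \inf_{\mu_1,\dots,\mu_n\in\mathcal M_1(B)}J(\lambda,\mu),$$ $$\rho(\phi)=\sup\Big\{\Big\|\sum_{i=1}^n\sqrt{\lambda_i}\,g_i^{2p-1}\phi_i\Big\|_E^2:\ \lambda\in\mathbb S_n,\ g_i\in L^{2p}(B),\ \|g_i\|_{2p}=1\text{ for }i=1,\dots,n\Big\}.$$ Then the integrals in the definition of $\rho(\phi)$ converge absolutely, the infimum of $J$ (jointly over $\lambda$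 and $\mu$) and the supremum in $\rho(\phi)$ are attained, and $$W(\phi)=p\log\rho(\phi)\qquad(\log 0=-\infty).$$ Moreover, minimisers $(\lambda,\mu)$ of $J$ and maximisers $(\lambda,g)$ in $\rho(\phi)$ correspond to each other, with the same $\lambda$, through the relation $g_i^{2p}=\frac{d\mu_i}{dx}$, $i=1,\dots,n$, in the following sense. 1. If $(\lambda,g)$ is a maximiser, then $(\lambda,(g_i^{2p}\,dx)_i)$ is a minimiser. 2. Unless all $\phi_i$ vanish a.e., for each minimiser $(\lambda,\mu)$ there is a maximiser $(\lambda,g)$ with all $g_i\ge0$ and $\mu_i=g_i^{2p}\,dx$ for every $i$ with $\lambda_i>0$ (components with $\lambda_i=0$ do not enter the functionals). 3. If $B$ is connected and no $\phi_i$ vanishes a.e., then $(\lambda,g)\mapsto(\lambda,(g_i^{2p}\,dx)_i)$ is a bijection from the set of maximisers with all $g_i\ge0$ onto the set of minimisers. -/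

import Mathlib

open MeasureTheory
open scoped ENNReal

namespace GreenVar

noncomputable section

/-- Euclidean space `ℝ^d`. -/
abbrev Eu (d : ℕ) : Type := EuclideanSpace ℝ (Fin d)

/-! ### The Green function of killed Brownian motion -/

/-- The transition density `(2πs)^(-d/2) exp(-|x-y|²/(2s))` of standard Brownian motion (generator
`Δ/2`) in `ℝ^d`; it is only used for `s > 0`. -/
def gaussKernel {d : ℕ} (s : ℝ) (x y : Eu d) : ℝ≥0∞ :=
  ENNReal.ofReal ((2 * Real.pi * s) ^ (-(d : ℝ) / 2) * Real.exp (-(‖x - y‖ ^ 2) / (2 * s)))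

/-- `skeletonKernel K n s x y` is the density, at `y`, of the sub-probability law
`P_x(W(s) ∈ dy, W(j s / 2^n) ∈ K for j = 1, …, 2^n - 1)` of a Brownian motion `W` started in `x`.
By the Markov property at the midpoint `s/2`, the case `n + 1` is the composition of two copies of
the case `n` on a time interval of length `s/2`. -/
def skeletonKernel {d : ℕ} (K : Set (Eu d)) : ℕ → ℝ → Eu d → Eu d → ℝ≥0∞
  | 0, s, x, y => gaussKernel s x y
  | n + 1, s, x, y =>
      ∫⁻ z in K, skeletonKernel K n (s / 2) x z * skeletonKernel K n (s / 2) z y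

/-- The transition sub-probability density `p_s(x, y)` of Brownian motion killed on leaving the
open set `B`, i.e. the density of `P_x(W(s) ∈ dy, W[0,s] ⊆ B)`, for `x, y ∈ B`.
For compact `K` the densities `skeletonKernel K n s x y` decrease in `n`, and, `K` being closed and
the paths being continuous, their limit is the density of `P_x(W(s) ∈ dy, W[0,s] ⊆ K)` (Gaussian
kernel times the probability that the Brownian bridge from `x` to `y` stays in `K`). A path that
stays in the open set `B` up to time `s` stays in some compact `K ⊆ B`, whence the supremum. -/
def killedKernel {d : ℕ} (B : Set (Eu d)) (s : ℝ) (x y : Eu d) : ℝ≥0∞ :=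
  ⨆ (K : Set (Eu d)) (_ : IsCompact K) (_ : K ⊆ B), ⨅ n : ℕ, skeletonKernel K n s x y

/-- The Green function `G(x, y) = ∫_0^∞ p_s(x, y) ds`, with values in `[0, ∞]`. -/
def green {d : ℕ} (B : Set (Eu d)) (x y : Eu d) : ℝ≥0∞ :=
  ∫⁻ s in Set.Ioi (0 : ℝ), killedKernel B s x y

/-! ### Entropies -/

open Classical in
/-- The integral `∫ f dν ∈ [-∞, ∞]` of an extended real function, as the integral of the positive
part minus the integral of the negative part; it is `∞` as soon as the positive part has infinite
integral. -/
def extIntegral {α : Type*} [MeasurableSpace α] (ν : Measure α) (f : α → EReal) : EReal :=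
  if (∫⁻ a, (f a).toENNReal ∂ν) = ∞ then ⊤
  else ((∫⁻ a, (f a).toENNReal ∂ν : ℝ≥0∞) : EReal) - ((∫⁻ a, (-f a).toENNReal ∂ν : ℝ≥0∞) : EReal)

open Classical in
/-- The relative entropy `H(μ | μ') = ∫ μ(dx) log (μ(dx)/μ'(dx))`, equal to `∞` if `μ` is not
absolutely continuous with respect to `μ'`. -/
def relEntropy {α : Type*} [MeasurableSpace α] (μ μ' : Measure α) : EReal :=
  if μ ≪ μ' then extIntegral μ (fun a => ENNReal.log (μ.rnDeriv μ' a)) else ⊤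

open Classical in
/-- The functional
`𝒢(μ) = inf_ν ∫∫ ν(dx dy) log (ν(dx dy) / (μ(dx) μ(dy) G(x, y)))`, the infimum being over the
probability measures `ν` on `B × B` both of whose marginals are `μ`; measures `ν` that are not
absolutely continuous with respect to `μ ⊗ μ` contribute `∞`. -/
def greenEntropy {d : ℕ} (B : Set (Eu d)) (μ : Measure (Eu d)) : EReal :=
  ⨅ (ν : Measure (Eu d × Eu d)) (_ : ν.fst = μ) (_ : ν.snd = μ),
    if ν ≪ μ.prod μ then
      extIntegral ν (fun z => ENNReal.log (ν.rnDeriv (μ.prod μ) z / green B z.1 z.2))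
    else ⊤

/-- `ℳ₁(B)`: the probability measures on `ℝ^d` that are carried by `B`. -/
def probOn {d : ℕ} (B : Set (Eu d)) : Set (Measure (Eu d)) :=
  {μ | IsProbabilityMeasure μ ∧ μ Bᶜ = 0}

/-- `I(λ) = ∑ λ_i log λ_i`, with `0 log 0 = 0`. -/
def simplexEntropy {n : ℕ} (l : Fin n → ℝ) : ℝ := ∑ i, l i * Real.log (l i)

/-- The measure `φ(x)^{2p} dx` on `B`. -/
def powMeasure {d : ℕ} (B : Set (Eu d)) (p : ℕ) (φ : Eu d → ℝ) : Measure (Eu d) :=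
  (volume.restrict B).withDensity (fun x => ENNReal.ofReal (φ x ^ (2 * p)))

/-- `∑ λ_i H(μ_i | φ_i^{2p})`, with the convention `0 · ∞ = 0`. -/
def entropyPart {d n : ℕ} (B : Set (Eu d)) (p : ℕ) (φ : Fin n → Eu d → ℝ)
    (l : Fin n → ℝ) (μ : Fin n → Measure (Eu d)) : EReal :=
  ∑ i, (l i : EReal) * relEntropy (μ i) (powMeasure B p (φ i))

/-- The mixture `∑ λ_j μ_j`. -/
def mixture {d n : ℕ} (l : Fin n → ℝ) (μ : Fin n → Measure (Eu d)) : Measure (Eu d) :=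
  ∑ j, ENNReal.ofReal (l j) • μ j

open Classical in
/-- `∑ λ_i H(μ_i | φ_i^{2p}) + p 𝒢(∑ λ_j μ_j)`, where the sum is `∞` if its first part is
(note that `EReal` addition would give `⊤ + ⊥ = ⊥`). -/
def innerFunctional {d n : ℕ} (B : Set (Eu d)) (p : ℕ) (φ : Fin n → Eu d → ℝ)
    (l : Fin n → ℝ) (μ : Fin n → Measure (Eu d)) : EReal :=
  if entropyPart B p φ l μ = ⊤ then ⊤
  else entropyPart B p φ l μ + ((p : ℝ) : EReal) * greenEntropy B (mixture l μ)

/-- `ℌ(φ, λ) = - inf { ∑ λ_i H(μ_i | φ_i^{2p}) + p 𝒢(∑ λ_j μ_j) : μ_1, …, μ_n ∈ ℳ₁(B) }`. -/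
def mixedRate {d n : ℕ} (B : Set (Eu d)) (p : ℕ) (φ : Fin n → Eu d → ℝ) (l : Fin n → ℝ) : EReal :=
  -⨅ (μ : Fin n → Measure (Eu d)) (_ : ∀ i, μ i ∈ probOn B), innerFunctional B p φ l μ

/-- `W(φ) = - inf_{λ} { p I(λ) - ℌ(φ, λ) }`, the infimum being over the unit simplex. -/
def W {d n : ℕ} (B : Set (Eu d)) (p : ℕ) (φ : Fin n → Eu d → ℝ) : EReal :=
  -⨅ (l : Fin n → ℝ) (_ : l ∈ stdSimplex ℝ (Fin n)),
    (((p * simplexEntropy l : ℝ) : EReal) - mixedRate B p φ l)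

/-- The functional that is minimised jointly over `λ` and `μ_1, …, μ_n` in the definition of `W`:
`p I(λ) + ∑ λ_i H(μ_i | φ_i^{2p}) + p 𝒢(∑ λ_j μ_j)`. -/
def jointFunctional {d n : ℕ} (B : Set (Eu d)) (p : ℕ) (φ : Fin n → Eu d → ℝ)
    (x : (Fin n → ℝ) × (Fin n → Measure (Eu d))) : EReal :=
  ((p * simplexEntropy x.1 : ℝ) : EReal) + innerFunctional B p φ x.1 x.2

/-- The admissible `(λ, μ_1, …, μ_n)`. -/
def admissibleMeasures {d : ℕ} (n : ℕ) (B : Set (Eu d)) :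
    Set ((Fin n → ℝ) × (Fin n → Measure (Eu d))) :=
  {x | x.1 ∈ stdSimplex ℝ (Fin n) ∧ ∀ i, x.2 i ∈ probOn B}

/-- The minimisers `(λ, μ_1, …, μ_n)` in the variational problem for `W`. -/
def minimisers {d n : ℕ} (B : Set (Eu d)) (p : ℕ) (φ : Fin n → Eu d → ℝ) :
    Set ((Fin n → ℝ) × (Fin n → Measure (Eu d))) :=
  {x | x ∈ admissibleMeasures n B ∧ IsMinOn (jointFunctional B p φ) (admissibleMeasures n B) x}

/-! ### Green energies -/

/-- The integrand `h(x) G(x, y) h(y)` of the Green energy. -/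
def energyDensity {d : ℕ} (B : Set (Eu d)) (h : Eu d → ℝ) (z : Eu d × Eu d) : ℝ :=
  h z.1 * (green B z.1 z.2).toReal * h z.2

/-- The Green energy `‖h‖_E² = ∫_B ∫_B h(x) G(x, y) h(y) dx dy`. -/
def energySq {d : ℕ} (B : Set (Eu d)) (h : Eu d → ℝ) : ℝ :=
  ∫ z, energyDensity B h z ∂((volume.restrict B).prod (volume.restrict B))

/-- The space `L^{2p}(B)` of real (equivalence classes of) functions. -/
abbrev L2p {d : ℕ} (B : Set (Eu d)) (p : ℕ) : Type :=
  Lp ℝ ((2 * p : ℕ) : ℝ≥0∞) ((volume : Measure (Eu d)).restrict B)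

/-- The function `∑ √λ_i g_i^{2p-1} φ_i`. -/
def combination {d n : ℕ} {B : Set (Eu d)} {p : ℕ} (φ : Fin n → Eu d → ℝ)
    (x : (Fin n → ℝ) × (Fin n → L2p B p)) : Eu d → ℝ :=
  fun y => ∑ i, √(x.1 i) * (x.2 i y) ^ (2 * p - 1) * φ i y

/-- The admissible `(λ, g_1, …, g_n)`: `λ` in the unit simplex, `g_i ∈ L^{2p}(B)`, `‖g_i‖ = 1`. -/
def admissibleFunctions {d : ℕ} (n : ℕ) (B : Set (Eu d)) (p : ℕ) :
    Set ((Fin n → ℝ) × (Fin n → L2p B p)) :=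
  {x | x.1 ∈ stdSimplex ℝ (Fin n) ∧ ∀ i, ‖x.2 i‖ = 1}

/-- `ρ(φ) = sup ‖∑ √λ_i g_i^{2p-1} φ_i‖_E²` over all admissible `(λ, g_1, …, g_n)`. -/
def rho {d n : ℕ} (B : Set (Eu d)) (p : ℕ) (φ : Fin n → Eu d → ℝ) : ℝ :=
  sSup ((fun x => energySq B (combination φ x)) '' admissibleFunctions n B p)

/-- The maximisers `(λ, g_1, …, g_n)` in the variational problem for `ρ`. -/
def maximisers {d n : ℕ} (B : Set (Eu d)) (p : ℕ) (φ : Fin n → Eu d → ℝ) :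
    Set ((Fin n → ℝ) × (Fin n → L2p B p)) :=
  {x | x ∈ admissibleFunctions n B p ∧
    IsMaxOn (fun x => energySq B (combination φ x)) (admissibleFunctions n B p) x}

/-- The measure `g(x)^{2p} dx` on `B`. -/
def toMeasure {d : ℕ} {B : Set (Eu d)} {p : ℕ} (g : L2p B p) : Measure (Eu d) :=
  powMeasure B p g

end

end GreenVar

/-!
Write `f = ∑ √λ_i g_i^{2p-1} φ_i` and `m = ∑ λ_i g_i^{2p}`, let `h = G f` be the potential of `f`,
and call `⟨f, G f⟩` its Green energy.

*Upper bound* (`FiniteEntropy.le_jointFunctional`). A measure `μ_i` of finite entropy is of the form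
`g_i^{2p} dx`. Written with the densities, `-(p I(λ) + ∑ λ_i H(μ_i | φ_i^{2p}))` is `2p` times
`∫ ∑ W_i log (E_i / W_i)` with `W_i = λ_i g_i^{2p}` and `E_i = √λ_i g_i^{2p-1} φ_i`, so by the
log-sum inequality it is at most `2p ∫ m log (f/m)`. The Gibbs variational principle, that is
Jensen's inequality (`le_extIntegral_log_rnDeriv_div`), gives
`𝒢(m dx) ≥ 2 ∫ m log (f/m) - log ⟨f, G f⟩`. Adding both, `J ≥ -p log ⟨f, G f⟩ ≥ -p log ρ`.

*Existence of maximisers* (`Standing.exists_mixEnergy_max`). The norm `‖(φ_i h)_i‖` in `ℓ²(L^{2p})`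
is the supremum of `∫ f h` over all `f` of the above form. As `p (d - 2) < d`, potentials of such
`f` are bounded in `L^r` over the supports of the `φ_i`, for some `r > 2p`. Along a subsequence of a
maximising sequence, the potentials have a lower limit `h` of norm at least `ρ`, and the `(λ, g)`
that is dual to `h` is a maximiser, by the Cauchy–Schwarz inequality and Fatou's lemma.

*Euler–Lagrange equations* (`IsMixMax.eulerLagrange`). By duality and the Cauchy–Schwarz inequality
for the Green energy, a maximiser attains the norm of its own potential, and the equality case of
Hölder's inequality yields `φ_i h = ρ √λ_i g_i` for all `i`. It follows that the `E_i` are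
proportional to the `W_i`, which is the equality case of the log-sum inequality, and that
`f(x) G(x, y) f(y) / ρ` is the density of a coupling of `m dx` with itself, for which there is
equality in the Gibbs principle. So `J = -p log ρ` at the maximiser
(`IsMixMax.jointFunctional_le`), and the entropies are finite since `h` is in `L^r` with `r > 2p`.

The correspondence of the optimisers follows. For a minimiser `(λ, μ)` with densities `g_i^{2p}`,
the bounds `-p log ρ = J ≥ -p log ⟨f, G f⟩` show that `(λ, g)` is a maximiser. On a connected domain
the potential `h` is positive everywhere, hence so are the weights `λ_i` of a maximiser, and all
components of a minimiser are determined by the functions `g_i`.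

The Green function is defined by time discretisation, so the facts about it that are used (symmetry,
the semigroup property of the killed kernel, domination by the Gaussian kernel, and positivity for
points of the same component) are established at the start.
-/

namespace GreenVar

open Filter Topology

/-! ### The Gaussian kernel -/

lemma gaussKernel_symm {d : ℕ} (s : ℝ) (x y : Eu d) : gaussKernel s x y = gaussKernel s y x := by
  simp only [gaussKernel, norm_sub_rev x y]

lemma measurable_gaussKernel {d : ℕ} :
    Measurable fun q : ℝ × Eu d × Eu d => gaussKernel q.1 q.2.1 q.2.2 := by
  unfold gaussKernel
  fun_prop

lemma gaussKernel_le {d : ℕ} {s : ℝ} (hs : 0 < s) (x y : Eu d) :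
    gaussKernel s x y ≤ ENNReal.ofReal ((2 * Real.pi * s) ^ (-(d : ℝ) / 2)) := by
  unfold gaussKernel
  apply ENNReal.ofReal_le_ofReal
  have h1 : Real.exp (-(‖x - y‖ ^ 2) / (2 * s)) ≤ 1 := by
    rw [Real.exp_le_one_iff]
    apply div_nonpos_of_nonpos_of_nonneg <;> nlinarith [sq_nonneg ‖x - y‖]
  have h2 : 0 ≤ (2 * Real.pi * s) ^ (-(d : ℝ) / 2) := by positivity
  exact mul_le_of_le_one_right h2 h1

lemma gaussKernel_ne_top {d : ℕ} (s : ℝ) (x y : Eu d) : gaussKernel s x y ≠ ∞ :=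
  ENNReal.ofReal_ne_top

lemma lintegral_gaussKernel {d : ℕ} {s : ℝ} (hs : 0 < s) (x : Eu d) :
    ∫⁻ y, gaussKernel s x y = 1 := by
  have hb : (0 : ℝ) < 1 / (2 * s) := by positivity
  have key := GaussianFourier.integral_rexp_neg_mul_sq_norm (V := Eu d) hb
  have hint : Integrable fun y : Eu d => Real.exp (-(1 / (2 * s)) * ‖y‖ ^ 2) := by
    by_contra hc
    rw [integral_undef hc] at key
    have : 0 < (Real.pi / (1 / (2 * s))) ^ ((Module.finrank ℝ (Eu d) : ℝ) / 2) := by positivity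
    linarith
  have e1 : ∀ y : Eu d, gaussKernel s x y = ENNReal.ofReal ((2 * Real.pi * s) ^ (-(d : ℝ) / 2)) *
      (fun v : Eu d => ENNReal.ofReal (Real.exp (-(1 / (2 * s)) * ‖v‖ ^ 2))) (y - x) := by
    intro y
    simp only [gaussKernel]
    rw [ENNReal.ofReal_mul (by positivity), norm_sub_rev]
    congr 3
    ring
  simp_rw [e1]
  rw [lintegral_const_mul _ (by fun_prop), lintegral_sub_right_eq_self
    (fun v : Eu d => ENNReal.ofReal (Real.exp (-(1 / (2 * s)) * ‖v‖ ^ 2))),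
    ← ofReal_integral_eq_lintegral_ofReal hint (ae_of_all _ fun _ => (Real.exp_pos _).le), key,
    ← ENNReal.ofReal_mul (by positivity)]
  rw [finrank_euclideanSpace_fin, neg_div, Real.rpow_neg (by positivity)]
  have : Real.pi / (1 / (2 * s)) = 2 * Real.pi * s := by field_simp
  rw [this, inv_mul_cancel₀ (by positivity), ENNReal.ofReal_one]

/-- The Chapman–Kolmogorov equation for Brownian motion, by completing the square. -/
lemma gaussKernel_comp {d : ℕ} {s t : ℝ} (hs : 0 < s) (ht : 0 < t) (x y : Eu d) :
    ∫⁻ z, gaussKernel s x z * gaussKernel t z y = gaussKernel (s + t) x y := by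
  -- the point `c` divides the segment from `x` to `y` in the ratio `s : t`
  set c : Eu d := (t / (s + t)) • x + (s / (s + t)) • y with hc
  set r : ℝ := s * t / (s + t) with hr
  have hst : 0 < s + t := by positivity
  have hrp : 0 < r := by positivity
  have key : ∀ z : Eu d, gaussKernel s x z * gaussKernel t z y
      = gaussKernel (s + t) x y * gaussKernel r c z := by
    intro z
    have hsq : ‖x - z‖ ^ 2 / s + ‖z - y‖ ^ 2 / t = ‖x - y‖ ^ 2 / (s + t) + ‖c - z‖ ^ 2 / r := by
      have e1 : x - y = (x - z) + (z - y) := by abel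
      have e2 : c - z = (t / (s + t)) • (x - z) - (s / (s + t)) • (z - y) := by
        have : z = (t / (s + t)) • z + (s / (s + t)) • z := by
          rw [← add_smul, ← add_div, add_comm t s, div_self hst.ne', one_smul]
        conv_lhs => rw [this]
        rw [hc]; module
      rw [e1, e2]
      generalize x - z = a
      generalize z - y = b
      rw [norm_add_sq_real, norm_sub_sq_real, norm_smul, norm_smul, inner_smul_left,
        inner_smul_right, Real.norm_of_nonneg (by positivity), Real.norm_of_nonneg (by positivity)]
      simp only [hr, conj_trivial]
      field_simp
      ring
    simp only [gaussKernel]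
    rw [← ENNReal.ofReal_mul (by positivity), ← ENNReal.ofReal_mul (by positivity)]
    congr 1
    have h1 : (2 * Real.pi * s) ^ (-(d : ℝ) / 2) * (2 * Real.pi * t) ^ (-(d : ℝ) / 2) =
        (2 * Real.pi * (s + t)) ^ (-(d : ℝ) / 2) * (2 * Real.pi * r) ^ (-(d : ℝ) / 2) := by
      rw [← Real.mul_rpow (by positivity) (by positivity),
        ← Real.mul_rpow (by positivity) (by positivity)]
      congr 1
      rw [hr]; field_simp
    have h2 : Real.exp (-(‖x - z‖ ^ 2) / (2 * s)) * Real.exp (-(‖z - y‖ ^ 2) / (2 * t)) =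
        Real.exp (-(‖x - y‖ ^ 2) / (2 * (s + t))) * Real.exp (-(‖c - z‖ ^ 2) / (2 * r)) := by
      rw [← Real.exp_add, ← Real.exp_add]
      congr 1
      have e : ∀ a b : ℝ, -a / (2 * b) = -(a / b) / 2 := fun a b => by
        rw [neg_div, neg_div, div_div, mul_comm b 2]
      rw [e, e, e, e]
      linarith
    calc _ = ((2 * Real.pi * s) ^ (-(d : ℝ) / 2) * (2 * Real.pi * t) ^ (-(d : ℝ) / 2)) *
        (Real.exp (-(‖x - z‖ ^ 2) / (2 * s)) * Real.exp (-(‖z - y‖ ^ 2) / (2 * t))) := by ring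
      _ = _ := by rw [h1, h2]; ring
  simp_rw [key]
  rw [lintegral_const_mul' _ _ (gaussKernel_ne_top _ _ _), lintegral_gaussKernel hrp, mul_one]

/-! ### The kernel of killed Brownian motion -/

lemma measurable_skeletonKernel {d : ℕ} (K : Set (Eu d)) (n : ℕ) :
    Measurable fun q : ℝ × Eu d × Eu d => skeletonKernel K n q.1 q.2.1 q.2.2 := by
  induction n with
  | zero => exact measurable_gaussKernel
  | succ n ih =>
    simp only [skeletonKernel]
    refine Measurable.lintegral_prod_right' (ν := volume.restrict K)
      (f := fun w : (ℝ × Eu d × Eu d) × Eu d => skeletonKernel K n (w.1.1 / 2) w.1.2.1 w.2 *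
        skeletonKernel K n (w.1.1 / 2) w.2 w.1.2.2) ?_
    refine Measurable.mul ?_ ?_
    · exact ih.comp (f := fun w : (ℝ × Eu d × Eu d) × Eu d => (w.1.1 / 2, w.1.2.1, w.2))
        (by fun_prop)
    · exact ih.comp (f := fun w : (ℝ × Eu d × Eu d) × Eu d => (w.1.1 / 2, w.2, w.1.2.2))
        (by fun_prop)

lemma measurable_skeletonKernel_right {d : ℕ} (K : Set (Eu d)) (n : ℕ) (s : ℝ) (x : Eu d) :
    Measurable fun z => skeletonKernel K n s x z :=
  (measurable_skeletonKernel K n).comp (f := fun z => (s, x, z)) (by fun_prop)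

lemma measurable_skeletonKernel_left {d : ℕ} (K : Set (Eu d)) (n : ℕ) (s : ℝ) (y : Eu d) :
    Measurable fun z => skeletonKernel K n s z y :=
  (measurable_skeletonKernel K n).comp (f := fun z => (s, z, y)) (by fun_prop)

lemma skeletonKernel_symm {d : ℕ} (K : Set (Eu d)) (n : ℕ) (s : ℝ) (x y : Eu d) :
    skeletonKernel K n s x y = skeletonKernel K n s y x := by
  induction n generalizing s x y with
  | zero => exact gaussKernel_symm s x y
  | succ n ih =>
    simp only [skeletonKernel]
    refine lintegral_congr fun z => ?_
    rw [mul_comm, ih _ z y, ih _ x z]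

lemma skeletonKernel_succ_le {d : ℕ} (K : Set (Eu d)) (n : ℕ) {s : ℝ} (hs : 0 < s) (x y : Eu d) :
    skeletonKernel K (n + 1) s x y ≤ skeletonKernel K n s x y := by
  induction n generalizing s x y with
  | zero =>
    calc skeletonKernel K 1 s x y
        = ∫⁻ z in K, gaussKernel (s / 2) x z * gaussKernel (s / 2) z y := rfl
      _ ≤ ∫⁻ z, gaussKernel (s / 2) x z * gaussKernel (s / 2) z y := setLIntegral_le_lintegral _ _
      _ = gaussKernel s x y := by
        rw [gaussKernel_comp (half_pos hs) (half_pos hs), add_halves]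
  | succ n ih =>
    rw [skeletonKernel, skeletonKernel]
    exact lintegral_mono fun z => mul_le_mul' (ih (half_pos hs) x z) (ih (half_pos hs) z y)

lemma antitone_skeletonKernel {d : ℕ} (K : Set (Eu d)) {s : ℝ} (hs : 0 < s) (x y : Eu d) :
    Antitone fun n => skeletonKernel K n s x y :=
  antitone_nat_of_succ_le fun n => skeletonKernel_succ_le K n hs x y

lemma skeletonKernel_mono {d : ℕ} {K L : Set (Eu d)} (h : K ⊆ L) (n : ℕ) (s : ℝ) (x y : Eu d) :
    skeletonKernel K n s x y ≤ skeletonKernel L n s x y := by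
  induction n generalizing s x y with
  | zero => exact le_rfl
  | succ n ih =>
    simp only [skeletonKernel]
    exact lintegral_mono' (Measure.restrict_mono h le_rfl)
      fun z => mul_le_mul' (ih _ x z) (ih _ z y)

/-- The density of Brownian motion killed on leaving the closed set `K`: the limit of the skeleton
kernels. -/
noncomputable def closedKernel {d : ℕ} (K : Set (Eu d)) (s : ℝ) (x y : Eu d) : ℝ≥0∞ :=
  ⨅ n : ℕ, skeletonKernel K n s x y

lemma measurable_closedKernel {d : ℕ} (K : Set (Eu d)) :
    Measurable fun q : ℝ × Eu d × Eu d => closedKernel K q.1 q.2.1 q.2.2 :=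
  Measurable.iInf fun n => measurable_skeletonKernel K n

lemma closedKernel_symm {d : ℕ} (K : Set (Eu d)) (s : ℝ) (x y : Eu d) :
    closedKernel K s x y = closedKernel K s y x :=
  iInf_congr fun n => skeletonKernel_symm K n s x y

lemma closedKernel_mono {d : ℕ} {K L : Set (Eu d)} (h : K ⊆ L) (s : ℝ) (x y : Eu d) :
    closedKernel K s x y ≤ closedKernel L s x y :=
  iInf_mono fun n => skeletonKernel_mono h n s x y

lemma closedKernel_le_gauss {d : ℕ} (K : Set (Eu d)) (s : ℝ) (x y : Eu d) :
    closedKernel K s x y ≤ gaussKernel s x y := iInf_le _ 0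

/-- The Chapman–Kolmogorov equation at the midpoint passes to the limit of the skeletons. -/
lemma closedKernel_comp {d : ℕ} (K : Set (Eu d)) {s : ℝ} (hs : 0 < s) (x y : Eu d) :
    closedKernel K s x y = ∫⁻ z in K, closedKernel K (s / 2) x z * closedKernel K (s / 2) z y := by
  have hs2 := half_pos hs
  have h1 : closedKernel K s x y = ⨅ n, skeletonKernel K (n + 1) s x y :=
    ((antitone_skeletonKernel K hs x y).iInf_nat_add 1).symm
  have hpt : ∀ z, closedKernel K (s / 2) x z * closedKernel K (s / 2) z y =
      ⨅ n, skeletonKernel K n (s / 2) x z * skeletonKernel K n (s / 2) z y := by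
    intro z
    have a1 := tendsto_atTop_iInf (antitone_skeletonKernel K hs2 x z)
    have a2 := tendsto_atTop_iInf (antitone_skeletonKernel K hs2 z y)
    have b1 : closedKernel K (s / 2) x z ≠ ∞ :=
      ne_top_of_le_ne_top (gaussKernel_ne_top _ _ _) (closedKernel_le_gauss _ _ _ _)
    have b2 : closedKernel K (s / 2) z y ≠ ∞ :=
      ne_top_of_le_ne_top (gaussKernel_ne_top _ _ _) (closedKernel_le_gauss _ _ _ _)
    refine tendsto_nhds_unique (ENNReal.Tendsto.mul a1 (Or.inr b2) a2 (Or.inr b1))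
      (tendsto_atTop_iInf fun m n hmn => mul_le_mul' (antitone_skeletonKernel K hs2 x z hmn)
        (antitone_skeletonKernel K hs2 z y hmn))
  rw [h1]
  simp_rw [hpt]
  rw [lintegral_iInf]
  · rfl
  · exact fun n => (measurable_skeletonKernel_right K n _ x).mul
      (measurable_skeletonKernel_left K n _ y)
  · exact fun m n hmn z => mul_le_mul' (antitone_skeletonKernel K hs2 x z hmn)
      (antitone_skeletonKernel K hs2 z y hmn)
  · exact ne_top_of_le_ne_top (gaussKernel_ne_top s x y) (skeletonKernel_succ_le K 0 hs x y)

lemma exists_compact_exhaustion {d : ℕ} {B : Set (Eu d)} (hB : IsOpen B) :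
    ∃ K : ℕ → Set (Eu d), Monotone K ∧ (∀ m, IsCompact (K m)) ∧ (∀ m, K m ⊆ B) ∧
      ∀ C, IsCompact C → C ⊆ B → ∃ m, C ⊆ K m := by
  have : LocallyCompactSpace B := hB.locallyCompactSpace
  let E := CompactExhaustion.choice B
  refine ⟨fun m => Subtype.val '' E m, fun m n h => Set.image_mono (E.subset h),
    fun m => (E.isCompact m).image continuous_subtype_val, fun m => by simp, fun C hC hCB => ?_⟩
  have : IsCompact (Subtype.val ⁻¹' C : Set B) := by
    rw [Topology.IsEmbedding.subtypeVal.isCompact_iff, Subtype.image_preimage_coe,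
      Set.inter_eq_self_of_subset_right hCB]
    exact hC
  obtain ⟨m, hm⟩ := E.exists_superset_of_isCompact this
  refine ⟨m, fun x hx => ⟨⟨x, hCB hx⟩, hm hx, rfl⟩⟩

/-- An increasing exhaustion by compact sets yields the supremum over all of them; being countable,
it gives measurability and allows monotone convergence. -/
lemma killedKernel_eq_iSup {d : ℕ} {B : Set (Eu d)} {K : ℕ → Set (Eu d)}
    (hK : ∀ m, IsCompact (K m)) (hKB : ∀ m, K m ⊆ B)
    (hC : ∀ C, IsCompact C → C ⊆ B → ∃ m, C ⊆ K m) (s : ℝ) (x y : Eu d) :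
    killedKernel B s x y = ⨆ m, closedKernel (K m) s x y := by
  apply le_antisymm
  · refine iSup_le fun C => iSup_le fun h1 => iSup_le fun h2 => ?_
    obtain ⟨m, hm⟩ := hC C h1 h2
    exact (closedKernel_mono hm s x y).trans (le_iSup (fun m => closedKernel (K m) s x y) m)
  · exact iSup_le fun m => le_iSup_of_le (K m) (le_iSup_of_le (hK m) (le_iSup_of_le (hKB m) le_rfl))

lemma closedKernel_le_killedKernel {d : ℕ} {B K : Set (Eu d)} (hK : IsCompact K) (hKB : K ⊆ B)
    (s : ℝ) (x y : Eu d) : closedKernel K s x y ≤ killedKernel B s x y :=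
  le_iSup_of_le K (le_iSup_of_le hK (le_iSup_of_le hKB le_rfl))

lemma measurable_killedKernel {d : ℕ} {B : Set (Eu d)} (hB : IsOpen B) :
    Measurable fun q : ℝ × Eu d × Eu d => killedKernel B q.1 q.2.1 q.2.2 := by
  obtain ⟨K, -, h2, h3, h4⟩ := exists_compact_exhaustion hB
  simp_rw [killedKernel_eq_iSup h2 h3 h4]
  exact Measurable.iSup fun m => measurable_closedKernel (K m)

lemma killedKernel_symm {d : ℕ} (B : Set (Eu d)) (s : ℝ) (x y : Eu d) :
    killedKernel B s x y = killedKernel B s y x :=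
  iSup_congr fun K => iSup_congr fun _ => iSup_congr fun _ => closedKernel_symm K s x y

lemma killedKernel_le_gauss {d : ℕ} (B : Set (Eu d)) (s : ℝ) (x y : Eu d) :
    killedKernel B s x y ≤ gaussKernel s x y :=
  iSup_le fun K => iSup_le fun _ => iSup_le fun _ => closedKernel_le_gauss K s x y

/-- The Chapman–Kolmogorov equation for killed Brownian motion at the midpoint of a time
interval. -/
lemma killedKernel_comp {d : ℕ} {B : Set (Eu d)} (hB : IsOpen B) {s : ℝ} (hs : 0 < s)
    (x y : Eu d) :
    killedKernel B s x y = ∫⁻ z in B, killedKernel B (s / 2) x z * killedKernel B (s / 2) z y := by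
  obtain ⟨K, h1, h2, h3, h4⟩ := exists_compact_exhaustion hB
  have hm : ∀ m, MeasurableSet (K m) := fun m => (h2 m).measurableSet
  have hmono : ∀ x y, Monotone fun m => closedKernel (K m) (s / 2) x y :=
    fun x y m n h => closedKernel_mono (h1 h) _ x y
  have hpt : ∀ z ∈ B, killedKernel B (s / 2) x z * killedKernel B (s / 2) z y =
      ⨆ m, (K m).indicator (fun z => closedKernel (K m) (s / 2) x z *
        closedKernel (K m) (s / 2) z y) z := by
    intro z hz
    have hfin : ∀ x y : Eu d, ⨆ m, closedKernel (K m) (s / 2) x y ≠ ∞ := fun x y =>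
      ne_top_of_le_ne_top (gaussKernel_ne_top (s / 2) x y)
        (iSup_le fun m => closedKernel_le_gauss _ _ _ _)
    rw [killedKernel_eq_iSup h2 h3 h4, killedKernel_eq_iSup h2 h3 h4,
      tendsto_nhds_unique (ENNReal.Tendsto.mul (tendsto_atTop_iSup (hmono x z))
        (Or.inr (hfin z y)) (tendsto_atTop_iSup (hmono z y)) (Or.inr (hfin x z)))
        (tendsto_atTop_iSup fun m n hmn => mul_le_mul' (hmono x z hmn) (hmono z y hmn))]
    apply le_antisymm
    · refine iSup_le fun m => ?_
      obtain ⟨k, hk⟩ := h4 {z} isCompact_singleton (by simpa using hz)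
      refine le_iSup_of_le (max m k) ?_
      rw [Set.indicator_of_mem (h1 (le_max_right m k) (hk rfl))]
      exact mul_le_mul' (hmono x z (le_max_left m k)) (hmono z y (le_max_left m k))
    · exact iSup_mono fun m => Set.indicator_le_self _ _ _
  rw [setLIntegral_congr_fun hB.measurableSet hpt, lintegral_iSup]
  · rw [killedKernel_eq_iSup h2 h3 h4]
    refine iSup_congr fun m => ?_
    rw [closedKernel_comp _ hs, lintegral_indicator (hm m), Measure.restrict_restrict (hm m),
      Set.inter_eq_self_of_subset_left (h3 m)]
  · intro m
    refine Measurable.indicator ?_ (hm m)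
    exact ((measurable_closedKernel (K m)).comp (f := fun z => (s / 2, x, z)) (by fun_prop)).mul
      ((measurable_closedKernel (K m)).comp (f := fun z => (s / 2, z, y)) (by fun_prop))
  · intro m n hmn z
    refine (Set.indicator_le_indicator_of_subset (h1 hmn) (fun _ => zero_le) z).trans
      (Set.indicator_le_indicator (mul_le_mul' (hmono x z hmn) (hmono z y hmn)))

/-! ### Positivity of the killed kernel -/

/-- The difference between the Gaussian kernel and `skeletonKernel K n`, i.e. the density of the
paths that are outside `K` at one of the intermediate times `j s / 2^n`: such a path has left `K` in
the first half of the time interval, or is outside `K` at the midpoint, or leaves `K` in the second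
half only. -/
noncomputable def exitKernel {d : ℕ} (K : Set (Eu d)) : ℕ → ℝ → Eu d → Eu d → ℝ≥0∞
  | 0, _, _, _ => 0
  | n + 1, s, x, y =>
      (∫⁻ z, exitKernel K n (s / 2) x z * gaussKernel (s / 2) z y) +
      (∫⁻ z in Kᶜ, skeletonKernel K n (s / 2) x z * gaussKernel (s / 2) z y) +
      ∫⁻ z in K, skeletonKernel K n (s / 2) x z * exitKernel K n (s / 2) z y

lemma measurable_exitKernel {d : ℕ} (K : Set (Eu d)) (n : ℕ) :
    Measurable fun q : ℝ × Eu d × Eu d => exitKernel K n q.1 q.2.1 q.2.2 := by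
  have key : ∀ (ν : Measure (Eu d)) [SFinite ν] (k l : ℝ → Eu d → Eu d → ℝ≥0∞),
      Measurable (fun q : ℝ × Eu d × Eu d => k q.1 q.2.1 q.2.2) →
      Measurable (fun q : ℝ × Eu d × Eu d => l q.1 q.2.1 q.2.2) →
      Measurable fun q : ℝ × Eu d × Eu d =>
        ∫⁻ z, k (q.1 / 2) q.2.1 z * l (q.1 / 2) z q.2.2 ∂ν := by
    intro ν _ k l hk hl
    refine Measurable.lintegral_prod_right'
      (f := fun w : (ℝ × Eu d × Eu d) × Eu d => k (w.1.1 / 2) w.1.2.1 w.2 *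
        l (w.1.1 / 2) w.2 w.1.2.2) (Measurable.mul ?_ ?_)
    · exact hk.comp (f := fun w : (ℝ × Eu d × Eu d) × Eu d => (w.1.1 / 2, w.1.2.1, w.2))
        (by fun_prop)
    · exact hl.comp (f := fun w : (ℝ × Eu d × Eu d) × Eu d => (w.1.1 / 2, w.2, w.1.2.2))
        (by fun_prop)
  induction n with
  | zero => exact measurable_const
  | succ n ih =>
    simp only [exitKernel]
    exact ((key _ _ _ ih measurable_gaussKernel).add
      (key _ _ _ (measurable_skeletonKernel K n) measurable_gaussKernel)).add
      (key _ _ _ (measurable_skeletonKernel K n) ih)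

lemma measurable_exitKernel_right {d : ℕ} (K : Set (Eu d)) (n : ℕ) (s : ℝ) (x : Eu d) :
    Measurable fun z => exitKernel K n s x z :=
  (measurable_exitKernel K n).comp (f := fun z => (s, x, z)) (by fun_prop)

lemma measurable_gaussKernel_right {d : ℕ} (s : ℝ) (x : Eu d) :
    Measurable fun z => gaussKernel s x z :=
  measurable_gaussKernel.comp (f := fun z => (s, x, z)) (by fun_prop)

lemma measurable_gaussKernel_left {d : ℕ} (s : ℝ) (y : Eu d) :
    Measurable fun z => gaussKernel s z y :=
  measurable_gaussKernel.comp (f := fun z => (s, z, y)) (by fun_prop)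

lemma skeletonKernel_add_exitKernel {d : ℕ} {K : Set (Eu d)} (hK : MeasurableSet K) (n : ℕ) {s : ℝ}
    (hs : 0 < s) (x y : Eu d) :
    skeletonKernel K n s x y + exitKernel K n s x y = gaussKernel s x y := by
  induction n generalizing s x y with
  | zero => simp [skeletonKernel, exitKernel]
  | succ n ih =>
    have hs2 := half_pos hs
    have m1 : Measurable fun z => skeletonKernel K n (s / 2) x z * gaussKernel (s / 2) z y :=
      (measurable_skeletonKernel_right _ _ _ _).mul (measurable_gaussKernel_left _ _)
    calc skeletonKernel K (n + 1) s x y + exitKernel K (n + 1) s x y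
        = (∫⁻ z, exitKernel K n (s / 2) x z * gaussKernel (s / 2) z y) +
          ((∫⁻ z in K, skeletonKernel K n (s / 2) x z *
              (skeletonKernel K n (s / 2) z y + exitKernel K n (s / 2) z y)) +
            ∫⁻ z in Kᶜ, skeletonKernel K n (s / 2) x z * gaussKernel (s / 2) z y) := by
          simp_rw [mul_add]
          rw [lintegral_add_left ((measurable_skeletonKernel_right _ _ _ _).fun_mul
            (measurable_skeletonKernel_left _ _ _ _))]
          simp only [skeletonKernel, exitKernel]
          ring
      _ = (∫⁻ z, exitKernel K n (s / 2) x z * gaussKernel (s / 2) z y) +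
          ∫⁻ z, skeletonKernel K n (s / 2) x z * gaussKernel (s / 2) z y := by
          simp_rw [ih hs2]
          rw [lintegral_add_compl _ hK]
      _ = ∫⁻ z, gaussKernel (s / 2) x z * gaussKernel (s / 2) z y := by
          rw [add_comm, ← lintegral_add_left m1]
          simp_rw [← add_mul, ih hs2]
      _ = gaussKernel s x y := by rw [gaussKernel_comp hs2 hs2, add_halves]

/-- Integrating the recursion for `exitKernel` in its end point against a function `ψ`. -/
lemma lintegral_exitKernel_succ {d : ℕ} (K : Set (Eu d)) (n : ℕ) (s : ℝ)
    (x : Eu d) {ψ : Eu d → ℝ≥0∞} (hψ : Measurable ψ) :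
    ∫⁻ y, exitKernel K (n + 1) s x y * ψ y =
      (∫⁻ z, exitKernel K n (s / 2) x z * ∫⁻ y, gaussKernel (s / 2) z y * ψ y) +
      (∫⁻ z in Kᶜ, skeletonKernel K n (s / 2) x z * ∫⁻ y, gaussKernel (s / 2) z y * ψ y) +
      ∫⁻ z in K, skeletonKernel K n (s / 2) x z * ∫⁻ y, exitKernel K n (s / 2) z y * ψ y := by
  have key : ∀ (ν : Measure (Eu d)) [SFinite ν] (a : Eu d → ℝ≥0∞) (k : Eu d × Eu d → ℝ≥0∞),
      Measurable a → Measurable k →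
      (Measurable fun y => (∫⁻ z, a z * k (z, y) ∂ν) * ψ y) ∧
      ∫⁻ y, (∫⁻ z, a z * k (z, y) ∂ν) * ψ y = ∫⁻ z, a z * ∫⁻ y, k (z, y) * ψ y ∂volume ∂ν := by
    intro ν _ a k ha hk
    constructor
    · refine Measurable.mul ?_ hψ
      exact Measurable.lintegral_prod_left' (f := fun w : Eu d × Eu d => a w.1 * k w) (by fun_prop)
    · have : ∀ y, (∫⁻ z, a z * k (z, y) ∂ν) * ψ y = ∫⁻ z, a z * (k (z, y) * ψ y) ∂ν := by
        intro y
        rw [← lintegral_mul_const _ (by fun_prop)]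
        simp_rw [mul_assoc]
      simp_rw [this]
      rw [lintegral_lintegral_swap (by fun_prop)]
      refine lintegral_congr fun z => ?_
      rw [lintegral_const_mul _ (by fun_prop)]
  have mg : Measurable fun w : Eu d × Eu d => gaussKernel (s / 2) w.1 w.2 :=
    measurable_gaussKernel.comp (f := fun w : Eu d × Eu d => (s / 2, w)) (by fun_prop)
  have me : Measurable fun w : Eu d × Eu d => exitKernel K n (s / 2) w.1 w.2 :=
    (measurable_exitKernel K n).comp (f := fun w : Eu d × Eu d => (s / 2, w)) (by fun_prop)
  obtain ⟨a1, b1⟩ := key volume _ _ (measurable_exitKernel_right K n (s / 2) x) mg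
  obtain ⟨a2, b2⟩ := key (volume.restrict Kᶜ) _ _ (measurable_skeletonKernel_right K n (s / 2) x) mg
  obtain ⟨a3, b3⟩ := key (volume.restrict K) _ _ (measurable_skeletonKernel_right K n (s / 2) x) me
  simp only [exitKernel, add_mul]
  rw [lintegral_add_left (a1.fun_add a2), lintegral_add_left a1, b1, b2, b3]

lemma lintegral_exitKernel_succ_one {d : ℕ} (K : Set (Eu d)) (n : ℕ) {s : ℝ} (hs : 0 < s)
    (x : Eu d) :
    ∫⁻ y, exitKernel K (n + 1) s x y =
      (∫⁻ z, exitKernel K n (s / 2) x z) + (∫⁻ z in Kᶜ, skeletonKernel K n (s / 2) x z) +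
      ∫⁻ z in K, skeletonKernel K n (s / 2) x z * ∫⁻ y, exitKernel K n (s / 2) z y := by
  have := lintegral_exitKernel_succ K n s x (ψ := fun _ => 1) measurable_const
  simpa [lintegral_gaussKernel (half_pos hs)] using this

section exit

variable {d : ℕ} {K : Set (Eu d)} {y : Eu d} {t : ℝ} {M : ℝ≥0∞}

/-- After the exit from `K`, the density at `y` is at most `M`, if the Gaussian kernel between `y`
and the complement of `K` is at most `M` at all remaining times. -/
lemma lintegral_exitKernel_mul_gauss_le
    (hM : ∀ z ∉ K, ∀ s, 0 < s → s ≤ t → gaussKernel s z y ≤ M) (n : ℕ) {s r : ℝ} (hs : 0 < s)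
    (hr : 0 < r) (hsr : s + r ≤ t) (x : Eu d) :
    ∫⁻ z, exitKernel K n s x z * gaussKernel r z y ≤ M * ∫⁻ z, exitKernel K n s x z := by
  induction n generalizing s r x with
  | zero => simp [exitKernel]
  | succ n ih =>
    have hs2 := half_pos hs
    rw [lintegral_exitKernel_succ K n s x (measurable_gaussKernel_left r y),
      lintegral_exitKernel_succ_one K n hs]
    simp_rw [gaussKernel_comp hs2 hr]
    rw [mul_add, mul_add]
    refine add_le_add (add_le_add (ih hs2 (by positivity) (by linarith) x) ?_) ?_
    · rw [← lintegral_const_mul _ (measurable_skeletonKernel_right _ _ _ _)]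
      refine setLIntegral_mono ((measurable_skeletonKernel_right _ _ _ _).const_mul _)
        fun z hz => ?_
      rw [mul_comm]
      exact mul_le_mul' (hM z hz _ (by positivity) (by linarith)) le_rfl
    · have mE : Measurable fun z => ∫⁻ y, exitKernel K n (s / 2) z y :=
        Measurable.lintegral_prod_right' (f := fun w : Eu d × Eu d =>
          exitKernel K n (s / 2) w.1 w.2) ((measurable_exitKernel K n).comp
            (f := fun w : Eu d × Eu d => (s / 2, w)) (by fun_prop))
      rw [← lintegral_const_mul _ ((measurable_skeletonKernel_right _ _ _ _).fun_mul mE)]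
      refine lintegral_mono fun z => ?_
      dsimp only
      rw [mul_left_comm]
      exact mul_le_mul' le_rfl (ih hs2 hr (by linarith) z)

/-- As `lintegral_exitKernel_mul_gauss_le`, for the density of the exiting paths itself. -/
lemma exitKernel_le
    (hM : ∀ z ∉ K, ∀ s, 0 < s → s ≤ t → gaussKernel s z y ≤ M) (n : ℕ) {s : ℝ} (hs : 0 < s)
    (hst : s ≤ t) (x : Eu d) :
    exitKernel K n s x y ≤ M * ∫⁻ z, exitKernel K n s x z := by
  induction n generalizing s x with
  | zero => simp [exitKernel]
  | succ n ih =>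
    have hs2 := half_pos hs
    rw [exitKernel, lintegral_exitKernel_succ_one K n hs, mul_add, mul_add]
    refine add_le_add (add_le_add
      (lintegral_exitKernel_mul_gauss_le hM n hs2 hs2 (by linarith) x) ?_) ?_
    · rw [← lintegral_const_mul _ (measurable_skeletonKernel_right _ _ _ _)]
      refine setLIntegral_mono ((measurable_skeletonKernel_right _ _ _ _).const_mul _)
        fun z hz => ?_
      rw [mul_comm]
      exact mul_le_mul' (hM z hz _ hs2 (by linarith)) le_rfl
    · have mE : Measurable fun z => ∫⁻ y, exitKernel K n (s / 2) z y :=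
        Measurable.lintegral_prod_right' (f := fun w : Eu d × Eu d =>
          exitKernel K n (s / 2) w.1 w.2) ((measurable_exitKernel K n).comp
            (f := fun w : Eu d × Eu d => (s / 2, w)) (by fun_prop))
      rw [← lintegral_const_mul _ ((measurable_skeletonKernel_right _ _ _ _).fun_mul mE)]
      refine lintegral_mono fun z => ?_
      dsimp only
      rw [mul_left_comm]
      exact mul_le_mul' le_rfl (ih hs2 (by linarith) z)

/-- The paths from `x` to `y` that leave `K` have density at most `M`. -/
lemma gaussKernel_sub_le_closedKernel (hK : MeasurableSet K) (ht : 0 < t)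
    (hM : ∀ z ∉ K, ∀ s, 0 < s → s ≤ t → gaussKernel s z y ≤ M) (x : Eu d) :
    gaussKernel t x y - M ≤ closedKernel K t x y := by
  refine le_iInf fun n => ?_
  rw [tsub_le_iff_right, ← skeletonKernel_add_exitKernel hK n ht]
  refine add_le_add le_rfl ((exitKernel_le hM n ht le_rfl x).trans ?_)
  calc M * ∫⁻ z, exitKernel K n t x z ≤ M * ∫⁻ z, gaussKernel t x z := by
        gcongr with z
        rw [← skeletonKernel_add_exitKernel hK n ht]
        exact le_add_self
    _ = M := by rw [lintegral_gaussKernel ht, mul_one]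

end exit

/-- At a distance of at least `r`, the Gaussian kernel increases in time up to time `r² / d`. -/
lemma gaussKernel_le_of_le_norm {d : ℕ} {r s t : ℝ} (hr : 0 < r) (hs : 0 < s) (hst : s ≤ t)
    (ht : d * t ≤ r ^ 2) {y z : Eu d} (hz : r ≤ ‖z - y‖) :
    gaussKernel s z y ≤
      ENNReal.ofReal ((2 * Real.pi * t) ^ (-(d : ℝ) / 2) * Real.exp (-(r ^ 2) / (2 * t))) := by
  have ht0 : 0 < t := hs.trans_le hst
  refine ENNReal.ofReal_le_ofReal ?_
  have h1 : Real.exp (-(‖z - y‖ ^ 2) / (2 * s)) ≤ Real.exp (-(r ^ 2) / (2 * s)) := by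
    gcongr
  have h2 : (2 * Real.pi * s) ^ (-(d : ℝ) / 2) =
      (2 * Real.pi * t) ^ (-(d : ℝ) / 2) * (t / s) ^ ((d : ℝ) / 2) := by
    rw [neg_div, Real.rpow_neg (by positivity), Real.rpow_neg (by positivity),
      show 2 * Real.pi * t = (2 * Real.pi * s) * (t / s) by field_simp,
      Real.mul_rpow (x := 2 * Real.pi * s) (by positivity) (by positivity)]
    have : (t / s) ^ ((d : ℝ) / 2) ≠ 0 := by positivity
    field_simp
  have h3 : (t / s) ^ ((d : ℝ) / 2) ≤ Real.exp ((t / s - 1) * ((d : ℝ) / 2)) := by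
    rw [Real.exp_mul]
    gcongr
    linarith [Real.add_one_le_exp (t / s - 1)]
  have h4 : (t / s - 1) * ((d : ℝ) / 2) ≤ r ^ 2 / (2 * s) - r ^ 2 / (2 * t) := by
    have e1 : r ^ 2 / (2 * s) - r ^ 2 / (2 * t) = (t / s - 1) * (r ^ 2 / (2 * t)) := by
      field_simp
    rw [e1]
    have : 0 ≤ t / s - 1 := by
      rw [sub_nonneg, one_le_div hs]; exact hst
    refine mul_le_mul_of_nonneg_left ?_ this
    rw [div_le_div_iff₀ (by norm_num) (by positivity)]
    linarith
  calc (2 * Real.pi * s) ^ (-(d : ℝ) / 2) * Real.exp (-(‖z - y‖ ^ 2) / (2 * s))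
      ≤ ((2 * Real.pi * t) ^ (-(d : ℝ) / 2) * Real.exp (r ^ 2 / (2 * s) - r ^ 2 / (2 * t))) *
        Real.exp (-(r ^ 2) / (2 * s)) := by
        rw [h2]
        gcongr
        exact h3.trans (Real.exp_le_exp.2 h4)
    _ = _ := by
        rw [mul_assoc, ← Real.exp_add]
        congr 2
        ring

/-- Locally and for small times the killed kernel is strictly positive: the Gaussian density exceeds
the density of the paths that return from the boundary of a ball. -/
lemma killedKernel_pos_of_closedBall {d : ℕ} {B : Set (Eu d)} {y : Eu d} {r : ℝ}
    (hB : Metric.closedBall y r ⊆ B) {t : ℝ} (ht : 0 < t) (htr : d * t ≤ r ^ 2) {x : Eu d}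
    (hx : ‖x - y‖ < r) : 0 < killedKernel B t x y := by
  have hr : 0 < r := (norm_nonneg _).trans_lt hx
  refine lt_of_lt_of_le ?_ (closedKernel_le_killedKernel (isCompact_closedBall y r) hB t x y)
  refine lt_of_lt_of_le ?_ (gaussKernel_sub_le_closedKernel
    (M := ENNReal.ofReal ((2 * Real.pi * t) ^ (-(d : ℝ) / 2) * Real.exp (-(r ^ 2) / (2 * t))))
    measurableSet_closedBall ht (fun z hz s hs hst => gaussKernel_le_of_le_norm hr hs hst htr ?_) x)
  · rw [tsub_pos_iff_lt, gaussKernel]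
    have h0 : 0 < (2 * Real.pi * t) ^ (-(d : ℝ) / 2) := by positivity
    refine (ENNReal.ofReal_lt_ofReal_iff (by positivity)).2 ?_
    gcongr
  · rw [Metric.mem_closedBall, not_le, dist_eq_norm] at hz
    exact hz.le

/-- `x` and `y` are linked if the killed kernel is positive near `(x, y)` for all small times. -/
def Linked {d : ℕ} (B : Set (Eu d)) (x y : Eu d) : Prop :=
  ∃ ε > 0, ∀ x' ∈ Metric.ball x ε, ∀ y' ∈ Metric.ball y ε, ∀ s, 0 < s → s < ε →
    0 < killedKernel B s x' y'

lemma Linked.symm {d : ℕ} {B : Set (Eu d)} {x y : Eu d} (h : Linked B x y) : Linked B y x := by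
  obtain ⟨ε, hε, h⟩ := h
  refine ⟨ε, hε, fun x' hx y' hy s h0 hs => ?_⟩
  rw [killedKernel_symm]
  exact h y' hy x' hx s h0 hs

lemma Linked.refl {d : ℕ} {B : Set (Eu d)} (hB : IsOpen B) {y : Eu d} (hy : y ∈ B) :
    Linked B y y := by
  obtain ⟨r, hr, hrB⟩ := Metric.isOpen_iff.1 hB y hy
  refine ⟨min (r / 4) (r ^ 2 / (4 * (d + 1))), by positivity, fun x' hx y' hy' s h0 hs => ?_⟩
  have hx' : dist x' y < r / 4 := lt_of_lt_of_le hx (min_le_left _ _)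
  have hy'' : dist y' y < r / 4 := lt_of_lt_of_le hy' (min_le_left _ _)
  refine killedKernel_pos_of_closedBall (r := r / 2) (fun z hz => hrB ?_) h0 ?_ ?_
  · rw [Metric.mem_closedBall] at hz
    rw [Metric.mem_ball]
    linarith [dist_triangle z y' y]
  · have := hs.trans_le (min_le_right _ _)
    rw [lt_div_iff₀ (by positivity)] at this
    nlinarith
  · rw [← dist_eq_norm]
    linarith [dist_triangle_right x' y' y]

lemma Linked.trans {d : ℕ} {B : Set (Eu d)} (hB : IsOpen B) {x y z : Eu d} (hz : z ∈ B)
    (h1 : Linked B x z) (h2 : Linked B z y) : Linked B x y := by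
  obtain ⟨ε, hε, h1⟩ := h1
  obtain ⟨δ, hδ, h2⟩ := h2
  refine ⟨min ε δ, by positivity, fun x' hx y' hy s h0 hs => ?_⟩
  rw [killedKernel_comp hB h0, lintegral_pos_iff_support]
  · have hO : IsOpen (Metric.ball z (min ε δ) ∩ B) := Metric.isOpen_ball.inter hB
    have hne : (Metric.ball z (min ε δ) ∩ B).Nonempty :=
      ⟨z, Metric.mem_ball_self (by positivity), hz⟩
    rw [Measure.restrict_apply' hB.measurableSet]
    refine (hO.measure_pos volume hne).trans_le (measure_mono ?_)
    rintro w ⟨hw, hwB⟩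
    refine ⟨?_, hwB⟩
    have a1 := h1 x' (Metric.ball_subset_ball (min_le_left _ _) hx) w
      (Metric.ball_subset_ball (min_le_left _ _) hw) (s / 2) (by positivity)
      (by linarith [min_le_left ε δ])
    have a2 := h2 w (Metric.ball_subset_ball (min_le_right _ _) hw) y'
      (Metric.ball_subset_ball (min_le_right _ _) hy) (s / 2) (by positivity)
      (by linarith [min_le_right ε δ])
    exact (ENNReal.mul_pos a1.ne' a2.ne').ne'
  · exact ((measurable_killedKernel hB).comp (f := fun w => (s / 2, x', w)) (by fun_prop)).mul
      ((measurable_killedKernel hB).comp (f := fun w => (s / 2, w, y')) (by fun_prop))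

lemma Linked.exists_ball {d : ℕ} {B : Set (Eu d)} {x y : Eu d} (h : Linked B x y) :
    ∃ ε > 0, ∀ x' ∈ Metric.ball x ε, ∀ y' ∈ Metric.ball y ε, Linked B x' y' := by
  obtain ⟨ε, hε, h⟩ := h
  refine ⟨ε / 2, by positivity, fun x' hx y' hy => ⟨ε / 2, by positivity,
    fun u hu v hv s h0 hs => ?_⟩⟩
  rw [Metric.mem_ball] at hx hy hu hv
  exact h u (by rw [Metric.mem_ball]; linarith [dist_triangle u x' x]) v
    (by rw [Metric.mem_ball]; linarith [dist_triangle v y' y]) s h0 (by linarith)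

/-- By the semigroup property `Linked B` is an equivalence relation on `B`, and its classes are
open. -/
lemma linked_of_isPreconnected {d : ℕ} {B : Set (Eu d)} (hB : IsOpen B) (hc : IsPreconnected B)
    {x y : Eu d} (hx : x ∈ B) (hy : y ∈ B) : Linked B x y := by
  have hU : IsOpen {z | z ∈ B ∧ Linked B x z} := by
    rw [Metric.isOpen_iff]
    rintro z ⟨hz, hl⟩
    obtain ⟨ε, hε, h⟩ := hl.exists_ball
    obtain ⟨δ, hδ, h'⟩ := Metric.isOpen_iff.1 hB z hz
    exact ⟨min ε δ, by positivity, fun w hw => ⟨h' (Metric.ball_subset_ball (min_le_right _ _) hw),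
      h x (Metric.mem_ball_self hε) w (Metric.ball_subset_ball (min_le_left _ _) hw)⟩⟩
  have hV : IsOpen {z | z ∈ B ∧ ¬ Linked B x z} := by
    rw [Metric.isOpen_iff]
    rintro z ⟨hz, hl⟩
    obtain ⟨ε, hε, h⟩ := (Linked.refl hB hz).exists_ball
    obtain ⟨δ, hδ, h'⟩ := Metric.isOpen_iff.1 hB z hz
    refine ⟨min ε δ, by positivity, fun w hw =>
      ⟨h' (Metric.ball_subset_ball (min_le_right _ _) hw), fun hxw => hl ?_⟩⟩
    exact hxw.trans hB (h' (Metric.ball_subset_ball (min_le_right _ _) hw))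
      (h w (Metric.ball_subset_ball (min_le_left _ _) hw) z (Metric.mem_ball_self hε))
  have := hc.subset_left_of_subset_union hU hV
    (Set.disjoint_left.2 fun z h1 h2 => h2.2 h1.2)
    (fun z hz => by by_cases h : Linked B x z <;> simp [hz, h])
    ⟨x, hx, hx, Linked.refl hB hx⟩
  exact (this hy).2

/-! ### First properties of the Green function -/

lemma measurable_green {d : ℕ} {B : Set (Eu d)} (hB : IsOpen B) :
    Measurable fun z : Eu d × Eu d => green B z.1 z.2 := by
  unfold green
  refine Measurable.lintegral_prod_right' (ν := volume.restrict (Set.Ioi (0 : ℝ)))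
    (f := fun w : (Eu d × Eu d) × ℝ => killedKernel B w.2 w.1.1 w.1.2) ?_
  exact (measurable_killedKernel hB).comp
    (f := fun w : (Eu d × Eu d) × ℝ => (w.2, w.1.1, w.1.2)) (by fun_prop)

lemma green_symm {d : ℕ} (B : Set (Eu d)) (x y : Eu d) : green B x y = green B y x :=
  lintegral_congr fun s => killedKernel_symm B s x y

lemma Linked.green_pos {d : ℕ} {B : Set (Eu d)} (hB : IsOpen B) {x y : Eu d} (h : Linked B x y) :
    0 < green B x y := by
  obtain ⟨ε, hε, h⟩ := h
  rw [green, lintegral_pos_iff_support]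
  · rw [Measure.restrict_apply' measurableSet_Ioi]
    have : (0 : ℝ≥0∞) < volume (Set.Ioo 0 ε) := by simpa using hε
    refine this.trans_le (measure_mono fun s hs => ⟨?_, hs.1⟩)
    exact (h x (Metric.mem_ball_self hε) y (Metric.mem_ball_self hε) s hs.1 hs.2).ne'
  · exact (measurable_killedKernel hB).comp (f := fun s => (s, x, y)) (by fun_prop)

/-! ### Mutual energies -/

/-- The potential `∫_B G(x, y) v(y) dy` of a nonnegative function `v`. -/
noncomputable def potential {d : ℕ} (B : Set (Eu d)) (v : Eu d → ℝ≥0∞) (x : Eu d) : ℝ≥0∞ :=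
  ∫⁻ y in B, green B x y * v y

/-- The mutual energy `∫_B ∫_B u(x) G(x, y) v(y) dx dy` of nonnegative functions `u` and `v`. -/
noncomputable def mutualEnergy {d : ℕ} (B : Set (Eu d)) (u v : Eu d → ℝ≥0∞) : ℝ≥0∞ :=
  ∫⁻ x in B, u x * potential B v x

lemma measurable_potential {d : ℕ} {B : Set (Eu d)} (hB : IsOpen B) {v : Eu d → ℝ≥0∞}
    (hv : Measurable v) : Measurable (potential B v) := by
  have := measurable_green hB
  exact Measurable.lintegral_prod_right' (ν := volume.restrict B)
    (f := fun z : Eu d × Eu d => green B z.1 z.2 * v z.2) (by fun_prop)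

/-- At a fixed time, the form of the killed semigroup is an inner product in `L²(B)`, by the
semigroup property at half the time. -/
lemma lintegral_killedKernel_eq {d : ℕ} {B : Set (Eu d)} (hB : IsOpen B) {s : ℝ} (hs : 0 < s)
    {u v : Eu d → ℝ≥0∞} (hu : Measurable u) (hv : Measurable v) :
    ∫⁻ x in B, ∫⁻ y in B, u x * killedKernel B s x y * v y =
      ∫⁻ z in B, (∫⁻ x in B, killedKernel B (s / 2) z x * u x) *
        ∫⁻ y in B, killedKernel B (s / 2) z y * v y := by
  have mp : Measurable fun w : Eu d × Eu d => killedKernel B (s / 2) w.1 w.2 :=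
    (measurable_killedKernel hB).comp (f := fun w : Eu d × Eu d => (s / 2, w)) (by fun_prop)
  have mpr : ∀ x, Measurable fun y => killedKernel B (s / 2) x y := fun x =>
    mp.comp (f := fun y => (x, y)) (by fun_prop)
  have mpl : ∀ y, Measurable fun x => killedKernel B (s / 2) x y := fun y =>
    mp.comp (f := fun x => (x, y)) (by fun_prop)
  have mV : Measurable fun z => ∫⁻ y in B, killedKernel B (s / 2) z y * v y :=
    Measurable.lintegral_prod_right' (ν := volume.restrict B)
      (f := fun w : Eu d × Eu d => killedKernel B (s / 2) w.1 w.2 * v w.2) (by fun_prop)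
  calc ∫⁻ x in B, ∫⁻ y in B, u x * killedKernel B s x y * v y
      = ∫⁻ x in B, ∫⁻ z in B, (u x * killedKernel B (s / 2) x z) *
          ∫⁻ y in B, killedKernel B (s / 2) z y * v y := by
        refine lintegral_congr fun x => ?_
        have : ∀ y, u x * killedKernel B s x y * v y = ∫⁻ z in B,
            (u x * killedKernel B (s / 2) x z) * (killedKernel B (s / 2) z y * v y) := by
          intro y
          have mx := mpr x
          have my := mpl y
          rw [killedKernel_comp hB hs, mul_right_comm, ← lintegral_const_mul _ (by fun_prop)]
          refine lintegral_congr fun z => ?_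
          ring
        simp_rw [this]
        rw [lintegral_lintegral_swap]
        · refine lintegral_congr fun z => ?_
          have mx := mpr z
          rw [lintegral_const_mul _ (by fun_prop)]
        · have mx := mpr x
          fun_prop
    _ = _ := by
        rw [lintegral_lintegral_swap (by fun_prop)]
        refine lintegral_congr fun z => ?_
        have mx := mpl z
        rw [lintegral_mul_const _ (by fun_prop)]
        congr 1
        refine lintegral_congr fun x => ?_
        rw [mul_comm, killedKernel_symm]

/-- The part of the mutual energy that stems from the times in `T`. -/
lemma lintegral_timePart {d : ℕ} {B : Set (Eu d)} (hB : IsOpen B) (T : Set ℝ)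
    {u v : Eu d → ℝ≥0∞} (hu : Measurable u) (hv : Measurable v) :
    ∫⁻ x in B, u x * ∫⁻ y in B, (∫⁻ s in T, killedKernel B s x y) * v y =
      ∫⁻ s in T, ∫⁻ x in B, ∫⁻ y in B, u x * killedKernel B s x y * v y := by
  have mp := measurable_killedKernel hB
  have m3 : Measurable fun w : (Eu d × ℝ) × Eu d =>
      u w.1.1 * killedKernel B w.1.2 w.1.1 w.2 * v w.2 := by
    have := mp.comp (f := fun w : (Eu d × ℝ) × Eu d => (w.1.2, w.1.1, w.2)) (by fun_prop)
    dsimp [Function.comp_def] at this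
    fun_prop
  have mI : ∀ x, Measurable fun y => ∫⁻ s in T, killedKernel B s x y := fun x => by
    refine Measurable.lintegral_prod_right' (ν := volume.restrict T)
      (f := fun w : Eu d × ℝ => killedKernel B w.2 x w.1) ?_
    exact mp.comp (f := fun w : Eu d × ℝ => (w.2, x, w.1)) (by fun_prop)
  have mS : ∀ x y, Measurable fun s => killedKernel B s x y := fun x y =>
    mp.comp (f := fun s => (s, x, y)) (by fun_prop)
  calc _ = ∫⁻ x in B, ∫⁻ s in T, ∫⁻ y in B, u x * killedKernel B s x y * v y := by
        refine lintegral_congr fun x => ?_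
        have hx := mI x
        rw [← lintegral_const_mul _ (by fun_prop), lintegral_lintegral_swap]
        · refine lintegral_congr fun y => ?_
          have hxy := mS x y
          rw [← lintegral_mul_const _ hxy, ← lintegral_const_mul _ (by fun_prop)]
          refine lintegral_congr fun s => ?_
          ring
        · exact (m3.comp (f := fun w : ℝ × Eu d => ((x, w.1), w.2)) (by fun_prop)).aemeasurable
    _ = _ := by
        rw [lintegral_lintegral_swap]
        exact (Measurable.lintegral_prod_right' (ν := volume.restrict B) m3).aemeasurable

/-- The Cauchy–Schwarz inequality for the energy. -/
lemma mutualEnergy_le {d : ℕ} {B : Set (Eu d)} (hB : IsOpen B)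
    {u v : Eu d → ℝ≥0∞} (hu : Measurable u) (hv : Measurable v) :
    mutualEnergy B u v ≤ mutualEnergy B u u ^ (1 / 2 : ℝ) * mutualEnergy B v v ^ (1 / 2 : ℝ) := by
  -- `P w (s, z)` is the semigroup at time `s / 2`, applied to `w`
  set P : (Eu d → ℝ≥0∞) → ℝ × Eu d → ℝ≥0∞ :=
    fun w q => ∫⁻ x in B, killedKernel B (q.1 / 2) q.2 x * w x with hP
  have mP : ∀ w, Measurable w → Measurable (P w) := by
    intro w hw
    refine Measurable.lintegral_prod_right' (ν := volume.restrict B)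
      (f := fun r : (ℝ × Eu d) × Eu d => killedKernel B (r.1.1 / 2) r.1.2 r.2 * w r.2) ?_
    have := (measurable_killedKernel hB).comp
      (f := fun r : (ℝ × Eu d) × Eu d => (r.1.1 / 2, r.1.2, r.2)) (by fun_prop)
    dsimp [Function.comp_def] at this
    fun_prop
  have key : ∀ u v, Measurable u → Measurable v → mutualEnergy B u v =
      ∫⁻ q, (P u * P v) q ∂((volume.restrict (Set.Ioi (0 : ℝ))).prod (volume.restrict B)) := by
    intro u v hu hv
    rw [lintegral_prod _ ((mP u hu).mul (mP v hv)).aemeasurable]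
    refine (lintegral_timePart hB (Set.Ioi 0) hu hv).trans ?_
    exact setLIntegral_congr_fun measurableSet_Ioi fun s hs =>
      lintegral_killedKernel_eq hB hs hu hv
  rw [key u v hu hv, key u u hu hu, key v v hv hv]
  refine (ENNReal.lintegral_mul_le_Lp_mul_Lq _ Real.HolderConjugate.two_two
    (mP u hu).aemeasurable (mP v hv).aemeasurable).trans (le_of_eq ?_)
  simp [sq]

/-- The energy is positive definite on nonnegative functions. -/
lemma mutualEnergy_pos {d : ℕ} {B : Set (Eu d)} (hB : IsOpen B) {u : Eu d → ℝ≥0∞}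
    (hu : Measurable u) (h0 : ¬ u =ᵐ[volume.restrict B] 0) : 0 < mutualEnergy B u u := by
  by_contra hc
  apply h0
  have hz : mutualEnergy B u u = 0 := by simpa using hc
  rw [mutualEnergy, lintegral_eq_zero_iff (hu.fun_mul (measurable_potential hB hu))] at hz
  have hgoal : volume {x | x ∈ B ∧ u x ≠ 0} = 0 := by
    refine measure_null_of_locally_null _ fun x hx => ?_
    obtain ⟨ε, hε, hl⟩ := (Linked.refl hB hx.1).exists_ball
    refine ⟨Metric.ball x ε ∩ {x | x ∈ B ∧ u x ≠ 0}, ?_, ?_⟩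
    · rw [Set.inter_comm]
      exact inter_mem_nhdsWithin _ (Metric.ball_mem_nhds x hε)
    -- on a ball where `G > 0`, positivity of `u` on a set of positive measure makes `G u` positive
    by_contra hne
    have hpos : ∀ y ∈ Metric.ball x ε, 0 < potential B u y := by
      intro y hy
      rw [potential, lintegral_pos_iff_support]
      · rw [Measure.restrict_apply' hB.measurableSet]
        refine (pos_iff_ne_zero.2 hne).trans_le (measure_mono ?_)
        rintro z ⟨hz, hzB, hzu⟩
        exact ⟨(ENNReal.mul_pos ((hl y hy z hz).green_pos hB).ne' hzu).ne', hzB⟩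
      · have := (measurable_green hB).comp (f := fun z => (y, z)) (by fun_prop)
        dsimp [Function.comp_def] at this
        fun_prop
    have h2 : ∀ᵐ y ∂(volume : Measure (Eu d)), y ∈ B → u y * potential B u y = 0 :=
      (ae_restrict_iff' hB.measurableSet).1 hz
    apply hne
    refine measure_mono_null ?_ (ae_iff.1 h2)
    rintro y ⟨hy, hyB, hyu⟩
    simp only [Set.mem_ofPred_eq, Classical.not_imp]
    exact ⟨hyB, (ENNReal.mul_pos hyu (hpos y hy).ne').ne'⟩
  refine (ae_restrict_iff' hB.measurableSet).2 (ae_iff.2 ?_)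
  convert hgoal using 2
  ext x
  simp

/-- On a connected set, potentials of nonzero functions are strictly positive. -/
lemma potential_pos {d : ℕ} {B : Set (Eu d)} (hB : IsOpen B) (hc : IsPreconnected B)
    {u : Eu d → ℝ≥0∞} (hu : Measurable u) (h0 : ¬ u =ᵐ[volume.restrict B] 0) {x : Eu d}
    (hx : x ∈ B) : 0 < potential B u x := by
  rw [pos_iff_ne_zero]
  intro hz
  apply h0
  have mg := (measurable_green hB).comp (f := fun z => (x, z)) (by fun_prop)
  dsimp [Function.comp_def] at mg
  rw [potential, lintegral_eq_zero_iff (by fun_prop)] at hz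
  filter_upwards [hz, ae_restrict_mem hB.measurableSet] with y hy hyB
  rcases mul_eq_zero.1 hy with h | h
  · exact absurd h ((linked_of_isPreconnected hB hc hx hyB).green_pos hB).ne'
  · exact h

/-! ### Integrability of the Green function near and off the diagonal -/

/-- Young's inequality for an integral kernel, by Hölder's inequality with three factors. -/
lemma lintegral_young {X : Type*} [MeasurableSpace X] (m : Measure X) [SFinite m]
    {k : X → X → ℝ≥0∞} (hk : Measurable fun z : X × X => k z.1 z.2) {A : ℝ≥0∞} {a b c : ℝ}
    (ha : 0 < a) (hb : 0 < b) (hc : 0 < c) (ha1 : a ≤ 1) (hb1 : b ≤ 1) (hc1 : c ≤ 1)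
    (habc : a + b + c = 2)
    (hk1 : ∀ x, ∫⁻ y, k x y ^ c⁻¹ ∂m ≤ A) (hk2 : ∀ y, ∫⁻ x, k x y ^ c⁻¹ ∂m ≤ A)
    {u v : X → ℝ≥0∞} (hu : Measurable u) (hv : Measurable v) :
    ∫⁻ x, ∫⁻ y, u x * k x y * v y ∂m ∂m ≤
      A ^ c * (∫⁻ x, u x ^ a⁻¹ ∂m) ^ a * (∫⁻ x, v x ^ b⁻¹ ∂m) ^ b := by
  set U := ∫⁻ x, u x ^ a⁻¹ ∂m
  set V := ∫⁻ x, v x ^ b⁻¹ ∂m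
  let f : Fin 3 → X × X → ℝ≥0∞ := ![fun z => u z.1 ^ a⁻¹ * k z.1 z.2 ^ c⁻¹,
    fun z => k z.1 z.2 ^ c⁻¹ * v z.2 ^ b⁻¹, fun z => u z.1 ^ a⁻¹ * v z.2 ^ b⁻¹]
  let e : Fin 3 → ℝ := ![1 - b, 1 - a, 1 - c]
  have hf : ∀ i ∈ (Finset.univ : Finset (Fin 3)), AEMeasurable (f i) (m.prod m) := by
    intro i _
    fin_cases i
    · exact Measurable.aemeasurable (by dsimp [f]; fun_prop)
    · exact Measurable.aemeasurable (by dsimp [f]; fun_prop)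
    · exact Measurable.aemeasurable (by dsimp [f]; fun_prop)
  have h := ENNReal.lintegral_prod_norm_pow_le (μ := m.prod m) Finset.univ hf (p := e)
    (by simp [Fin.sum_univ_three, e]; linarith)
    (by intro i _; fin_cases i <;> simp [e] <;> linarith)
  simp only [Fin.prod_univ_three, f, e, Matrix.cons_val_zero, Matrix.cons_val_one,
    Matrix.cons_val_two, Matrix.head_cons, Matrix.tail_cons] at h
  have hpt : ∀ z : X × X, (u z.1 ^ a⁻¹ * k z.1 z.2 ^ c⁻¹) ^ (1 - b) *
      (k z.1 z.2 ^ c⁻¹ * v z.2 ^ b⁻¹) ^ (1 - a) * (u z.1 ^ a⁻¹ * v z.2 ^ b⁻¹) ^ (1 - c) =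
      u z.1 * k z.1 z.2 * v z.2 := by
    intro z
    have e1 : ∀ (t : ℝ≥0∞) (p q r : ℝ), 0 < p → 0 ≤ q → 0 ≤ r → q + r = p →
        (t ^ p⁻¹) ^ q * (t ^ p⁻¹) ^ r = t := by
      intro t p q r hp hq hr hqr
      rw [← ENNReal.rpow_add_of_nonneg _ _ hq hr, hqr, ENNReal.rpow_inv_rpow hp.ne']
    rw [ENNReal.mul_rpow_of_nonneg _ _ (by linarith), ENNReal.mul_rpow_of_nonneg _ _ (by linarith),
      ENNReal.mul_rpow_of_nonneg _ _ (by linarith)]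
    calc _ = ((u z.1 ^ a⁻¹) ^ (1 - b) * (u z.1 ^ a⁻¹) ^ (1 - c)) *
        ((k z.1 z.2 ^ c⁻¹) ^ (1 - b) * (k z.1 z.2 ^ c⁻¹) ^ (1 - a)) *
        ((v z.2 ^ b⁻¹) ^ (1 - a) * (v z.2 ^ b⁻¹) ^ (1 - c)) := by ring
      _ = _ := by
        rw [e1 _ _ _ _ ha (by linarith) (by linarith) (by linarith),
          e1 _ _ _ _ hc (by linarith) (by linarith) (by linarith),
          e1 _ _ _ _ hb (by linarith) (by linarith) (by linarith)]
  have hku : ∫⁻ z, u z.1 ^ a⁻¹ * k z.1 z.2 ^ c⁻¹ ∂(m.prod m) ≤ U * A := by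
    rw [lintegral_prod _ (by fun_prop)]
    rw [← lintegral_mul_const _ (by fun_prop)]
    refine lintegral_mono fun x => ?_
    have := hk.comp (f := fun y => (x, y)) (by fun_prop)
    dsimp [Function.comp_def] at this
    dsimp only
    rw [lintegral_const_mul _ (by fun_prop)]
    exact mul_le_mul' le_rfl (hk1 x)
  have hkv : ∫⁻ z, k z.1 z.2 ^ c⁻¹ * v z.2 ^ b⁻¹ ∂(m.prod m) ≤ A * V := by
    rw [lintegral_prod_symm _ (by fun_prop)]
    rw [← lintegral_const_mul _ (by fun_prop)]
    refine lintegral_mono fun y => ?_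
    have := hk.comp (f := fun x => (x, y)) (by fun_prop)
    dsimp [Function.comp_def] at this
    dsimp only
    rw [lintegral_mul_const _ (by fun_prop)]
    exact mul_le_mul' (hk2 y) le_rfl
  have huv : ∫⁻ z, u z.1 ^ a⁻¹ * v z.2 ^ b⁻¹ ∂(m.prod m) = U * V :=
    lintegral_prod_mul (f := fun x => u x ^ a⁻¹) (g := fun x => v x ^ b⁻¹)
      (by fun_prop) (by fun_prop)
  have e2 : ∀ (t : ℝ≥0∞) (p q r : ℝ), 0 ≤ q → 0 ≤ r → q + r = p → t ^ q * t ^ r = t ^ p := by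
    intro t p q r hq hr hqr
    rw [← ENNReal.rpow_add_of_nonneg _ _ hq hr, hqr]
  calc ∫⁻ x, ∫⁻ y, u x * k x y * v y ∂m ∂m
      = ∫⁻ z, (u z.1 ^ a⁻¹ * k z.1 z.2 ^ c⁻¹) ^ (1 - b) *
      (k z.1 z.2 ^ c⁻¹ * v z.2 ^ b⁻¹) ^ (1 - a) *
        (u z.1 ^ a⁻¹ * v z.2 ^ b⁻¹) ^ (1 - c) ∂(m.prod m) := by
        simp_rw [hpt]
        rw [lintegral_prod _ (by fun_prop)]
    _ ≤ (U * A) ^ (1 - b) * (A * V) ^ (1 - a) * (U * V) ^ (1 - c) := by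
        refine h.trans ?_
        rw [huv]
        gcongr
    _ = (A ^ (1 - b) * A ^ (1 - a)) * (U ^ (1 - b) * U ^ (1 - c)) *
        (V ^ (1 - a) * V ^ (1 - c)) := by
        rw [ENNReal.mul_rpow_of_nonneg _ _ (by linarith),
          ENNReal.mul_rpow_of_nonneg _ _ (by linarith),
          ENNReal.mul_rpow_of_nonneg _ _ (by linarith)]
        ring
    _ = _ := by
        rw [e2 _ c _ _ (by linarith) (by linarith) (by linarith),
          e2 _ a _ _ (by linarith) (by linarith) (by linarith),
          e2 _ b _ _ (by linarith) (by linarith) (by linarith)]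

lemma lintegral_gaussKernel_rpow_le {d : ℕ} {s : ℝ} (hs : 0 < s) {c : ℝ} (hc : 0 < c) (hc1 : c ≤ 1)
    (x : Eu d) :
    ∫⁻ y, gaussKernel s x y ^ c⁻¹ ≤
      ENNReal.ofReal ((2 * Real.pi * s) ^ (-(d : ℝ) / 2)) ^ (c⁻¹ - 1) := by
  have h1 : 0 ≤ c⁻¹ - 1 := by
    rw [sub_nonneg]; exact (one_le_inv₀ hc).2 hc1
  calc ∫⁻ y, gaussKernel s x y ^ c⁻¹ ≤ ∫⁻ y, gaussKernel s x y *
        ENNReal.ofReal ((2 * Real.pi * s) ^ (-(d : ℝ) / 2)) ^ (c⁻¹ - 1) := by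
        refine lintegral_mono fun y => ?_
        have : gaussKernel s x y ^ c⁻¹ = gaussKernel s x y ^ (1 : ℝ) *
            gaussKernel s x y ^ (c⁻¹ - 1) := by
          rw [← ENNReal.rpow_add_of_nonneg _ _ zero_le_one h1]; congr 1; ring
        rw [this, ENNReal.rpow_one]
        gcongr
        exact gaussKernel_le hs x y
    _ = _ := by
        rw [lintegral_mul_const _ (measurable_gaussKernel_right _ _), lintegral_gaussKernel hs,
          one_mul]

/-- The `L^α × L^β` bound for the part of the Green energy that stems from the times up to `ε`; the
constant is finite if `(d / 2) (1 - c) < 1`. Here `α = 1 / a` and `β = 1 / b`, while `1 / c` is the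
exponent of integrability of the Gaussian kernel. -/
lemma nearEnergy_le {d : ℕ} {B : Set (Eu d)} (hB : IsOpen B) {a b c : ℝ}
    (ha : 0 < a) (hb : 0 < b) (hc : 0 < c) (ha1 : a ≤ 1) (hb1 : b ≤ 1) (hc1 : c ≤ 1)
    (habc : a + b + c = 2) {u v : Eu d → ℝ≥0∞} (hu : Measurable u) (hv : Measurable v) (ε : ℝ) :
    ∫⁻ x in B, u x * ∫⁻ y in B, (∫⁻ s in Set.Ioc 0 ε, killedKernel B s x y) * v y ≤
      (∫⁻ s in Set.Ioc 0 ε, ENNReal.ofReal ((2 * Real.pi * s) ^ (-(d : ℝ) / 2 * (1 - c)))) *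
        ((∫⁻ x in B, u x ^ a⁻¹) ^ a * (∫⁻ x in B, v x ^ b⁻¹) ^ b) := by
  rw [lintegral_timePart hB _ hu hv, ← lintegral_mul_const _ (by fun_prop)]
  refine setLIntegral_mono (by fun_prop) fun s hs => ?_
  have hs0 : 0 < s := hs.1
  have mp : Measurable fun z : Eu d × Eu d => killedKernel B s z.1 z.2 :=
    (measurable_killedKernel hB).comp (f := fun w : Eu d × Eu d => (s, w)) (by fun_prop)
  have h1 : ∀ x : Eu d, ∫⁻ y in B, killedKernel B s x y ^ c⁻¹ ≤
      ENNReal.ofReal ((2 * Real.pi * s) ^ (-(d : ℝ) / 2)) ^ (c⁻¹ - 1) := by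
    intro x
    refine le_trans (setLIntegral_le_lintegral _ _) (le_trans (lintegral_mono fun y => ?_)
      (lintegral_gaussKernel_rpow_le hs0 hc hc1 x))
    exact ENNReal.rpow_le_rpow (killedKernel_le_gauss B s x y) (by positivity)
  have h2 : ∀ y : Eu d, ∫⁻ x in B, killedKernel B s x y ^ c⁻¹ ≤
      ENNReal.ofReal ((2 * Real.pi * s) ^ (-(d : ℝ) / 2)) ^ (c⁻¹ - 1) := by
    intro y
    simp_rw [fun x => killedKernel_symm B s x y]
    exact h1 y
  refine (lintegral_young _ mp ha hb hc ha1 hb1 hc1 habc h1 h2 hu hv).trans (le_of_eq ?_)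
  rw [mul_assoc]
  congr 1
  have hp : 0 < (2 * Real.pi * s) ^ (-(d : ℝ) / 2) := by positivity
  rw [← ENNReal.rpow_mul, ENNReal.ofReal_rpow_of_pos hp, ← Real.rpow_mul (by positivity)]
  congr 3
  field_simp

lemma lintegral_Ioc_rpow_ne_top {κ : ℝ} (hκ : -1 < κ) (ε : ℝ) :
    ∫⁻ s in Set.Ioc 0 ε, ENNReal.ofReal ((2 * Real.pi * s) ^ κ) ≠ ∞ := by
  rcases le_or_gt ε 0 with h | h
  · simp [Set.Ioc_eq_empty_of_le h]
  have h1 : IntervalIntegrable (fun s : ℝ => s ^ κ) volume 0 ε :=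
    intervalIntegral.intervalIntegrable_rpow' hκ
  rw [intervalIntegrable_iff_integrableOn_Ioc_of_le h.le] at h1
  have h2 : IntegrableOn (fun s : ℝ => (2 * Real.pi * s) ^ κ) (Set.Ioc 0 ε) := by
    refine (h1.const_mul ((2 * Real.pi) ^ κ)).congr ?_
    filter_upwards [ae_restrict_mem measurableSet_Ioc] with s hs
    rw [Real.mul_rpow (by positivity) hs.1.le]
  have h3 := h2.2
  rw [hasFiniteIntegral_iff_ofReal] at h3
  · exact h3.ne
  · filter_upwards [ae_restrict_mem measurableSet_Ioc] with s hs
    have := hs.1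
    positivity

lemma exists_lintegral_Ioc_rpow_le {κ : ℝ} (hκ : -1 < κ) {δ : ℝ≥0∞} (hδ : δ ≠ 0) :
    ∃ ε > 0, ∫⁻ s in Set.Ioc 0 ε, ENNReal.ofReal ((2 * Real.pi * s) ^ κ) ≤ δ := by
  have h1 := lintegral_Ioc_rpow_ne_top hκ 1
  obtain ⟨η, hη, h2⟩ := exists_pos_setLIntegral_lt_of_measure_lt h1 hδ
  obtain ⟨ε, hε, hεη⟩ : ∃ ε : ℝ, 0 < ε ∧ ENNReal.ofReal ε < η := by
    obtain ⟨r, hr, hrη⟩ := ENNReal.lt_iff_exists_nnreal_btwn.1 hη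
    exact ⟨r, by exact_mod_cast hr, by simpa using hrη⟩
  refine ⟨min ε 1, by positivity, ?_⟩
  have h3 := h2 (Set.Ioc 0 (min ε 1)) ((Measure.restrict_apply_le _ _).trans_lt ?_)
  · rw [Measure.restrict_restrict measurableSet_Ioc,
      Set.inter_eq_self_of_subset_left (Set.Ioc_subset_Ioc_right (min_le_right _ _))] at h3
    exact h3.le
  · rw [Real.volume_Ioc]
    refine lt_of_le_of_lt (ENNReal.ofReal_le_ofReal ?_) hεη
    simp

/-- In a bounded set, the semigroup property improves a polynomial decay in time. -/
lemma killedKernel_le_improve {d : ℕ} {B : Set (Eu d)} (hB : IsOpen B) (hbdd : volume B ≠ ∞)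
    {C r : ℝ} (hC : 0 ≤ C)
    (h : ∀ s, 0 < s → ∀ x y, killedKernel B s x y ≤ ENNReal.ofReal (C * s ^ (-r))) :
    ∃ C', 0 ≤ C' ∧
      ∀ s, 0 < s → ∀ x y, killedKernel B s x y ≤ ENNReal.ofReal (C' * s ^ (-(2 * r))) := by
  refine ⟨C ^ 2 * (1 / 2) ^ (-(2 * r)) * (volume B).toReal, by positivity, fun s hs x y => ?_⟩
  rw [killedKernel_comp hB hs]
  calc ∫⁻ z in B, killedKernel B (s / 2) x z * killedKernel B (s / 2) z y
      ≤ ∫⁻ z in B, ENNReal.ofReal (C * (s / 2) ^ (-r)) * ENNReal.ofReal (C * (s / 2) ^ (-r)) :=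
        lintegral_mono fun z => mul_le_mul' (h _ (half_pos hs) x z) (h _ (half_pos hs) z y)
    _ = _ := by
      rw [lintegral_const, Measure.restrict_apply_univ, ← ENNReal.ofReal_mul (by positivity)]
      conv_lhs => rw [← ENNReal.ofReal_toReal hbdd]
      rw [← ENNReal.ofReal_mul (by positivity)]
      congr 1
      have e1 : (s / 2) ^ (-r) * (s / 2) ^ (-r) = (1 / 2) ^ (-(2 * r)) * s ^ (-(2 * r)) := by
        rw [← Real.rpow_add (by positivity), ← Real.mul_rpow (by positivity) hs.le]
        congr 1 <;> ring
      calc _ = C ^ 2 * ((s / 2) ^ (-r) * (s / 2) ^ (-r)) * (volume B).toReal := by ring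
        _ = _ := by rw [e1]; ring

/-- The killed kernel is integrable at infinity in time, uniformly in space. -/
lemma exists_farKernel_le {d : ℕ} (hd : 1 ≤ d) {B : Set (Eu d)} (hB : IsOpen B)
    (hbdd : d ≤ 2 → Bornology.IsBounded B) {ε : ℝ} (hε : 0 < ε) :
    ∃ C : ℝ≥0∞, C ≠ ∞ ∧ ∀ x y, ∫⁻ s in Set.Ioi ε, killedKernel B s x y ≤ C := by
  have h0 : ∀ s, 0 < s → ∀ x y, killedKernel B s x y ≤
      ENNReal.ofReal ((2 * Real.pi) ^ (-(d : ℝ) / 2) * s ^ (-((d : ℝ) / 2))) := by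
    intro s hs x y
    refine ((killedKernel_le_gauss B s x y).trans (gaussKernel_le hs x y)).trans (le_of_eq ?_)
    rw [Real.mul_rpow (by positivity) hs.le, neg_div]
  obtain ⟨C, r, hC, hr, h⟩ : ∃ C r : ℝ, 0 ≤ C ∧ 1 < r ∧ ∀ s, 0 < s → ∀ x y,
      killedKernel B s x y ≤ ENNReal.ofReal (C * s ^ (-r)) := by
    rcases le_or_gt d 2 with h2 | h2
    · have hv : volume B ≠ ∞ := (hbdd h2).measure_lt_top.ne
      obtain ⟨C1, hC1, h1⟩ := killedKernel_le_improve hB hv (by positivity) h0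
      obtain ⟨C2, hC2, h2⟩ := killedKernel_le_improve hB hv hC1 h1
      refine ⟨C2, _, hC2, ?_, h2⟩
      have : (1 : ℝ) ≤ d := by exact_mod_cast hd
      linarith
    · refine ⟨_, _, by positivity, ?_, h0⟩
      have : (3 : ℝ) ≤ d := by exact_mod_cast h2
      linarith
  refine ⟨∫⁻ s in Set.Ioi ε, ENNReal.ofReal (C * s ^ (-r)), ?_, fun x y =>
    setLIntegral_mono (by fun_prop) fun s hs => h s (hε.trans hs) x y⟩
  have h3 := ((integrableOn_Ioi_rpow_of_lt (by linarith : -r < -1) hε).const_mul C).2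
  rw [hasFiniteIntegral_iff_ofReal] at h3
  · exact h3.ne
  · filter_upwards [ae_restrict_mem measurableSet_Ioi] with s hs
    have : 0 < s := hε.trans hs
    positivity

/-! ### Potentials of functions in `L^q` with support in a set of finite measure -/

lemma setLIntegral_eq_of_support {X : Type*} [MeasurableSpace X] {m : Measure X} {S B : Set X}
    (hS : MeasurableSet S) (hSB : S ⊆ B) {f : X → ℝ≥0∞} (hf : ∀ x ∉ S, f x = 0) :
    ∫⁻ x in B, f x ∂m = ∫⁻ x in S, f x ∂m := by
  have : S.indicator f = f := Set.indicator_eq_self.2 fun x hx => by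
    by_contra h
    exact hx (hf x h)
  rw [← this, lintegral_indicator hS, Measure.restrict_restrict hS,
    Set.inter_eq_self_of_subset_left hSB, setLIntegral_congr_fun hS fun x hx => ?_]
  rw [Set.indicator_of_mem hx]

lemma rpow_le_one_add_rpow (t : ℝ≥0∞) {r s : ℝ} (hr : 0 ≤ r) (hrs : r ≤ s) :
    t ^ r ≤ 1 + t ^ s := by
  rcases le_total t 1 with h | h
  · exact (ENNReal.rpow_le_one h hr).trans le_self_add
  · exact (ENNReal.rpow_le_rpow_of_exponent_le h hrs).trans le_add_self

lemma lintegral_rpow_le_of_support {d : ℕ} {B S : Set (Eu d)} (hS : MeasurableSet S)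
    {f : Eu d → ℝ≥0∞} (hf : ∀ x ∉ S, f x = 0) {r s : ℝ} (hr : 0 < r) (hrs : r ≤ s) :
    ∫⁻ x in B, f x ^ r ≤ volume S + ∫⁻ x in B, f x ^ s := by
  calc ∫⁻ x in B, f x ^ r ≤ ∫⁻ x in B, (S.indicator 1 x + f x ^ s) := by
        refine lintegral_mono fun x => ?_
        by_cases hx : x ∈ S
        · simpa [hx] using rpow_le_one_add_rpow (f x) hr.le hrs
        · simp [hx, hf x hx, ENNReal.zero_rpow_of_pos hr]
    _ = volume.restrict B S + ∫⁻ x in B, f x ^ s := by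
        rw [lintegral_add_left (measurable_one.indicator hS), lintegral_indicator_one hS]
    _ ≤ _ := by gcongr; exact Measure.restrict_le_self

/-- The contribution of the times up to `ε` to the Green energy of functions in a ball of
`L^{1/b}` is small, uniformly. -/
lemma exists_nearEnergy_le {d : ℕ} {B S : Set (Eu d)} (hB : IsOpen B) (hS : MeasurableSet S)
    (hvS : volume S ≠ ∞) {a b c : ℝ} (hb : 0 < b) (hc : 0 < c) (ha1 : a ≤ 1) (hab : b ≤ a)
    (hc1 : c ≤ 1) (habc : a + b + c = 2) (hdc : -1 < -(d : ℝ) / 2 * (1 - c))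
    {Q : ℝ≥0∞} (hQ : Q ≠ ∞) {δ : ℝ≥0∞} (hδ : δ ≠ 0) :
    ∃ ε > 0, ∀ f : Eu d → ℝ≥0∞, Measurable f → (∀ x ∉ S, f x = 0) →
      ∫⁻ x in B, f x ^ b⁻¹ ≤ Q →
      ∫⁻ x in B, f x * ∫⁻ y in B, (∫⁻ s in Set.Ioc 0 ε, killedKernel B s x y) * f y ≤ δ := by
  have ha : 0 < a := hb.trans_le hab
  set T : ℝ≥0∞ := (volume S + Q) ^ a * Q ^ b with hT
  have hTfin : T ≠ ∞ := ENNReal.mul_ne_top (ENNReal.rpow_ne_top_of_nonneg ha.le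
    (ENNReal.add_ne_top.2 ⟨hvS, hQ⟩)) (ENNReal.rpow_ne_top_of_nonneg hb.le hQ)
  have hT1 : T + 1 ≠ ∞ := by simp [hTfin]
  obtain ⟨ε, hε, h⟩ := exists_lintegral_Ioc_rpow_le hdc (δ := δ / (T + 1))
    (by simp [ENNReal.div_eq_zero_iff, hδ, hT1])
  refine ⟨ε, hε, fun f hf hfS hfQ => ?_⟩
  refine (nearEnergy_le hB ha hb hc ha1 (hab.trans ha1) hc1 habc hf hf ε).trans ?_
  have h1 : (∫⁻ x in B, f x ^ a⁻¹) ^ a * (∫⁻ x in B, f x ^ b⁻¹) ^ b ≤ T := by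
    rw [hT]
    gcongr
    refine (lintegral_rpow_le_of_support hS hfS (by positivity)
      (inv_anti₀ hb hab)).trans ?_
    exact add_le_add le_rfl hfQ
  calc _ ≤ δ / (T + 1) * (T + 1) := mul_le_mul' h (h1.trans le_self_add)
    _ = δ := ENNReal.div_mul_cancel (by simp) hT1

/-- If the pairing of `h` with functions on `S` is bounded by a multiple of their norm in
`L^{1/a}`, then the `L^{1/(1-a)}` norm of `h` over `S` is bounded. -/
lemma lintegral_rpow_le_of_pairing {X : Type*} [MeasurableSpace X] {m : Measure X} {S : Set X}
    (hS : MeasurableSet S) (hvS : m S ≠ ∞) {a : ℝ} (ha : 0 < a) (ha1 : a < 1) {h : X → ℝ≥0∞}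
    (hh : Measurable h) {C : ℝ≥0∞} (H : ∀ v : X → ℝ≥0∞, Measurable v →
      ∫⁻ x, v x * h x ∂m ≤ C * (∫⁻ x, v x ^ a⁻¹ ∂m) ^ a) :
    ∫⁻ x in S, h x ^ (1 - a)⁻¹ ∂m ≤ C ^ (1 - a)⁻¹ := by
  set r : ℝ := (1 - a)⁻¹ with hr
  have h1a : 0 < 1 - a := by linarith
  have hr0 : 0 < r := by positivity
  have hr1 : 0 ≤ r - 1 := by
    rw [sub_nonneg, hr]; exact (one_le_inv₀ h1a).2 (by linarith)
  have hra : (r - 1) * a⁻¹ = r := by rw [hr]; field_simp; ring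
  -- test with the power `r - 1` of the truncations of `h`
  have key : ∀ M : ℕ, ∫⁻ x in S, (min (h x) M) ^ r ∂m ≤ C ^ r := by
    intro M
    set Y := ∫⁻ x in S, (min (h x) M) ^ r ∂m with hY
    have hYfin : Y ≠ ∞ := by
      have : Y ≤ ∫⁻ x in S, (M : ℝ≥0∞) ^ r ∂m :=
        lintegral_mono fun x => ENNReal.rpow_le_rpow (min_le_right _ _) hr0.le
      refine ne_top_of_le_ne_top ?_ this
      rw [setLIntegral_const]
      exact ENNReal.mul_ne_top (ENNReal.rpow_ne_top_of_nonneg hr0.le (by simp)) hvS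
    have h1 := H (S.indicator fun x => (min (h x) M) ^ (r - 1))
      (Measurable.indicator (by fun_prop) hS)
    have h2 : ∫⁻ x, (S.indicator (fun x => (min (h x) M) ^ (r - 1)) x) ^ a⁻¹ ∂m = Y := by
      rw [hY, ← lintegral_indicator hS]
      refine lintegral_congr fun x => ?_
      by_cases hx : x ∈ S
      · simp only [hx, Set.indicator_of_mem]
        rw [← ENNReal.rpow_mul, hra]
      · simp [hx, ENNReal.zero_rpow_of_pos (inv_pos.2 ha)]
    have h3 : Y ≤ ∫⁻ x, S.indicator (fun x => (min (h x) M) ^ (r - 1)) x * h x ∂m := by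
      rw [hY, ← lintegral_indicator hS]
      refine lintegral_mono fun x => ?_
      by_cases hx : x ∈ S
      · simp only [hx, Set.indicator_of_mem]
        calc min (h x) ↑M ^ r = min (h x) ↑M ^ (r - 1) * min (h x) ↑M ^ (1 : ℝ) := by
              rw [← ENNReal.rpow_add_of_nonneg _ _ hr1 zero_le_one, sub_add_cancel]
          _ ≤ _ := by
              rw [ENNReal.rpow_one]
              gcongr
              exact min_le_left _ _
      · simp [hx]
    rw [h2] at h1
    have h4 : Y ≤ C * Y ^ a := h3.trans h1
    rcases eq_or_ne Y 0 with h0 | h0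
    · rw [h0]; exact zero_le
    have h5 : Y ^ (1 - a) ≤ C := by
      have e : Y = Y ^ (1 - a) * Y ^ a := by
        rw [← ENNReal.rpow_add _ _ h0 hYfin, sub_add_cancel, ENNReal.rpow_one]
      rw [e] at h4
      have n0 : Y ^ a ≠ 0 := (ENNReal.rpow_pos (pos_iff_ne_zero.2 h0) hYfin).ne'
      have nt : Y ^ a ≠ ∞ := ENNReal.rpow_ne_top_of_nonneg ha.le hYfin
      rw [← e] at h4
      nth_rewrite 1 [e] at h4
      exact (ENNReal.mul_le_mul_iff_left n0 nt).1 h4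
    calc Y = (Y ^ (1 - a)) ^ r := by rw [hr, ENNReal.rpow_rpow_inv h1a.ne']
      _ ≤ C ^ r := ENNReal.rpow_le_rpow h5 hr0.le
  have hlim : Tendsto (fun M : ℕ => ∫⁻ x in S, (min (h x) M) ^ r ∂m) atTop
      (𝓝 (∫⁻ x in S, h x ^ r ∂m)) := by
    refine lintegral_tendsto_of_tendsto_of_monotone (fun M => by fun_prop) ?_ ?_
    · refine ae_of_all _ fun x M N hMN => ?_
      dsimp only
      gcongr
    · refine ae_of_all _ fun x => ?_
      have h1 : Tendsto (fun M : ℕ => min (h x) (M : ℝ≥0∞)) atTop (𝓝 (min (h x) ∞)) :=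
        tendsto_const_nhds.min ENNReal.tendsto_nat_nhds_top
      rw [min_eq_left le_top] at h1
      exact (ENNReal.continuous_rpow_const.tendsto _).comp h1
  exact le_of_tendsto' hlim key

lemma potential_eq_add {d : ℕ} {B : Set (Eu d)} (hB : IsOpen B) {ε : ℝ} (hε : 0 < ε)
    {f : Eu d → ℝ≥0∞} (hf : Measurable f) (x : Eu d) :
    potential B f x = (∫⁻ y in B, (∫⁻ s in Set.Ioc 0 ε, killedKernel B s x y) * f y) +
      ∫⁻ y in B, (∫⁻ s in Set.Ioi ε, killedKernel B s x y) * f y := by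
  have mI : Measurable fun y => ∫⁻ s in Set.Ioc 0 ε, killedKernel B s x y := by
    refine Measurable.lintegral_prod_right' (ν := volume.restrict (Set.Ioc 0 ε))
      (f := fun w : Eu d × ℝ => killedKernel B w.2 x w.1) ?_
    exact (measurable_killedKernel hB).comp (f := fun w : Eu d × ℝ => (w.2, x, w.1)) (by fun_prop)
  rw [← lintegral_add_left (by fun_prop)]
  refine lintegral_congr fun y => ?_
  rw [← add_mul, green, ← Set.Ioc_union_Ioi_eq_Ioi hε.le,
    lintegral_union measurableSet_Ioi (Set.Ioc_disjoint_Ioi le_rfl)]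

/-- Potentials of functions in a ball of `L^{1/b}` are bounded in `L^{1/(1-a)}(S)`. -/
lemma exists_lintegral_potential_rpow_le {d : ℕ} (hd : 1 ≤ d) {B S : Set (Eu d)} (hB : IsOpen B)
    (hbdd : d ≤ 2 → Bornology.IsBounded B) (hS : MeasurableSet S) (hvS : volume S ≠ ∞)
    {a b c : ℝ} (hb : 0 < b) (hc : 0 < c) (ha1 : a < 1) (hab : b ≤ a)
    (hc1 : c ≤ 1) (habc : a + b + c = 2) (hdc : -1 < -(d : ℝ) / 2 * (1 - c))
    {Q : ℝ≥0∞} (hQ : Q ≠ ∞) :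
    ∃ C : ℝ≥0∞, C ≠ ∞ ∧ ∀ f : Eu d → ℝ≥0∞, Measurable f → (∀ x ∉ S, f x = 0) →
      ∫⁻ x in B, f x ^ b⁻¹ ≤ Q → ∫⁻ x in S ∩ B, potential B f x ^ (1 - a)⁻¹ ≤ C := by
  have ha : 0 < a := hb.trans_le hab
  have hr0 : 0 < (1 - a)⁻¹ := inv_pos.2 (by linarith)
  have hr1 : 1 ≤ (1 - a)⁻¹ := (one_le_inv₀ (by linarith)).2 (by linarith)
  obtain ⟨C1, hC1, h1⟩ := exists_farKernel_le hd hB hbdd one_pos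
  have hb1 : b ≤ 1 := by linarith
  set κ := ∫⁻ s in Set.Ioc (0 : ℝ) 1, ENNReal.ofReal ((2 * Real.pi * s) ^ (-(d : ℝ) / 2 * (1 - c)))
  have hκ : κ ≠ ∞ := lintegral_Ioc_rpow_ne_top hdc 1
  set D : ℝ≥0∞ := (κ * Q ^ b) ^ (1 - a)⁻¹
  have hD : D ≠ ∞ := ENNReal.rpow_ne_top_of_nonneg hr0.le
    (ENNReal.mul_ne_top hκ (ENNReal.rpow_ne_top_of_nonneg hb.le hQ))
  set F : ℝ≥0∞ := (C1 * (volume S + Q)) ^ (1 - a)⁻¹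
  have hF : F ≠ ∞ := ENNReal.rpow_ne_top_of_nonneg hr0.le
    (ENNReal.mul_ne_top hC1 (ENNReal.add_ne_top.2 ⟨hvS, hQ⟩))
  refine ⟨2 ^ ((1 - a)⁻¹ - 1) * (D + F * volume S), ENNReal.mul_ne_top
    (ENNReal.rpow_ne_top_of_nonneg (by linarith) (by simp)) (ENNReal.add_ne_top.2
      ⟨hD, ENNReal.mul_ne_top hF hvS⟩), fun f hf hfS hfQ => ?_⟩
  set n : Eu d → ℝ≥0∞ := fun x =>
    ∫⁻ y in B, (∫⁻ s in Set.Ioc 0 1, killedKernel B s x y) * f y with hn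
  have mn : Measurable n := by
    refine Measurable.lintegral_prod_right' (ν := volume.restrict B) (f := fun z : Eu d × Eu d =>
      (∫⁻ s in Set.Ioc 0 1, killedKernel B s z.1 z.2) * f z.2) ?_
    refine Measurable.mul ?_ (by fun_prop)
    refine Measurable.lintegral_prod_right' (ν := volume.restrict (Set.Ioc 0 1))
      (f := fun w : (Eu d × Eu d) × ℝ => killedKernel B w.2 w.1.1 w.1.2) ?_
    exact (measurable_killedKernel hB).comp
      (f := fun w : (Eu d × Eu d) × ℝ => (w.2, w.1.1, w.1.2)) (by fun_prop)
  have hnear : ∫⁻ x in S, n x ^ (1 - a)⁻¹ ∂(volume.restrict B) ≤ D := by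
    refine lintegral_rpow_le_of_pairing hS
      (ne_top_of_le_ne_top hvS (Measure.restrict_apply_le _ _)) ha ha1 mn fun v hv => ?_
    refine (nearEnergy_le hB ha hb hc ha1.le hb1 hc1 habc hv hf 1).trans ?_
    rw [mul_assoc, mul_comm (Q ^ b)]
    gcongr
  have hfar : ∀ x, ∫⁻ y in B, (∫⁻ s in Set.Ioi 1, killedKernel B s x y) * f y ≤
      C1 * (volume S + Q) := by
    intro x
    calc _ ≤ ∫⁻ y in B, C1 * f y := lintegral_mono fun y => mul_le_mul' (h1 x y) le_rfl
      _ = C1 * ∫⁻ y in B, f y ^ (1 : ℝ) := by rw [lintegral_const_mul _ hf]; simp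
      _ ≤ _ := by
        gcongr
        refine (lintegral_rpow_le_of_support hS hfS one_pos ((one_le_inv₀ hb).2 hb1)).trans ?_
        gcongr
  rw [Measure.restrict_restrict hS] at hnear
  calc ∫⁻ x in S ∩ B, potential B f x ^ (1 - a)⁻¹
      ≤ ∫⁻ x in S ∩ B, 2 ^ ((1 - a)⁻¹ - 1) * (n x ^ (1 - a)⁻¹ + F) := by
        refine lintegral_mono fun x => ?_
        rw [potential_eq_add hB one_pos hf]
        refine (ENNReal.rpow_add_le_mul_rpow_add_rpow _ _ hr1).trans ?_
        gcongr
        exact ENNReal.rpow_le_rpow (hfar x) hr0.le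
    _ = 2 ^ ((1 - a)⁻¹ - 1) * ((∫⁻ x in S ∩ B, n x ^ (1 - a)⁻¹) + F * volume (S ∩ B)) := by
        rw [lintegral_const_mul _ (by fun_prop), lintegral_add_left (by fun_prop),
          setLIntegral_const]
    _ ≤ _ := by
        gcongr
        exact Set.inter_subset_left

/-- Bounded sequences in `L^q`, `1 < q < ∞`, have weakly convergent subsequences; here weak
convergence means that all pairings with functions in the dual space converge. -/
lemma exists_weak_subseq {X : Type*} [MeasurableSpace X] [MeasurableSpace.CountablyGenerated X]
    (m : Measure X) [IsFiniteMeasure m] {p q : ℝ} (hpq : p.HolderConjugate q) {F : ℕ → X → ℝ}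
    (hF : ∀ k, Measurable (F k)) {Q : ℝ≥0∞} (hQ : Q ≠ ∞)
    (hFQ : ∀ k, ∫⁻ x, ‖F k x‖ₑ ^ q ∂m ≤ Q) :
    ∃ σ : ℕ → ℕ, StrictMono σ ∧ ∀ v : X → ℝ, MemLp v (ENNReal.ofReal p) m →
      ∃ L : ℝ, Tendsto (fun k => ∫ x, F (σ k) x * v x ∂m) atTop (𝓝 L) := by
  have hconj : (ENNReal.ofReal q).HolderConjugate (ENNReal.ofReal p) := hpq.symm.ennrealOfReal
  have hp1 : Fact (1 ≤ ENNReal.ofReal p) := ⟨by simpa using hpq.lt.le⟩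
  have hq1 : Fact (1 ≤ ENNReal.ofReal q) := ⟨by simpa using hpq.symm.lt.le⟩
  have hpt : Fact (ENNReal.ofReal p ≠ ∞) := ⟨by simp⟩
  have hq0 : ENNReal.ofReal q ≠ 0 := by simpa using hpq.symm.pos
  have hnorm : ∀ k, eLpNorm (F k) (ENNReal.ofReal q) m ≤ Q ^ (1 / q) := by
    intro k
    rw [eLpNorm_eq_lintegral_rpow_enorm_toReal hq0 (by simp),
      ENNReal.toReal_ofReal hpq.symm.pos.le]
    exact ENNReal.rpow_le_rpow (hFQ k) (by have := hpq.symm.pos; positivity)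
  have hQq : Q ^ (1 / q) ≠ ∞ :=
    ENNReal.rpow_ne_top_of_nonneg (by have := hpq.symm.pos; positivity) hQ
  have hmem : ∀ k, MemLp (F k) (ENNReal.ofReal q) m := fun k =>
    ⟨(hF k).aestronglyMeasurable, (hnorm k).trans_lt hQq.lt_top⟩
  set Φ := (ContinuousLinearMap.mul ℝ ℝ).lpPairing m (ENNReal.ofReal q) (ENNReal.ofReal p)
  set Λ : ℕ → WeakDual ℝ (Lp ℝ (ENNReal.ofReal p) m) :=
    fun k => StrongDual.toWeakDual (Φ ((hmem k).toLp (F k))) with hΛ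
  have hball : ∀ k, Λ k ∈ WeakDual.toStrongDual ⁻¹'
      Metric.closedBall (0 : StrongDual ℝ (Lp ℝ (ENNReal.ofReal p) m))
        (‖Φ‖ * (Q ^ (1 / q)).toReal) := by
    intro k
    rw [Set.mem_preimage, mem_closedBall_zero_iff]
    refine (Φ.le_opNorm _).trans ?_
    gcongr
    rw [Lp.norm_toLp]
    exact ENNReal.toReal_mono hQq (hnorm k)
  obtain ⟨L, -, σ, hσ, hlim⟩ := WeakDual.isSeqCompact_closedBall ℝ
    (Lp ℝ (ENNReal.ofReal p) m) 0 _ hball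
  refine ⟨σ, hσ, fun v hv => ⟨L (hv.toLp v), ?_⟩⟩
  have h1 := ((WeakDual.eval_continuous (hv.toLp v)).tendsto L).comp hlim
  refine h1.congr fun k => ?_
  change Φ ((hmem (σ k)).toLp (F (σ k))) (hv.toLp v) = _
  rw [ContinuousLinearMap.lpPairing_eq_integral]
  refine integral_congr_ae ?_
  filter_upwards [(hmem (σ k)).coeFn_toLp, hv.coeFn_toLp] with x h1 h2
  simp [h1, h2]

/-- Along a subsequence, the contributions of the times after `ε` to the potentials converge
everywhere, for all `ε`. -/
lemma exists_subseq_farPotential_tendsto {d : ℕ} (hd : 1 ≤ d) {B S : Set (Eu d)} (hB : IsOpen B)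
    (hbdd : d ≤ 2 → Bornology.IsBounded B) (hS : MeasurableSet S) (hSB : S ⊆ B)
    (hvS : volume S ≠ ∞) {p q : ℝ} (hpq : p.HolderConjugate q) {F : ℕ → Eu d → ℝ}
    (hF : ∀ k, Measurable (F k)) (hF0 : ∀ k x, 0 ≤ F k x) (hFS : ∀ k, ∀ x ∉ S, F k x = 0)
    {Q : ℝ≥0∞} (hQ : Q ≠ ∞) (hFQ : ∀ k, ∫⁻ x in B, ENNReal.ofReal (F k x) ^ q ≤ Q) :
    ∃ σ : ℕ → ℕ, StrictMono σ ∧ ∀ ε > 0, ∀ x, ∃ L : ℝ≥0∞, Tendsto (fun k =>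
      ∫⁻ y in B, (∫⁻ s in Set.Ioi ε, killedKernel B s x y) * ENNReal.ofReal (F (σ k) y))
      atTop (𝓝 L) := by
  have : IsFiniteMeasure (volume.restrict S) := ⟨by simpa using hvS.lt_top⟩
  have hFe : ∀ k x, ‖F k x‖ₑ = ENNReal.ofReal (F k x) := fun k x => by
    rw [Real.enorm_eq_ofReal (hF0 k x)]
  obtain ⟨σ, hσ, h⟩ := exists_weak_subseq (volume.restrict S) hpq hF hQ (fun k => by
    simp_rw [hFe]
    exact (lintegral_mono_set hSB).trans (hFQ k))
  refine ⟨σ, hσ, fun ε hε x => ?_⟩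
  obtain ⟨C, hC, hbd⟩ := exists_farKernel_le hd hB hbdd hε
  set v : Eu d → ℝ≥0∞ := fun y => ∫⁻ s in Set.Ioi ε, killedKernel B s x y with hv
  have mv : Measurable v := by
    refine Measurable.lintegral_prod_right' (ν := volume.restrict (Set.Ioi ε))
      (f := fun w : Eu d × ℝ => killedKernel B w.2 x w.1) ?_
    exact (measurable_killedKernel hB).comp (f := fun w : Eu d × ℝ => (w.2, x, w.1)) (by fun_prop)
  have hvt : ∀ y, v y ≠ ∞ := fun y => ne_top_of_le_ne_top hC (hbd x y)
  have hmem : MemLp (fun y => (v y).toReal) (ENNReal.ofReal p) (volume.restrict S) := by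
    refine MemLp.of_bound mv.ennreal_toReal.aestronglyMeasurable C.toReal (ae_of_all _ fun y => ?_)
    rw [Real.norm_of_nonneg ENNReal.toReal_nonneg]
    exact ENNReal.toReal_mono hC (hbd x y)
  obtain ⟨L, hL⟩ := h _ hmem
  refine ⟨ENNReal.ofReal L, ((ENNReal.continuous_ofReal.tendsto L).comp hL).congr fun k => ?_⟩
  have hint : Integrable (fun y => F (σ k) y * (v y).toReal) (volume.restrict S) := by
    have hq0 : ENNReal.ofReal q ≠ 0 := by simpa using hpq.symm.pos
    have hmF : MemLp (F (σ k)) (ENNReal.ofReal q) (volume.restrict S) := by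
      refine ⟨(hF _).aestronglyMeasurable, ?_⟩
      rw [eLpNorm_eq_lintegral_rpow_enorm_toReal hq0 (by simp),
        ENNReal.toReal_ofReal hpq.symm.pos.le]
      refine ENNReal.rpow_lt_top_of_nonneg (by have := hpq.symm.pos; positivity) ?_
      simp_rw [hFe]
      exact ne_top_of_le_ne_top hQ ((lintegral_mono_set hSB).trans (hFQ _))
    have hconj : (ENNReal.ofReal q).HolderConjugate (ENNReal.ofReal p) := hpq.symm.ennrealOfReal
    exact hmF.integrable_mul hmem
  rw [Function.comp_apply, ofReal_integral_eq_lintegral_ofReal hint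
    (ae_of_all _ fun y => mul_nonneg (hF0 _ _) ENNReal.toReal_nonneg)]
  have e1 : ∀ y, ENNReal.ofReal (F (σ k) y * (v y).toReal) = v y * ENNReal.ofReal (F (σ k) y) := by
    intro y
    rw [ENNReal.ofReal_mul (hF0 _ _), ENNReal.ofReal_toReal (hvt y), mul_comm]
  simp_rw [e1]
  exact (setLIntegral_eq_of_support hS hSB fun y hy => by simp [hFS _ y hy]).symm

/-! ### Duality between `ρ` and the potential -/

/-- The standing assumptions on the dimension, the domain and the test functions. -/
structure Standing {d n : ℕ} (B : Set (Eu d)) (p : ℕ) (φ : Fin n → Eu d → ℝ) : Prop where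
  one_le_d : 1 ≤ d
  one_le_n : 1 ≤ n
  one_le_p : 1 ≤ p
  subcritical : (p : ℤ) * ((d : ℤ) - 2) < (d : ℤ)
  isOpen : IsOpen B
  nonempty : B.Nonempty
  bounded : d ≤ 2 → Bornology.IsBounded B
  measurable : ∀ i, Measurable (φ i)
  nonneg : ∀ i x, 0 ≤ φ i x
  bdd : ∀ i, ∃ C : ℝ, ∀ x, φ i x ≤ C
  supp : ∀ i, HasCompactSupport (φ i) ∧ tsupport (φ i) ⊆ B

/-- A measurable nonnegative function `g` with `∫_B g^{2p} = 1`. -/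
structure Normalised {d : ℕ} (B : Set (Eu d)) (p : ℕ) (g : Eu d → ℝ) : Prop where
  measurable : Measurable g
  nonneg : ∀ x, 0 ≤ g x
  lintegral : ∫⁻ x in B, ENNReal.ofReal (g x ^ (2 * p)) = 1

/-- The function `∑ √λ_i g_i^{2p-1} φ_i`, for functions `g_i` rather than classes of functions. -/
noncomputable def mixFun {d n : ℕ} (p : ℕ) (φ : Fin n → Eu d → ℝ) (l : Fin n → ℝ)
    (g : Fin n → Eu d → ℝ) : Eu d → ℝ :=
  fun y => ∑ i, √(l i) * g i y ^ (2 * p - 1) * φ i y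

/-- The energy of `mixFun` as an extended nonnegative number. -/
noncomputable def mixEnergy {d n : ℕ} (B : Set (Eu d)) (p : ℕ) (φ : Fin n → Eu d → ℝ)
    (l : Fin n → ℝ) (g : Fin n → Eu d → ℝ) : ℝ≥0∞ :=
  mutualEnergy B (fun y => ENNReal.ofReal (mixFun p φ l g y))
    (fun y => ENNReal.ofReal (mixFun p φ l g y))

/-- The norm of `φ h` in `L^{2p}(B)`. -/
noncomputable def weightedNorm {d : ℕ} (B : Set (Eu d)) (p : ℕ) (φ : Eu d → ℝ) (h : Eu d → ℝ≥0∞) :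
    ℝ≥0∞ :=
  (∫⁻ x in B, (ENNReal.ofReal (φ x) * h x) ^ (2 * p)) ^ (1 / (2 * p : ℝ))

/-- The norm of `(φ_1 h, …, φ_n h)` in `ℓ²(L^{2p}(B))`. It is the supremum of `∫_B f h` over all
functions `f = ∑ √λ_i g_i^{2p-1} φ_i`. -/
noncomputable def totalNorm {d n : ℕ} (B : Set (Eu d)) (p : ℕ) (φ : Fin n → Eu d → ℝ)
    (h : Eu d → ℝ≥0∞) : ℝ≥0∞ :=
  (∑ i, weightedNorm B p (φ i) h ^ 2) ^ (1 / 2 : ℝ)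

section duality

variable {d n p : ℕ} {B : Set (Eu d)} {φ : Fin n → Eu d → ℝ}

lemma measurable_mixFun (hφ : ∀ i, Measurable (φ i)) {l : Fin n → ℝ} {g : Fin n → Eu d → ℝ}
    (hg : ∀ i, Measurable (g i)) : Measurable (mixFun p φ l g) := by
  unfold mixFun
  fun_prop

lemma mixFun_nonneg (hφ : ∀ i x, 0 ≤ φ i x) {l : Fin n → ℝ} {g : Fin n → Eu d → ℝ}
    (hg : ∀ i x, 0 ≤ g i x) (x : Eu d) : 0 ≤ mixFun p φ l g x :=
  Finset.sum_nonneg fun i _ => mul_nonneg (mul_nonneg (Real.sqrt_nonneg _)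
    (pow_nonneg (hg i x) _)) (hφ i x)

lemma ofReal_mixFun (hφ : ∀ i x, 0 ≤ φ i x) {l : Fin n → ℝ} {g : Fin n → Eu d → ℝ}
    (hg : ∀ i x, 0 ≤ g i x) (x : Eu d) :
    ENNReal.ofReal (mixFun p φ l g x) = ∑ i, ENNReal.ofReal √(l i) *
      (ENNReal.ofReal (g i x ^ (2 * p - 1)) * ENNReal.ofReal (φ i x)) := by
  rw [mixFun, ENNReal.ofReal_sum_of_nonneg]
  · refine Finset.sum_congr rfl fun i _ => ?_
    rw [mul_assoc, ENNReal.ofReal_mul (Real.sqrt_nonneg _),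
      ENNReal.ofReal_mul (pow_nonneg (hg i x) _)]
  · exact fun i _ => mul_nonneg (mul_nonneg (Real.sqrt_nonneg _)
      (pow_nonneg (hg i x) _)) (hφ i x)

lemma lintegral_mixFun_mul (hφm : ∀ i, Measurable (φ i)) (hφ : ∀ i x, 0 ≤ φ i x)
    {l : Fin n → ℝ} {g : Fin n → Eu d → ℝ} (hg : ∀ i, Normalised B p (g i)) {h : Eu d → ℝ≥0∞}
    (hh : Measurable h) :
    ∫⁻ x in B, ENNReal.ofReal (mixFun p φ l g x) * h x = ∑ i, ENNReal.ofReal √(l i) *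
      ∫⁻ x in B, ENNReal.ofReal (g i x ^ (2 * p - 1)) * (ENNReal.ofReal (φ i x) * h x) := by
  simp_rw [fun x => ofReal_mixFun (p := p) (l := l) hφ (fun i => (hg i).nonneg) x, Finset.sum_mul]
  have hm := fun i => (hg i).measurable
  rw [lintegral_finsetSum _ (fun i _ => by have := hm i; have := hφm i; fun_prop)]
  refine Finset.sum_congr rfl fun i _ => ?_
  have := hm i
  have := hφm i
  rw [← lintegral_const_mul _ (by fun_prop)]
  refine lintegral_congr fun x => ?_
  ring

lemma holderConjugate_two_mul (hp : 1 ≤ p) :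
    (2 * p : ℝ).HolderConjugate ((2 * p : ℝ) / (2 * p - 1)) := by
  have : (1 : ℝ) ≤ p := by exact_mod_cast hp
  exact Real.HolderConjugate.conjExponent (by linarith)

lemma ofReal_pow_rpow (hp : 1 ≤ p) {t : ℝ} (ht : 0 ≤ t) :
    ENNReal.ofReal (t ^ (2 * p - 1)) ^ ((2 * p : ℝ) / (2 * p - 1)) =
      ENNReal.ofReal (t ^ (2 * p)) := by
  have h1 : (1 : ℝ) ≤ p := by exact_mod_cast hp
  rw [ENNReal.ofReal_rpow_of_nonneg (by positivity) (by apply div_nonneg <;> linarith),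
    ← Real.rpow_natCast, ← Real.rpow_mul ht, ← Real.rpow_natCast]
  congr 2
  have h2 : ((2 * p - 1 : ℕ) : ℝ) = 2 * p - 1 := by
    rw [Nat.cast_sub (by omega)]; push_cast; ring
  have h3 : (2 * p - 1 : ℝ) ≠ 0 := by linarith
  rw [h2]
  push_cast
  field_simp

lemma lintegral_pow_mul_le_weightedNorm (hp : 1 ≤ p) {ψ : Eu d → ℝ} (hψ : Measurable ψ)
    {g : Eu d → ℝ} (hg : Normalised B p g) {h : Eu d → ℝ≥0∞} (hh : Measurable h) :
    ∫⁻ x in B, ENNReal.ofReal (g x ^ (2 * p - 1)) * (ENNReal.ofReal (ψ x) * h x) ≤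
      weightedNorm B p ψ h := by
  have hm := hg.measurable
  have := ENNReal.lintegral_mul_le_Lp_mul_Lq (volume.restrict B) (holderConjugate_two_mul hp).symm
    (f := fun x => ENNReal.ofReal (g x ^ (2 * p - 1)))
    (g := fun x => ENNReal.ofReal (ψ x) * h x) (by fun_prop) (by fun_prop)
  refine this.trans (le_of_eq ?_)
  simp_rw [fun x => ofReal_pow_rpow hp (hg.nonneg x)]
  rw [hg.lintegral, ENNReal.one_rpow, one_mul, weightedNorm]
  congr 1
  refine lintegral_congr fun x => ?_
  exact_mod_cast ENNReal.rpow_natCast _ (2 * p)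

lemma sum_ofReal_sqrt_sq {l : Fin n → ℝ} (hl : l ∈ stdSimplex ℝ (Fin n)) :
    ∑ i, ENNReal.ofReal √(l i) ^ 2 = 1 := by
  have : ∀ i, ENNReal.ofReal √(l i) ^ 2 = ENNReal.ofReal (l i) := fun i => by
    rw [← ENNReal.ofReal_pow (Real.sqrt_nonneg _), Real.sq_sqrt (hl.1 i)]
  simp_rw [this]
  rw [← ENNReal.ofReal_sum_of_nonneg fun i _ => hl.1 i, hl.2, ENNReal.ofReal_one]

lemma sum_sqrt_mul_le_totalNorm {l : Fin n → ℝ} (hl : l ∈ stdSimplex ℝ (Fin n))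
    (h : Eu d → ℝ≥0∞) :
    ∑ i, ENNReal.ofReal √(l i) * weightedNorm B p (φ i) h ≤ totalNorm B p φ h := by
  have := ENNReal.inner_le_Lp_mul_Lq Finset.univ (fun i => ENNReal.ofReal √(l i))
    (fun i => weightedNorm B p (φ i) h) Real.HolderConjugate.two_two
  refine this.trans (le_of_eq ?_)
  simp only [ENNReal.rpow_two]
  rw [sum_ofReal_sqrt_sq hl, ENNReal.one_rpow, one_mul, totalNorm]

/-- The bound `∫ f h ≤ ‖(φ_i h)_i‖`, by the Hölder inequality in `L^{2p}` and the Cauchy–Schwarz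
inequality in the sum over `i`. -/
lemma lintegral_mixFun_mul_le (hp : 1 ≤ p) (hφm : ∀ i, Measurable (φ i)) (hφ : ∀ i x, 0 ≤ φ i x)
    {l : Fin n → ℝ} (hl : l ∈ stdSimplex ℝ (Fin n)) {g : Fin n → Eu d → ℝ}
    (hg : ∀ i, Normalised B p (g i)) {h : Eu d → ℝ≥0∞} (hh : Measurable h) :
    ∫⁻ x in B, ENNReal.ofReal (mixFun p φ l g x) * h x ≤ totalNorm B p φ h := by
  rw [lintegral_mixFun_mul hφm hφ hg hh]
  refine le_trans (Finset.sum_le_sum fun i _ => ?_) (sum_sqrt_mul_le_totalNorm hl h)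
  exact mul_le_mul' le_rfl (lintegral_pow_mul_le_weightedNorm hp (hφm i) (hg i) hh)

lemma weightedNorm_pow (hp : 1 ≤ p) (ψ : Eu d → ℝ) (h : Eu d → ℝ≥0∞) :
    weightedNorm B p ψ h ^ (2 * p) = ∫⁻ x in B, (ENNReal.ofReal (ψ x) * h x) ^ (2 * p) := by
  have h1 : (p : ℝ) ≠ 0 := by exact_mod_cast (by omega : p ≠ 0)
  rw [weightedNorm, ← ENNReal.rpow_natCast, ← ENNReal.rpow_mul]
  have : 1 / (2 * p : ℝ) * ((2 * p : ℕ) : ℝ) = 1 := by push_cast; field_simp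
  rw [this, ENNReal.rpow_one]

lemma totalNorm_sq (φ : Fin n → Eu d → ℝ) (h : Eu d → ℝ≥0∞) :
    totalNorm B p φ h ^ 2 = ∑ i, weightedNorm B p (φ i) h ^ 2 := by
  rw [totalNorm, ← ENNReal.rpow_natCast, ← ENNReal.rpow_mul]
  norm_num

lemma weightedNorm_le_totalNorm (φ : Fin n → Eu d → ℝ) (h : Eu d → ℝ≥0∞) (i : Fin n) :
    weightedNorm B p (φ i) h ≤ totalNorm B p φ h := by
  have h1 : weightedNorm B p (φ i) h ^ 2 ≤ totalNorm B p φ h ^ 2 := by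
    rw [totalNorm_sq]
    exact Finset.single_le_sum (f := fun i => weightedNorm B p (φ i) h ^ 2)
      (fun _ _ => zero_le) (Finset.mem_univ i)
  exact (ENNReal.pow_le_pow_left_iff two_ne_zero).1 h1

lemma ae_ne_top_of_weightedNorm (hp : 1 ≤ p) {ψ : Eu d → ℝ} (hψ : Measurable ψ)
    {h : Eu d → ℝ≥0∞} (hh : Measurable h) (hfin : weightedNorm B p ψ h ≠ ∞) :
    ∀ᵐ x ∂volume.restrict B, ENNReal.ofReal (ψ x) * h x ≠ ∞ := by
  have h1 : ∫⁻ x in B, (ENNReal.ofReal (ψ x) * h x) ^ (2 * p) ≠ ∞ := by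
    rw [← weightedNorm_pow hp]
    exact ENNReal.pow_ne_top hfin
  filter_upwards [ae_lt_top (by fun_prop) h1] with x hx htop
  rw [htop, ENNReal.top_pow (by omega)] at hx
  exact lt_irrefl _ hx

lemma exists_normalised (hp : 1 ≤ p) (hB : IsOpen B) (hne : B.Nonempty) :
    ∃ g : Eu d → ℝ, Normalised B p g := by
  obtain ⟨x, hx⟩ := hne
  obtain ⟨r, hr, hrB⟩ := Metric.isOpen_iff.1 hB x hx
  set v := volume (Metric.ball x r) with hv
  have hv0 : v ≠ 0 := (Metric.measure_ball_pos volume x hr).ne'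
  have hvt : v ≠ ∞ := measure_ball_lt_top.ne
  have hp0 : (p : ℝ) ≠ 0 := by exact_mod_cast (by omega : p ≠ 0)
  have hvr : 0 < v.toReal := ENNReal.toReal_pos hv0 hvt
  refine ⟨(Metric.ball x r).indicator fun _ => v.toReal⁻¹ ^ (1 / (2 * p : ℝ)),
    measurable_const.indicator measurableSet_ball,
    fun y => Set.indicator_nonneg (fun _ _ => by positivity) y, ?_⟩
  have e1 : ∀ y, ENNReal.ofReal ((Metric.ball x r).indicator
      (fun _ => v.toReal⁻¹ ^ (1 / (2 * p : ℝ))) y ^ (2 * p)) =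
      (Metric.ball x r).indicator (fun _ => v⁻¹) y := by
    intro y
    by_cases hy : y ∈ Metric.ball x r
    · rw [Set.indicator_of_mem hy, Set.indicator_of_mem hy, ← Real.rpow_natCast,
        ← Real.rpow_mul (by positivity)]
      have : 1 / (2 * p : ℝ) * ((2 * p : ℕ) : ℝ) = 1 := by push_cast; field_simp
      rw [this, Real.rpow_one, ENNReal.ofReal_inv_of_pos hvr, ENNReal.ofReal_toReal hvt]
    · rw [Set.indicator_of_notMem hy, Set.indicator_of_notMem hy, zero_pow (by omega),
        ENNReal.ofReal_zero]
  simp_rw [e1]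
  rw [lintegral_indicator measurableSet_ball, Measure.restrict_restrict measurableSet_ball,
    Set.inter_eq_self_of_subset_left hrB, setLIntegral_const, ENNReal.inv_mul_cancel hv0 hvt]

/-- The supremum `totalNorm` of the linear functional given by `h` is attained. -/
lemma exists_lintegral_mixFun_mul_eq (hp : 1 ≤ p) (hB : IsOpen B) (hne : B.Nonempty)
    (hφm : ∀ i, Measurable (φ i)) (hφ : ∀ i x, 0 ≤ φ i x) {h : Eu d → ℝ≥0∞} (hh : Measurable h)
    (h0 : totalNorm B p φ h ≠ 0) (ht : totalNorm B p φ h ≠ ∞) :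
    ∃ l ∈ stdSimplex ℝ (Fin n), ∃ g : Fin n → Eu d → ℝ, (∀ i, Normalised B p (g i)) ∧
      ∫⁻ x in B, ENNReal.ofReal (mixFun p φ l g x) * h x = totalNorm B p φ h := by
  classical
  obtain ⟨g₀, hg₀⟩ := exists_normalised hp hB hne
  set A := totalNorm B p φ h with hA
  have hAr : 0 < A.toReal := ENNReal.toReal_pos h0 ht
  set a : Fin n → ℝ≥0∞ := fun i => weightedNorm B p (φ i) h with ha
  have hat : ∀ i, a i ≠ ∞ := fun i => ne_top_of_le_ne_top ht (weightedNorm_le_totalNorm φ h i)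
  have hsum : ∑ i, (a i).toReal ^ 2 = A.toReal ^ 2 := by
    rw [← ENNReal.toReal_pow, hA, totalNorm_sq, ENNReal.toReal_sum fun i _ =>
      ENNReal.pow_ne_top (hat i)]
    simp [ha]
  let g : Fin n → Eu d → ℝ := fun i => if a i = 0 then g₀ else
    fun x => (ENNReal.ofReal (φ i x) * h x).toReal / (a i).toReal
  have hg : ∀ i, Normalised B p (g i) := by
    intro i
    dsimp only [g]
    split_ifs with hai
    · exact hg₀
    have := hφm i
    refine ⟨by fun_prop, fun x => by positivity, ?_⟩
    have har : 0 < (a i).toReal := ENNReal.toReal_pos hai (hat i)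
    have e1 : ∀ᵐ x ∂volume.restrict B,
        ENNReal.ofReal (((ENNReal.ofReal (φ i x) * h x).toReal / (a i).toReal) ^ (2 * p)) =
        (ENNReal.ofReal (φ i x) * h x) ^ (2 * p) * (a i ^ (2 * p))⁻¹ := by
      filter_upwards [ae_ne_top_of_weightedNorm hp (hφm i) hh (hat i)] with x hx
      rw [div_pow, ENNReal.ofReal_div_of_pos (by positivity),
            ENNReal.ofReal_pow (by positivity),
        ENNReal.ofReal_pow (by positivity), ENNReal.ofReal_toReal hx, ENNReal.ofReal_toReal (hat i),
        div_eq_mul_inv]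
    rw [lintegral_congr_ae e1, lintegral_mul_const _ (by fun_prop), ← weightedNorm_pow hp,
      ENNReal.mul_inv_cancel (pow_ne_zero _ hai) (ENNReal.pow_ne_top (hat i))]
  refine ⟨fun i => ((a i).toReal / A.toReal) ^ 2, ⟨fun i => sq_nonneg _, ?_⟩, g, hg, ?_⟩
  · simp_rw [div_pow]
    rw [← Finset.sum_div, hsum, div_self (by positivity)]
  · rw [lintegral_mixFun_mul hφm hφ hg hh]
    · have key : ∀ i, ENNReal.ofReal √(((a i).toReal / A.toReal) ^ 2) * ∫⁻ x in B, ENNReal.ofReal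
          (g i x ^ (2 * p - 1)) * (ENNReal.ofReal (φ i x) * h x) = a i ^ 2 / A := by
        intro i
        dsimp only [g]
        rw [Real.sqrt_sq (by positivity), ENNReal.ofReal_div_of_pos hAr,
          ENNReal.ofReal_toReal (hat i), ENNReal.ofReal_toReal ht]
        split_ifs with hai
        · rw [hai]; simp
        have har : 0 < (a i).toReal := ENNReal.toReal_pos hai (hat i)
        have := hφm i
        have e1 : ∀ᵐ x ∂volume.restrict B, ENNReal.ofReal
            (((ENNReal.ofReal (φ i x) * h x).toReal / (a i).toReal) ^ (2 * p - 1)) *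
              (ENNReal.ofReal (φ i x) * h x) =
            (ENNReal.ofReal (φ i x) * h x) ^ (2 * p) * (a i ^ (2 * p - 1))⁻¹ := by
          filter_upwards [ae_ne_top_of_weightedNorm hp (hφm i) hh (hat i)] with x hx
          rw [div_pow, ENNReal.ofReal_div_of_pos (by positivity),
            ENNReal.ofReal_pow (by positivity),
            ENNReal.ofReal_pow (by positivity), ENNReal.ofReal_toReal hx,
            ENNReal.ofReal_toReal (hat i), div_eq_mul_inv, mul_right_comm, ← pow_succ,
            Nat.sub_add_cancel (by omega)]
        rw [lintegral_congr_ae e1, lintegral_mul_const _ (by fun_prop), ← weightedNorm_pow hp]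
        have e2 : weightedNorm B p (φ i) h ^ (2 * p) = a i * a i ^ (2 * p - 1) := by
          rw [← pow_succ', Nat.sub_add_cancel (by omega)]
        rw [e2, mul_assoc, ENNReal.mul_inv_cancel (pow_ne_zero _ hai) (ENNReal.pow_ne_top (hat i)),
          mul_one, sq, div_eq_mul_inv, div_eq_mul_inv]
        ring
      rw [Finset.sum_congr rfl fun i _ => key i]
      simp_rw [div_eq_mul_inv]
      rw [← Finset.sum_mul, ← totalNorm_sq, ← hA, sq, mul_assoc, ENNReal.mul_inv_cancel h0 ht,
        mul_one]

end duality

/-! ### The equality case of the duality -/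

/-- Young's inequality with its equality case. -/
lemma young_pow_lt {M : ℕ} (hM : 1 ≤ M) {g k : ℝ} (hg : 0 ≤ g) (hk : 0 ≤ k) (hgk : g ≠ k) :
    (M + 1) * (g ^ M * k) < M * g ^ (M + 1) + k ^ (M + 1) := by
  rcases hg.eq_or_lt with h | h
  · subst h
    have : 0 < k := lt_of_le_of_ne hk hgk
    rw [zero_pow (by omega), zero_pow (by omega)]
    simp only [zero_mul, mul_zero, zero_add]
    positivity
  · have hs : k / g - 1 ≠ 0 := by
      rw [sub_ne_zero]
      intro hc
      rw [div_eq_one_iff_eq h.ne'] at hc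
      exact hgk hc.symm
    have h1 : (1 : ℝ) ≤ M := by exact_mod_cast hM
    have hb := one_add_mul_self_lt_rpow_one_add (s := k / g - 1)
      (by have : 0 ≤ k / g := by positivity
          linarith) hs (p := (M + 1 : ℕ)) (by push_cast; linarith)
    rw [Real.rpow_natCast, add_sub_cancel, div_pow, lt_div_iff₀ (by positivity)] at hb
    push_cast at hb
    have e : (1 + (M + 1 : ℝ) * (k / g - 1)) * g ^ (M + 1) =
        (M + 1) * (g ^ M * k) - M * g ^ (M + 1) := by
      rw [pow_succ]; field_simp; ring
    linarith

/-- The equality case of Hölder's inequality for normalised functions. -/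
lemma ae_eq_of_lintegral_pow_mul_eq_one {X : Type*} [MeasurableSpace X] {m : Measure X} {M : ℕ}
    (hM : 1 ≤ M) {g k : X → ℝ} (hg : Measurable g) (hk : Measurable k) (hg0 : ∀ x, 0 ≤ g x)
    (hk0 : ∀ x, 0 ≤ k x) (h1 : ∫⁻ x, ENNReal.ofReal (g x ^ (M + 1)) ∂m = 1)
    (h2 : ∫⁻ x, ENNReal.ofReal (k x ^ (M + 1)) ∂m = 1)
    (h3 : ∫⁻ x, ENNReal.ofReal (g x ^ M * k x) ∂m = 1) : g =ᵐ[m] k := by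
  set L : X → ℝ≥0∞ := fun x => ENNReal.ofReal ((M + 1) * (g x ^ M * k x))
  set R : X → ℝ≥0∞ := fun x => ENNReal.ofReal (M * g x ^ (M + 1) + k x ^ (M + 1))
  have hL : ∫⁻ x, L x ∂m = M + 1 := by
    have : ∀ x, L x = (M + 1) * ENNReal.ofReal (g x ^ M * k x) := fun x => by
      simp only [L]
      rw [ENNReal.ofReal_mul (by positivity)]
      congr 1
      exact_mod_cast ENNReal.ofReal_natCast (M + 1)
    simp_rw [this]
    rw [lintegral_const_mul _ (by fun_prop), h3, mul_one]
  have hR : ∫⁻ x, R x ∂m = M + 1 := by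
    have : ∀ x, R x = M * ENNReal.ofReal (g x ^ (M + 1)) + ENNReal.ofReal (k x ^ (M + 1)) :=
      fun x => by
        simp only [R]
        have := hg0 x
        have := hk0 x
        rw [ENNReal.ofReal_add (by positivity) (by positivity), ENNReal.ofReal_mul (by positivity),
          ENNReal.ofReal_natCast]
    simp_rw [this]
    rw [lintegral_add_left (by fun_prop), lintegral_const_mul _ (by fun_prop), h1, h2, mul_one]
  have hle : L ≤ᵐ[m] R := ae_of_all _ fun x => by
    refine ENNReal.ofReal_le_ofReal ?_
    by_cases hx : g x = k x
    · rw [← hx, ← pow_succ]; linarith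
    · exact (young_pow_lt hM (hg0 x) (hk0 x) hx).le
  have hLt : ∫⁻ x, L x ∂m ≠ ∞ := by
    rw [hL]
    exact ENNReal.add_ne_top.2 ⟨ENNReal.natCast_ne_top M, ENNReal.one_ne_top⟩
  have heq := ae_eq_of_ae_le_of_lintegral_le hle hLt (by fun_prop) (by rw [hL, hR])
  filter_upwards [heq] with x hx
  by_contra hne
  have h4 := young_pow_lt hM (hg0 x) (hk0 x) hne
  have h5 := hg0 x
  have h6 := hk0 x
  have h7 : 0 ≤ (M + 1 : ℝ) * (g x ^ M * k x) := by positivity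
  exact absurd hx ((ENNReal.ofReal_lt_ofReal_iff (h7.trans_lt h4)).2 h4).ne

section equality

variable {d n p : ℕ} {B : Set (Eu d)} {φ : Fin n → Eu d → ℝ}

/-- The equality case in `lintegral_mixFun_mul_le`. -/
lemma ae_eq_of_lintegral_mixFun_mul_eq (hp : 1 ≤ p) (hφm : ∀ i, Measurable (φ i))
    (hφ : ∀ i x, 0 ≤ φ i x) {l : Fin n → ℝ} (hl : l ∈ stdSimplex ℝ (Fin n))
    {g : Fin n → Eu d → ℝ} (hg : ∀ i, Normalised B p (g i)) {h : Eu d → ℝ≥0∞} (hh : Measurable h)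
    (h0 : totalNorm B p φ h ≠ 0) (ht : totalNorm B p φ h ≠ ∞)
    (heq : ∫⁻ x in B, ENNReal.ofReal (mixFun p φ l g x) * h x = totalNorm B p φ h) (i : Fin n) :
    ∀ᵐ x ∂volume.restrict B, ENNReal.ofReal (φ i x) * h x =
      totalNorm B p φ h * ENNReal.ofReal (√(l i) * g i x) := by
  set A := totalNorm B p φ h with hA
  have hAr : 0 < A.toReal := ENNReal.toReal_pos h0 ht
  set a : Fin n → ℝ≥0∞ := fun i => weightedNorm B p (φ i) h with ha
  have hat : ∀ i, a i ≠ ∞ := fun i => ne_top_of_le_ne_top ht (weightedNorm_le_totalNorm φ h i)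
  set t : Fin n → ℝ≥0∞ := fun i => ∫⁻ x in B, ENNReal.ofReal (g i x ^ (2 * p - 1)) *
    (ENNReal.ofReal (φ i x) * h x) with hti
  have hta : ∀ i, t i ≤ a i := fun i => lintegral_pow_mul_le_weightedNorm hp (hφm i) (hg i) hh
  have htt : ∀ i, t i ≠ ∞ := fun i => ne_top_of_le_ne_top (hat i) (hta i)
  have hsum1 : ∑ i, √(l i) * (t i).toReal = A.toReal := by
    rw [← heq, lintegral_mixFun_mul hφm hφ hg hh, ENNReal.toReal_sum fun i _ =>
      ENNReal.mul_ne_top ENNReal.ofReal_ne_top (htt i)]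
    simp [hti, Real.sqrt_nonneg]
  have hsum2 : ∑ i, √(l i) * (a i).toReal ≤ A.toReal := by
    have h1 := ENNReal.toReal_mono ht (sum_sqrt_mul_le_totalNorm (B := B) (p := p) (φ := φ) hl h)
    rw [ENNReal.toReal_sum fun i _ => ENNReal.mul_ne_top ENNReal.ofReal_ne_top (hat i)] at h1
    simpa [Real.sqrt_nonneg] using h1
  have hsum3 : ∑ i, (a i).toReal ^ 2 = A.toReal ^ 2 := by
    rw [← ENNReal.toReal_pow, hA, totalNorm_sq, ENNReal.toReal_sum fun i _ =>
      ENNReal.pow_ne_top (hat i)]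
    simp [ha]
  have htar : ∀ i, (t i).toReal ≤ (a i).toReal := fun i => ENNReal.toReal_mono (hat i) (hta i)
  have hle : ∀ i ∈ Finset.univ, √(l i) * (t i).toReal ≤ √(l i) * (a i).toReal := fun i _ =>
    mul_le_mul_of_nonneg_left (htar i) (Real.sqrt_nonneg _)
  have hsum4 : ∑ i, √(l i) * (a i).toReal = A.toReal :=
    le_antisymm hsum2 (hsum1 ▸ Finset.sum_le_sum hle)
  -- equality in Hölder's inequality for every component of positive weight
  have heach : √(l i) * (t i).toReal = √(l i) * (a i).toReal :=
    (Finset.sum_eq_sum_iff_of_le hle).1 (hsum1.trans hsum4.symm) i (Finset.mem_univ i)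
  -- equality in the Cauchy–Schwarz inequality for the weights
  have hcs : ∑ j, ((a j).toReal - A.toReal * √(l j)) ^ 2 = 0 := by
    have hls : ∑ j, √(l j) ^ 2 = 1 := by
      simp_rw [fun j => Real.sq_sqrt (hl.1 j)]
      exact hl.2
    calc _ = ∑ j, (a j).toReal ^ 2 - 2 * A.toReal * ∑ j, √(l j) * (a j).toReal +
          A.toReal ^ 2 * ∑ j, √(l j) ^ 2 := by
          rw [Finset.mul_sum, Finset.mul_sum, ← Finset.sum_sub_distrib, ← Finset.sum_add_distrib]
          exact Finset.sum_congr rfl fun j _ => by ring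
      _ = 0 := by rw [hsum3, hsum4, hls]; ring
  have hai : (a i).toReal = A.toReal * √(l i) := by
    have := (Finset.sum_eq_zero_iff_of_nonneg fun j _ => sq_nonneg _).1 hcs i (Finset.mem_univ i)
    have := pow_eq_zero_iff two_ne_zero |>.1 this
    linarith
  have hφi := hφm i
  by_cases hz : a i = 0
  · have hl0 : √(l i) = 0 := by
      rw [hz] at hai
      simpa [hAr.ne'] using hai.symm
    have h1 : ∫⁻ x in B, (ENNReal.ofReal (φ i x) * h x) ^ (2 * p) = 0 := by
      rw [← weightedNorm_pow hp]
      change a i ^ (2 * p) = 0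
      rw [hz, zero_pow (by omega)]
    rw [lintegral_eq_zero_iff (by fun_prop)] at h1
    filter_upwards [h1] with x hx
    rw [hl0, zero_mul, ENNReal.ofReal_zero, mul_zero]
    exact (pow_eq_zero_iff (by omega : 2 * p ≠ 0)).1 hx
  have har : 0 < (a i).toReal := ENNReal.toReal_pos hz (hat i)
  have hl0 : √(l i) ≠ 0 := by
    intro hc
    rw [hc, mul_zero] at hai
    exact har.ne' hai
  have hta' : t i = a i := (ENNReal.toReal_eq_toReal_iff' (htt i) (hat i)).1
    (mul_left_cancel₀ hl0 heach)
  have hfin := ae_ne_top_of_weightedNorm hp (hφm i) hh (hat i)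
  set k : Eu d → ℝ := fun x => (ENNReal.ofReal (φ i x) * h x).toReal / (a i).toReal with hk
  have hgi := (hg i).measurable
  have hpp : 2 * p - 1 + 1 = 2 * p := by omega
  have hgk : g i =ᵐ[volume.restrict B] k := by
    refine ae_eq_of_lintegral_pow_mul_eq_one (M := 2 * p - 1) (by omega) hgi (by fun_prop)
      (hg i).nonneg (fun x => by positivity) ?_ ?_ ?_
    · rw [hpp]; exact (hg i).lintegral
    · rw [hpp]
      have e1 : ∀ᵐ x ∂volume.restrict B, ENNReal.ofReal (k x ^ (2 * p)) =
          (ENNReal.ofReal (φ i x) * h x) ^ (2 * p) * (a i ^ (2 * p))⁻¹ := by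
        filter_upwards [hfin] with x hx
        rw [hk, div_pow, ENNReal.ofReal_div_of_pos (by positivity),
          ENNReal.ofReal_pow (by positivity), ENNReal.ofReal_pow (by positivity),
          ENNReal.ofReal_toReal hx, ENNReal.ofReal_toReal (hat i), div_eq_mul_inv]
      rw [lintegral_congr_ae e1, lintegral_mul_const _ (by fun_prop), ← weightedNorm_pow hp,
        ENNReal.mul_inv_cancel (pow_ne_zero _ hz) (ENNReal.pow_ne_top (hat i))]
    · have e1 : ∀ᵐ x ∂volume.restrict B, ENNReal.ofReal (g i x ^ (2 * p - 1) * k x) =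
          (ENNReal.ofReal (g i x ^ (2 * p - 1)) * (ENNReal.ofReal (φ i x) * h x)) * (a i)⁻¹ := by
        filter_upwards [hfin] with x hx
        have := (hg i).nonneg x
        rw [hk, ENNReal.ofReal_mul (by positivity), ENNReal.ofReal_div_of_pos (by positivity),
          ENNReal.ofReal_toReal hx, ENNReal.ofReal_toReal (hat i), div_eq_mul_inv]
        ring
      rw [lintegral_congr_ae e1, lintegral_mul_const _ (by fun_prop)]
      change t i * (a i)⁻¹ = 1
      rw [hta', ENNReal.mul_inv_cancel hz (hat i)]
  filter_upwards [hgk, hfin] with x hx1 hx2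
  rw [hx1]
  simp only [hk]
  have e2 : √(l i) * ((ENNReal.ofReal (φ i x) * h x).toReal / (a i).toReal) =
      (ENNReal.ofReal (φ i x) * h x).toReal / A.toReal := by
    rw [hai]
    field_simp
  rw [e2, ENNReal.ofReal_div_of_pos hAr, ENNReal.ofReal_toReal hx2, ENNReal.ofReal_toReal ht,
    ENNReal.mul_div_cancel h0 ht]

end equality

/-! ### Existence of maximisers -/

/-- The exponents for Young's inequality. The Gaussian kernel at time `s` has norm of order
`s^{-d(1-c)/2}` in `L^{1/c}`, which is integrable at `s = 0`; it maps `L^{1/b}`, with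
`1/b = 2p/(2p-1)`, to `L^{1/(1-a)}`, with an exponent above `2p`. Such a `c` has to satisfy
`max (1/(2p), 1 - 2/d) < c < 1/p`, and exists by the subcriticality `p (d - 2) < d`. -/
lemma exists_exponents {d p : ℕ} (hd : 1 ≤ d) (hp : 1 ≤ p)
    (hpd : (p : ℤ) * ((d : ℤ) - 2) < (d : ℤ)) :
    ∃ a b c : ℝ, b⁻¹ = (2 * p : ℝ) / (2 * p - 1) ∧ 0 < b ∧ 0 < c ∧ a < 1 ∧ b ≤ a ∧ c ≤ 1 ∧
      a + b + c = 2 ∧ -1 < -(d : ℝ) / 2 * (1 - c) ∧ (2 * p : ℝ) < (1 - a)⁻¹ := by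
  have hp1 : (1 : ℝ) ≤ p := by exact_mod_cast hp
  have hd1 : (1 : ℝ) ≤ d := by exact_mod_cast hd
  have hpd' : (p : ℝ) * ((d : ℝ) - 2) < d := by exact_mod_cast hpd
  have hlt : max (1 / (2 * p : ℝ)) (1 - 2 / d) < 1 / p := by
    refine max_lt ?_ ?_
    · exact one_div_lt_one_div_of_lt (by linarith) (by linarith)
    · rw [lt_div_iff₀ (by linarith)]
      have : (1 - 2 / d : ℝ) * p = (p * (d - 2)) / d := by field_simp
      rw [this, div_lt_one (by linarith)]
      exact hpd'
  obtain ⟨c, hc1, hc2⟩ := exists_between hlt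
  obtain ⟨hc3, hc4⟩ := max_lt_iff.1 hc1
  have h2p : 0 < 1 / (2 * p : ℝ) := by positivity
  have hpp : 1 / (p : ℝ) = 2 * (1 / (2 * p)) := by field_simp
  have hple : 1 / (p : ℝ) ≤ 1 := by rw [div_le_one (by linarith)]; exact hp1
  refine ⟨1 + 1 / (2 * p) - c, 1 - 1 / (2 * p), c, ?_, ?_, by linarith, by linarith, by linarith,
    by linarith, by ring, ?_, ?_⟩
  · have h3 : (2 * p - 1 : ℝ) ≠ 0 := by linarith
    have : (1 - 1 / (2 * p) : ℝ) = (2 * p - 1) / (2 * p) := by field_simp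
    rw [this, inv_div]
  · linarith
  · have : d * (1 - c) < 2 := by
      have h5 : 1 - c < 2 / d := by linarith
      rw [lt_div_iff₀ (by linarith)] at h5
      linarith
    linarith
  · rw [lt_inv_comm₀ (by positivity) (by linarith), inv_eq_one_div]
    linarith

section existence

variable {d n p : ℕ} {B : Set (Eu d)} {φ : Fin n → Eu d → ℝ}

/-- A set of finite measure that carries all `φ_i`, together with a common bound. -/
lemma Standing.exists_carrier (H : Standing B p φ) : ∃ (S : Set (Eu d)) (C : ℝ), MeasurableSet S ∧
    S ⊆ B ∧ volume S ≠ ∞ ∧ 0 ≤ C ∧ (∀ i x, φ i x ≤ C) ∧ ∀ i, ∀ x ∉ S, φ i x = 0 := by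
  choose C hC using H.bdd
  have hS : IsCompact (⋃ i, tsupport (φ i)) := isCompact_iUnion fun i => (H.supp i).1
  refine ⟨⋃ i, tsupport (φ i), ∑ i, |C i|, hS.measurableSet,
    Set.iUnion_subset fun i => (H.supp i).2, hS.measure_lt_top.ne,
    Finset.sum_nonneg fun i _ => abs_nonneg _, fun i x => ?_, fun i x hx => ?_⟩
  · exact ((hC i x).trans (le_abs_self _)).trans
      (Finset.single_le_sum (f := fun i => |C i|) (fun _ _ => abs_nonneg _) (Finset.mem_univ i))
  · exact image_eq_zero_of_notMem_tsupport fun h => hx (Set.mem_iUnion.2 ⟨i, h⟩)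

lemma mixFun_eq_zero {S : Set (Eu d)} (hφ : ∀ i, ∀ x ∉ S, φ i x = 0) (l : Fin n → ℝ)
    (g : Fin n → Eu d → ℝ) {x : Eu d} (hx : x ∉ S) : mixFun p φ l g x = 0 :=
  Finset.sum_eq_zero fun i _ => by rw [hφ i x hx, mul_zero]

/-- The functions `∑ √λ_i g_i^{2p-1} φ_i` form a bounded subset of `L^{2p/(2p-1)}(B)`. -/
lemma exists_lintegral_mixFun_rpow_le (hp : 1 ≤ p) (hφ : ∀ i x, 0 ≤ φ i x) {C : ℝ}
    (hC : ∀ i x, φ i x ≤ C) :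
    ∃ Q : ℝ≥0∞, Q ≠ ∞ ∧ ∀ l ∈ stdSimplex ℝ (Fin n), ∀ g : Fin n → Eu d → ℝ,
      (∀ i, Normalised B p (g i)) → ∫⁻ x in B, ENNReal.ofReal (mixFun p φ l g x) ^
        ((2 * p : ℝ) / (2 * p - 1)) ≤ Q := by
  set q : ℝ := (2 * p : ℝ) / (2 * p - 1) with hq
  have hq1 : 1 ≤ q := (holderConjugate_two_mul hp).symm.lt.le
  have hq0 : 0 ≤ q := by linarith
  refine ⟨(n : ℝ≥0∞) ^ (q - 1) * ∑ _i : Fin n, ENNReal.ofReal C ^ q, ?_, fun l hl g hg => ?_⟩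
  · refine ENNReal.mul_ne_top (ENNReal.rpow_ne_top_of_nonneg (by linarith) (by simp)) ?_
    exact ENNReal.sum_ne_top.2 fun i _ => ENNReal.rpow_ne_top_of_nonneg hq0 ENNReal.ofReal_ne_top
  have hm := fun i => (hg i).measurable
  have hpt : ∀ x, ENNReal.ofReal (mixFun p φ l g x) ^ q ≤ (n : ℝ≥0∞) ^ (q - 1) *
      ∑ i, ENNReal.ofReal C ^ q * ENNReal.ofReal (g i x ^ (2 * p)) := by
    intro x
    calc _ ≤ (∑ i, ENNReal.ofReal C * ENNReal.ofReal (g i x ^ (2 * p - 1))) ^ q := by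
          refine ENNReal.rpow_le_rpow ?_ hq0
          rw [ofReal_mixFun hφ fun i => (hg i).nonneg]
          refine Finset.sum_le_sum fun i _ => ?_
          have hl1 : √(l i) ≤ 1 := by
            rw [Real.sqrt_le_one]
            have := Finset.single_le_sum (f := l) (fun i _ => hl.1 i) (Finset.mem_univ i)
            rwa [hl.2] at this
          calc _ ≤ 1 * (ENNReal.ofReal (g i x ^ (2 * p - 1)) * ENNReal.ofReal C) := by
                gcongr
                · exact ENNReal.ofReal_le_one.2 hl1
                · exact hC i x
            _ = _ := by rw [one_mul, mul_comm]
      _ ≤ _ := by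
          refine (ENNReal.rpow_sum_le_const_mul_sum_rpow _ _ hq1).trans (le_of_eq ?_)
          rw [Finset.card_univ, Fintype.card_fin]
          congr 1
          refine Finset.sum_congr rfl fun i _ => ?_
          rw [ENNReal.mul_rpow_of_nonneg _ _ hq0, ofReal_pow_rpow hp ((hg i).nonneg x)]
  refine (lintegral_mono hpt).trans (le_of_eq ?_)
  rw [lintegral_const_mul _ (by fun_prop), lintegral_finsetSum _ (fun i _ => by fun_prop)]
  congr 1
  refine Finset.sum_congr rfl fun i _ => ?_
  rw [lintegral_const_mul _ (by fun_prop), (hg i).lintegral, mul_one]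

lemma totalNorm_mono {h k : Eu d → ℝ≥0∞} (hk : ∀ x, h x ≤ k x) :
    totalNorm B p φ h ≤ totalNorm B p φ k := by
  unfold totalNorm weightedNorm
  gcongr with i _ x
  exact hk x

/-- A bound for `h` in `L^r` over the carrier of the `φ_i`, with `r ≥ 2p`, bounds `totalNorm`. -/
lemma exists_totalNorm_le {S : Set (Eu d)} (hS : MeasurableSet S) (hSB : S ⊆ B)
    (hvS : volume S ≠ ∞) {C : ℝ} (hC : ∀ i x, φ i x ≤ C)
    (hφS : ∀ i, ∀ x ∉ S, φ i x = 0) (hp : 1 ≤ p) {r : ℝ} (hr : (2 * p : ℝ) ≤ r)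
    {D : ℝ≥0∞} (hD : D ≠ ∞) :
    ∃ K : ℝ≥0∞, K ≠ ∞ ∧ ∀ h : Eu d → ℝ≥0∞, ∫⁻ x in S, h x ^ r ≤ D → totalNorm B p φ h ≤ K := by
  set K : ℝ≥0∞ := (ENNReal.ofReal C ^ (2 * p) * (volume S + D)) ^ (1 / (2 * p : ℝ))
  have hK : K ≠ ∞ := ENNReal.rpow_ne_top_of_nonneg (by positivity) (ENNReal.mul_ne_top
    (ENNReal.pow_ne_top ENNReal.ofReal_ne_top) (ENNReal.add_ne_top.2 ⟨hvS, hD⟩))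
  refine ⟨(∑ _i : Fin n, K ^ 2) ^ (1 / 2 : ℝ), ENNReal.rpow_ne_top_of_nonneg (by norm_num)
    (ENNReal.sum_ne_top.2 fun _ _ => ENNReal.pow_ne_top hK), fun h hh => ?_⟩
  unfold totalNorm
  gcongr with i
  unfold weightedNorm
  refine ENNReal.rpow_le_rpow ?_ (by positivity)
  calc ∫⁻ x in B, (ENNReal.ofReal (φ i x) * h x) ^ (2 * p)
      = ∫⁻ x in S, (ENNReal.ofReal (φ i x) * h x) ^ (2 * p) := by
        refine setLIntegral_eq_of_support hS hSB fun x hx => ?_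
        rw [hφS i x hx, ENNReal.ofReal_zero, zero_mul, zero_pow (by omega)]
    _ ≤ ∫⁻ x in S, ENNReal.ofReal C ^ (2 * p) * (1 + h x ^ r) := by
        refine lintegral_mono fun x => ?_
        dsimp only
        rw [mul_pow]
        gcongr
        · exact hC i x
        · have := rpow_le_one_add_rpow (h x) (r := ((2 * p : ℕ) : ℝ)) (by positivity)
            (by push_cast; exact hr)
          rwa [ENNReal.rpow_natCast] at this
    _ ≤ _ := by
        rw [lintegral_const_mul' _ _ (ENNReal.pow_ne_top ENNReal.ofReal_ne_top),
          lintegral_add_left measurable_const]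
        gcongr
        simp

lemma mixEnergy_eq_lintegral (l : Fin n → ℝ) (g : Fin n → Eu d → ℝ) :
    mixEnergy B p φ l g = ∫⁻ x in B, ENNReal.ofReal (mixFun p φ l g x) *
      potential B (fun y => ENNReal.ofReal (mixFun p φ l g y)) x := rfl

/-- The potentials of the functions `∑ √λ_i g_i^{2p-1} φ_i` are bounded in `L^r` over the carrier
of the `φ_i`, for some `r > 2p`; this is where the subcriticality `p (d - 2) < d` is used. -/
lemma Standing.exists_potential_le (H : Standing B p φ) {S : Set (Eu d)} (hS : MeasurableSet S)
    (hSB : S ⊆ B) (hvS : volume S ≠ ∞) (hφS : ∀ i, ∀ x ∉ S, φ i x = 0) :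
    ∃ r : ℝ, (2 * p : ℝ) < r ∧ ∃ D : ℝ≥0∞, D ≠ ∞ ∧ ∀ l ∈ stdSimplex ℝ (Fin n),
      ∀ g : Fin n → Eu d → ℝ, (∀ i, Normalised B p (g i)) →
        ∫⁻ x in S, potential B (fun y => ENNReal.ofReal (mixFun p φ l g y)) x ^ r ≤ D := by
  obtain ⟨S', C, -, -, -, -, hC, -⟩ := H.exists_carrier
  obtain ⟨a, b, c, hbq, hb, hc, ha1, hab, hc1, habc, hdc, hr⟩ :=
    exists_exponents H.one_le_d H.one_le_p H.subcritical
  obtain ⟨Q, hQ, hfQ⟩ := exists_lintegral_mixFun_rpow_le (B := B) H.one_le_p H.nonneg hC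
  obtain ⟨D, hD, h⟩ := exists_lintegral_potential_rpow_le H.one_le_d H.isOpen H.bounded hS hvS
    hb hc ha1 hab hc1 habc hdc hQ
  refine ⟨(1 - a)⁻¹, hr, D, hD, fun l hl g hg => ?_⟩
  have := h (fun y => ENNReal.ofReal (mixFun p φ l g y))
    (measurable_mixFun H.measurable fun i => (hg i).measurable).ennreal_ofReal
    (fun x hx => by rw [mixFun_eq_zero hφS l g hx, ENNReal.ofReal_zero])
    (by rw [hbq]; exact hfQ l hl g hg)
  rwa [Set.inter_eq_self_of_subset_left hSB] at this

/-- There is a nonnegative maximiser. For a maximising sequence `f_k`, the lower limit `h` of the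
potentials `G f_k` along a suitable subsequence has `totalNorm` at least `ρ`, because all but a
small part of `G f_k` converges pointwise and boundedly; a maximiser of the linear functional given
by `h` is then a maximiser of the energy, by the Cauchy–Schwarz inequality and Fatou's lemma. -/
theorem Standing.exists_mixEnergy_max (H : Standing B p φ) :
    ∃ l ∈ stdSimplex ℝ (Fin n), ∃ g : Fin n → Eu d → ℝ, (∀ i, Normalised B p (g i)) ∧
      mixEnergy B p φ l g ≠ ∞ ∧ ∀ l' ∈ stdSimplex ℝ (Fin n), ∀ g' : Fin n → Eu d → ℝ,
        (∀ i, Normalised B p (g' i)) → mixEnergy B p φ l' g' ≤ mixEnergy B p φ l g := by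
  obtain ⟨S, C, hS, hSB, hvS, hC0, hC, hφS⟩ := H.exists_carrier
  obtain ⟨r, hr, D, hD, hpot⟩ := H.exists_potential_le hS hSB hvS hφS
  obtain ⟨K, hK, hnorm⟩ := exists_totalNorm_le hS hSB hvS hC hφS H.one_le_p hr.le hD
  obtain ⟨a, b, c, hbq, hb, hc, ha1, hab, hc1, habc, hdc, -⟩ :=
    exists_exponents H.one_le_d H.one_le_p H.subcritical
  obtain ⟨Q, hQ, hfQ⟩ := exists_lintegral_mixFun_rpow_le (B := B) H.one_le_p H.nonneg hC
  obtain ⟨g₀, hg₀⟩ := exists_normalised H.one_le_p H.isOpen H.nonempty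
  have hr0 : 0 < r := by
    have : (0 : ℝ) ≤ p := by positivity
    linarith
  set P : Set ℝ≥0∞ := {t | ∃ l ∈ stdSimplex ℝ (Fin n), ∃ g : Fin n → Eu d → ℝ,
    (∀ i, Normalised B p (g i)) ∧ mixEnergy B p φ l g = t} with hP
  have hPK : ∀ t ∈ P, t ≤ K := by
    rintro t ⟨l, hl, g, hg, rfl⟩
    have hm : Measurable fun y => ENNReal.ofReal (mixFun p φ l g y) :=
      (measurable_mixFun H.measurable fun i => (hg i).measurable).ennreal_ofReal
    exact (lintegral_mixFun_mul_le H.one_le_p H.measurable H.nonneg hl hg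
      (measurable_potential H.isOpen hm)).trans (hnorm _ (hpot l hl g hg))
  have hne : P.Nonempty := by
    have : NeZero n := ⟨by have := H.one_le_n; omega⟩
    exact ⟨_, Pi.single 0 1, single_mem_stdSimplex ℝ 0, fun _ => g₀, fun _ => hg₀, rfl⟩
  set R := sSup P with hR
  have hRK : R ≤ K := sSup_le hPK
  have hRt : R ≠ ∞ := ne_top_of_le_ne_top hK hRK
  suffices ∃ l ∈ stdSimplex ℝ (Fin n), ∃ g : Fin n → Eu d → ℝ, (∀ i, Normalised B p (g i)) ∧
      R ≤ mixEnergy B p φ l g by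
    obtain ⟨l, hl, g, hg, hle⟩ := this
    exact ⟨l, hl, g, hg, ne_top_of_le_ne_top hK (hPK _ ⟨l, hl, g, hg, rfl⟩),
      fun l' hl' g' hg' => (le_sSup (show _ ∈ P from ⟨l', hl', g', hg', rfl⟩)).trans hle⟩
  rcases eq_or_ne R 0 with hR0 | hR0
  · obtain ⟨t, l, hl, g, hg, -⟩ := hne
    exact ⟨l, hl, g, hg, by rw [hR0]; exact zero_le⟩
  obtain ⟨u, -, hu, huP⟩ := exists_seq_tendsto_sSup hne (OrderTop.bddAbove P)
  choose l hl g hg hlg using huP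
  set F : ℕ → Eu d → ℝ := fun k => mixFun p φ (l k) (g k) with hF
  have mF : ∀ k, Measurable (F k) :=
    fun k => measurable_mixFun H.measurable fun i => (hg k i).measurable
  have mFe : ∀ k, Measurable fun y => ENNReal.ofReal (F k y) := fun k => (mF k).ennreal_ofReal
  have F0 : ∀ k x, 0 ≤ F k x := fun k => mixFun_nonneg H.nonneg fun i => (hg k i).nonneg
  have FS : ∀ k, ∀ x ∉ S, F k x = 0 := fun k x hx => mixFun_eq_zero hφS _ _ hx
  have FQ : ∀ k, ∫⁻ x in B, ENNReal.ofReal (F k x) ^ ((2 * p : ℝ) / (2 * p - 1)) ≤ Q :=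
    fun k => hfQ _ (hl k) _ (hg k)
  obtain ⟨σ, hσ, hconv⟩ := exists_subseq_farPotential_tendsto H.one_le_d H.isOpen H.bounded hS hSB
    hvS (holderConjugate_two_mul H.one_le_p) mF F0 FS hQ FQ
  have huσ : Tendsto (fun k => u (σ k)) atTop (𝓝 R) := hu.comp hσ.tendsto_atTop
  set V : ℕ → Eu d → ℝ≥0∞ := fun k => potential B fun y => ENNReal.ofReal (F (σ k) y) with hV
  have mV : ∀ k, Measurable (V k) := fun k => measurable_potential H.isOpen (mFe _)
  set h : Eu d → ℝ≥0∞ := fun x => liminf (fun k => V k x) atTop with hh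
  have mh : Measurable h := Measurable.liminf mV
  have hnh : totalNorm B p φ h ≤ K := by
    refine hnorm h ?_
    have e1 : ∀ x, h x ^ r = liminf (fun k => V k x ^ r) atTop := fun x =>
      (ENNReal.monotone_rpow_of_nonneg hr0.le).map_liminf_of_continuousAt _
        ENNReal.continuous_rpow_const.continuousAt
    simp_rw [e1]
    refine (lintegral_liminf_le fun k => (mV k).pow_const r).trans ?_
    refine liminf_le_of_frequently_le' (Frequently.of_forall fun k => ?_)
    exact hpot _ (hl _) _ (hg _)
  -- up to `δ`, the energies are bounded by the norms of the far potentials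
  have hlow : R ≤ totalNorm B p φ h := by
    refine ENNReal.le_of_forall_pos_le_add fun δ hδ _ => ?_
    obtain ⟨ε, hε, hnear⟩ := exists_nearEnergy_le H.isOpen hS hvS hb hc ha1.le hab hc1 habc hdc hQ
      (δ := δ) (by exact_mod_cast hδ.ne')
    obtain ⟨C1, hC1, hfar⟩ := exists_farKernel_le H.one_le_d H.isOpen H.bounded hε
    set U : ℕ → Eu d → ℝ≥0∞ := fun k x =>
      ∫⁻ y in B, (∫⁻ s in Set.Ioi ε, killedKernel B s x y) * ENNReal.ofReal (F (σ k) y) with hU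
    have mU : ∀ k, Measurable (U k) := by
      intro k
      have mk := mFe (σ k)
      refine Measurable.lintegral_prod_right' (ν := volume.restrict B)
        (f := fun z : Eu d × Eu d => (∫⁻ s in Set.Ioi ε, killedKernel B s z.1 z.2) *
          ENNReal.ofReal (F (σ k) z.2)) (Measurable.mul ?_ (by fun_prop))
      refine Measurable.lintegral_prod_right' (ν := volume.restrict (Set.Ioi ε))
        (f := fun w : (Eu d × Eu d) × ℝ => killedKernel B w.2 w.1.1 w.1.2) ?_
      exact (measurable_killedKernel H.isOpen).comp
        (f := fun w : (Eu d × Eu d) × ℝ => (w.2, w.1.1, w.1.2)) (by fun_prop)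
    have hUV : ∀ k x, U k x ≤ V k x := fun k x => by
      simp only [hV]
      rw [potential_eq_add H.isOpen hε (mFe _)]
      exact le_add_self
    have hUb : ∀ k x, U k x ≤ C1 * (volume S + Q) := by
      intro k x
      calc U k x ≤ ∫⁻ y in B, C1 * ENNReal.ofReal (F (σ k) y) :=
            lintegral_mono fun y => mul_le_mul' (hfar x y) le_rfl
        _ = C1 * ∫⁻ y in B, ENNReal.ofReal (F (σ k) y) ^ (1 : ℝ) := by
            rw [lintegral_const_mul _ (mFe _)]; simp
        _ ≤ _ := by
            gcongr
            refine (lintegral_rpow_le_of_support hS (fun x hx => by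
              rw [FS _ x hx, ENNReal.ofReal_zero]) one_pos
              (holderConjugate_two_mul H.one_le_p).symm.lt.le).trans ?_
            gcongr
            exact FQ _
    choose L hL using fun x => hconv ε hε x
    have mL : Measurable L := measurable_of_tendsto_metrizable mU (tendsto_pi_nhds.2 hL)
    have hLh : ∀ x, L x ≤ h x := fun x => by
      rw [← (hL x).liminf_eq]
      exact liminf_le_liminf (Eventually.of_forall fun k => hUV k x)
    have hwt : ∀ i, Tendsto (fun k => weightedNorm B p (φ i) (U k)) atTop
        (𝓝 (weightedNorm B p (φ i) L)) := by
      intro i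
      refine (ENNReal.continuous_rpow_const.tendsto _).comp ?_
      have mi := H.measurable i
      refine tendsto_lintegral_of_dominated_convergence
        (S.indicator fun _ => (ENNReal.ofReal C * (C1 * (volume S + Q))) ^ (2 * p))
        (fun k => by have := mU k; fun_prop) (fun k => ae_of_all _ fun x => ?_) ?_
        (ae_of_all _ fun x => ?_)
      · by_cases hx : x ∈ S
        · rw [Set.indicator_of_mem hx]
          exact pow_le_pow_left' (mul_le_mul' (ENNReal.ofReal_le_ofReal (hC i x)) (hUb k x)) _
        · dsimp only
          rw [hφS i x hx, ENNReal.ofReal_zero, zero_mul, zero_pow (by have := H.one_le_p; omega)]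
          exact zero_le
      · rw [lintegral_indicator hS, setLIntegral_const]
        refine ENNReal.mul_ne_top (ENNReal.pow_ne_top (ENNReal.mul_ne_top ENNReal.ofReal_ne_top
          (ENNReal.mul_ne_top hC1 (ENNReal.add_ne_top.2 ⟨hvS, hQ⟩))))
          (ne_top_of_le_ne_top hvS (Measure.restrict_apply_le _ _))
      · exact ((ENNReal.continuous_pow (2 * p)).tendsto _).comp
          (ENNReal.Tendsto.const_mul (hL x) (Or.inr ENNReal.ofReal_ne_top))
    have htt : Tendsto (fun k => totalNorm B p φ (U k)) atTop (𝓝 (totalNorm B p φ L)) :=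
      (ENNReal.continuous_rpow_const.tendsto _).comp (tendsto_finsetSum _ fun i _ =>
        ((ENNReal.continuous_pow 2).tendsto _).comp (hwt i))
    have hbound : ∀ k, u (σ k) ≤ totalNorm B p φ (U k) + δ := by
      intro k
      rw [← hlg (σ k)]
      change ∫⁻ x in B, ENNReal.ofReal (F (σ k) x) *
        potential B (fun y => ENNReal.ofReal (F (σ k) y)) x ≤ _
      simp_rw [potential_eq_add H.isOpen hε (mFe (σ k)), mul_add]
      rw [lintegral_add_right _ ((mFe (σ k)).fun_mul (mU k)), add_comm]
      refine add_le_add (lintegral_mixFun_mul_le H.one_le_p H.measurable H.nonneg (hl _) (hg _)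
        (mU k)) (hnear _ (mFe _) (fun x hx => by rw [FS _ x hx, ENNReal.ofReal_zero]) ?_)
      rw [hbq]
      exact FQ _
    calc R ≤ totalNorm B p φ L + δ :=
          le_of_tendsto_of_tendsto' huσ (htt.add tendsto_const_nhds) hbound
      _ ≤ totalNorm B p φ h + δ := by
          gcongr
          exact totalNorm_mono hLh
  have hh0 : totalNorm B p φ h ≠ 0 := (pos_iff_ne_zero.2 hR0 |>.trans_le hlow).ne'
  obtain ⟨l', hl', g', hg', heq⟩ := exists_lintegral_mixFun_mul_eq H.one_le_p H.isOpen H.nonempty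
    H.measurable H.nonneg mh hh0 (ne_top_of_le_ne_top hK hnh)
  refine ⟨l', hl', g', hg', ?_⟩
  have mf' : Measurable fun y => ENNReal.ofReal (mixFun p φ l' g' y) :=
    (measurable_mixFun H.measurable fun i => (hg' i).measurable).ennreal_ofReal
  have hkey : R ≤ mixEnergy B p φ l' g' ^ (1 / 2 : ℝ) * R ^ (1 / 2 : ℝ) := by
    calc R ≤ ∫⁻ x in B, ENNReal.ofReal (mixFun p φ l' g' x) * h x := by rw [heq]; exact hlow
      _ ≤ ∫⁻ x in B, liminf (fun k => ENNReal.ofReal (mixFun p φ l' g' x) * V k x) atTop := by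
          refine lintegral_mono fun x => ?_
          exact (ENNReal.continuous_const_mul ENNReal.ofReal_ne_top |>.continuousAt
            |> (monotone_id.const_mul' (ENNReal.ofReal (mixFun p φ l' g' x))
              |>.map_liminf_of_continuousAt (fun k => V k x))).le
      _ ≤ liminf (fun k => ∫⁻ x in B, ENNReal.ofReal (mixFun p φ l' g' x) * V k x) atTop :=
          lintegral_liminf_le fun k => mf'.mul (mV k)
      _ ≤ mixEnergy B p φ l' g' ^ (1 / 2 : ℝ) * R ^ (1 / 2 : ℝ) := by
          refine liminf_le_of_frequently_le' (Frequently.of_forall fun k => ?_)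
          refine (mutualEnergy_le H.isOpen mf' (mFe (σ k))).trans ?_
          refine mul_le_mul' le_rfl (ENNReal.rpow_le_rpow ?_ (by norm_num))
          exact le_sSup ⟨_, hl _, _, hg _, rfl⟩
  have hs0 : R ^ (1 / 2 : ℝ) ≠ 0 := (ENNReal.rpow_pos (pos_iff_ne_zero.2 hR0) hRt).ne'
  have hst : R ^ (1 / 2 : ℝ) ≠ ∞ := ENNReal.rpow_ne_top_of_nonneg (by norm_num) hRt
  have e2 : R = R ^ (1 / 2 : ℝ) * R ^ (1 / 2 : ℝ) := by
    rw [← ENNReal.rpow_add _ _ hR0 hRt]; norm_num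
  have h3 : R ^ (1 / 2 : ℝ) ≤ mixEnergy B p φ l' g' ^ (1 / 2 : ℝ) := by
    have h4 := hkey
    nth_rewrite 1 [e2] at h4
    exact (ENNReal.mul_le_mul_iff_left hs0 hst).1 h4
  exact (ENNReal.rpow_le_rpow_iff (by norm_num : (0 : ℝ) < 1 / 2)).1 h3

end existence

/-! ### Relative entropies of measures with densities -/

lemma extIntegral_eq_of_integrable {α : Type*} [MeasurableSpace α] {ν : Measure α} {f : α → EReal}
    {r : α → ℝ} (hf : f =ᵐ[ν] fun a => (r a : EReal)) (hr : Integrable r ν) :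
    extIntegral ν f = ((∫ a, r a ∂ν : ℝ) : EReal) := by
  have h1 : ∫⁻ a, (f a).toENNReal ∂ν = ∫⁻ a, ENNReal.ofReal (r a) ∂ν :=
    lintegral_congr_ae (hf.mono fun a ha => by simp [ha])
  have h2 : ∫⁻ a, (-f a).toENNReal ∂ν = ∫⁻ a, ENNReal.ofReal (-r a) ∂ν :=
    lintegral_congr_ae (hf.mono fun a ha => by
      dsimp only
      rw [ha, ← EReal.coe_neg, EReal.real_coe_toENNReal])
  have h3 : ∫⁻ a, ENNReal.ofReal (r a) ∂ν ≠ ∞ := hr.lintegral_lt_top.ne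
  have h4 : ∫⁻ a, ENNReal.ofReal (-r a) ∂ν ≠ ∞ := hr.neg.lintegral_lt_top.ne
  rw [extIntegral, h1, h2, if_neg h3,
    integral_eq_lintegral_pos_part_sub_lintegral_neg_part hr, EReal.coe_sub,
    EReal.coe_ennreal_toReal h3, EReal.coe_ennreal_toReal h4]

lemma integrable_of_extIntegral_ne_top {α : Type*} [MeasurableSpace α] {ν : Measure α}
    {f : α → EReal} {r : α → ℝ} (hf : f =ᵐ[ν] fun a => (r a : EReal)) (hr : Measurable r)
    (h : extIntegral ν f ≠ ⊤) (hneg : ∫⁻ a, ENNReal.ofReal (-r a) ∂ν ≠ ∞) : Integrable r ν := by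
  have h1 : ∫⁻ a, (f a).toENNReal ∂ν = ∫⁻ a, ENNReal.ofReal (r a) ∂ν :=
    lintegral_congr_ae (hf.mono fun a ha => by simp [ha])
  have h2 : ∫⁻ a, ENNReal.ofReal (r a) ∂ν ≠ ∞ := by
    intro hc
    exact h (by rw [extIntegral, h1, if_pos hc])
  refine ⟨hr.aestronglyMeasurable, ?_⟩
  have h3 : ∀ a, ‖r a‖ₑ = ENNReal.ofReal (r a) + ENNReal.ofReal (-r a) := by
    intro a
    rcases le_total 0 (r a) with h | h
    · rw [Real.enorm_eq_ofReal h, ENNReal.ofReal_of_nonpos (p := -r a) (by linarith), add_zero]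
    · rw [← enorm_neg, Real.enorm_eq_ofReal (by linarith : 0 ≤ -r a), ENNReal.ofReal_of_nonpos h,
        zero_add]
  rw [HasFiniteIntegral]
  simp_rw [h3]
  rw [lintegral_add_left (by fun_prop)]
  exact ENNReal.add_lt_top.2 ⟨h2.lt_top, hneg.lt_top⟩

section density

variable {d p : ℕ} {B : Set (Eu d)} {g ψ : Eu d → ℝ}

lemma pow_two_mul_nonneg (t : ℝ) : 0 ≤ t ^ (2 * p) := (even_two_mul p).pow_nonneg t

lemma integrable_powMeasure_iff (hg : Measurable g) {F : Eu d → ℝ} :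
    Integrable F (powMeasure B p g) ↔ Integrable (fun x => g x ^ (2 * p) * F x)
      (volume.restrict B) := by
  rw [powMeasure, integrable_withDensity_iff_integrable_smul' (by fun_prop)
    (ae_of_all _ fun _ => ENNReal.ofReal_lt_top)]
  simp_rw [ENNReal.toReal_ofReal (pow_two_mul_nonneg _), smul_eq_mul]

lemma integral_powMeasure (hg : Measurable g) (F : Eu d → ℝ) :
    ∫ x, F x ∂(powMeasure B p g) = ∫ x in B, g x ^ (2 * p) * F x := by
  rw [powMeasure, integral_withDensity_eq_integral_toReal_smul (by fun_prop)
    (ae_of_all _ fun _ => ENNReal.ofReal_lt_top)]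
  simp_rw [ENNReal.toReal_ofReal (pow_two_mul_nonneg _), smul_eq_mul]

lemma lintegral_powMeasure (hg : Measurable g) {F : Eu d → ℝ≥0∞} (hF : Measurable F) :
    ∫⁻ x, F x ∂(powMeasure B p g) = ∫⁻ x in B, ENNReal.ofReal (g x ^ (2 * p)) * F x := by
  rw [powMeasure, lintegral_withDensity_eq_lintegral_mul _ (by fun_prop) hF]
  rfl

lemma ae_powMeasure_iff (hp : 1 ≤ p) (hg : Measurable g) {P : Eu d → Prop} :
    (∀ᵐ x ∂(powMeasure B p g), P x) ↔ ∀ᵐ x ∂(volume.restrict B), g x ≠ 0 → P x := by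
  rw [powMeasure, ae_withDensity_iff (by fun_prop)]
  refine eventually_congr (Eventually.of_forall fun x => ?_)
  have : ENNReal.ofReal (g x ^ (2 * p)) ≠ 0 ↔ g x ≠ 0 := by
    rw [ne_eq, ENNReal.ofReal_eq_zero, not_le]
    constructor
    · intro h h0
      rw [h0, zero_pow (by omega)] at h
      exact lt_irrefl _ h
    · intro h
      exact lt_of_le_of_ne (pow_two_mul_nonneg _) (pow_ne_zero _ h).symm
  rw [this]

lemma powMeasure_absolutelyContinuous_iff (hp : 1 ≤ p) (hg : Measurable g) (hψ : Measurable ψ) :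
    powMeasure B p g ≪ powMeasure B p ψ ↔
      ∀ᵐ x ∂(volume.restrict B), ψ x = 0 → g x = 0 := by
  constructor
  · intro h
    have h1 : ∀ᵐ x ∂(powMeasure B p ψ), ψ x ≠ 0 :=
      (ae_powMeasure_iff hp hψ).2 (ae_of_all _ fun x h => h)
    filter_upwards [(ae_powMeasure_iff hp hg).1 (h.ae_le h1)] with x hx h0
    by_contra hc
    exact hx hc h0
  · intro h
    refine Measure.AbsolutelyContinuous.mk fun s hs h0 => ?_
    have h1 : ∀ᵐ x ∂(powMeasure B p ψ), x ∉ s := measure_eq_zero_iff_ae_notMem.1 h0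
    rw [ae_powMeasure_iff hp hψ] at h1
    refine measure_eq_zero_iff_ae_notMem.2 ?_
    rw [ae_powMeasure_iff hp hg]
    filter_upwards [h, h1] with x hx1 hx2 hx3
    exact hx2 fun h0 => hx3 (hx1 h0)

lemma log_rnDeriv_powMeasure (hp : 1 ≤ p) (hg : Measurable g) (hψ : Measurable ψ)
    (hg0 : ∀ x, 0 ≤ g x) (hψ0 : ∀ x, 0 ≤ ψ x)
    (h : ∀ᵐ x ∂(volume.restrict B), ψ x = 0 → g x = 0) :
    (fun x => ENNReal.log ((powMeasure B p g).rnDeriv (powMeasure B p ψ) x)) =ᵐ[powMeasure B p g]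
      fun x => ((2 * p * (Real.log (g x) - Real.log (ψ x)) : ℝ) : EReal) := by
  have hac := (powMeasure_absolutelyContinuous_iff hp hg hψ).2 h
  have hsf : SigmaFinite (powMeasure B p ψ) := by unfold powMeasure; infer_instance
  have e1 : powMeasure B p g =
      (powMeasure B p ψ).withDensity fun x => ENNReal.ofReal ((g x / ψ x) ^ (2 * p)) := by
    rw [powMeasure, powMeasure, ← withDensity_mul _ (by fun_prop) (by fun_prop)]
    refine withDensity_congr_ae ?_
    filter_upwards [h] with x hx
    rw [Pi.mul_apply, ← ENNReal.ofReal_mul (pow_two_mul_nonneg _), ← mul_pow]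
    by_cases h0 : ψ x = 0
    · rw [hx h0, h0]; simp
    · rw [mul_div_cancel₀ _ h0]
  have e2 : (powMeasure B p g).rnDeriv (powMeasure B p ψ) =ᵐ[powMeasure B p g]
      fun x => ENNReal.ofReal ((g x / ψ x) ^ (2 * p)) := by
    have h1 : ((powMeasure B p ψ).withDensity
        fun x => ENNReal.ofReal ((g x / ψ x) ^ (2 * p))).rnDeriv (powMeasure B p ψ)
        =ᵐ[powMeasure B p ψ] fun x => ENNReal.ofReal ((g x / ψ x) ^ (2 * p)) :=
      Measure.rnDeriv_withDensity _ (by fun_prop)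
    rw [← e1] at h1
    exact hac.ae_le h1
  have e3 : ∀ᵐ x ∂(powMeasure B p g), g x ≠ 0 ∧ ψ x ≠ 0 := by
    rw [ae_powMeasure_iff hp hg]
    filter_upwards [h] with x hx h0
    exact ⟨h0, fun hc => h0 (hx hc)⟩
  filter_upwards [e2, e3] with x hx1 hx2
  have hgx : 0 < g x := lt_of_le_of_ne (hg0 x) hx2.1.symm
  have hψx : 0 < ψ x := lt_of_le_of_ne (hψ0 x) hx2.2.symm
  rw [hx1, ENNReal.log_ofReal_of_pos (by positivity), Real.log_pow, Real.log_div hgx.ne' hψx.ne']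
  push_cast
  rfl

/-- The negative part of a relative entropy is at most the total mass of the reference measure. -/
lemma lintegral_neg_log_le (hp : 1 ≤ p) (hg : Measurable g) (hψ : Measurable ψ)
    (hg0 : ∀ x, 0 ≤ g x) (hψ0 : ∀ x, 0 ≤ ψ x)
    (h : ∀ᵐ x ∂(volume.restrict B), ψ x = 0 → g x = 0) :
    ∫⁻ x, ENNReal.ofReal (-(2 * p * (Real.log (g x) - Real.log (ψ x)))) ∂(powMeasure B p g) ≤
      powMeasure B p ψ Set.univ := by
  rw [lintegral_powMeasure hg (by fun_prop), powMeasure, withDensity_apply _ MeasurableSet.univ,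
    Measure.restrict_univ]
  refine lintegral_mono_ae ?_
  filter_upwards [h] with x hx
  rw [← ENNReal.ofReal_mul (pow_two_mul_nonneg _)]
  refine ENNReal.ofReal_le_ofReal ?_
  rcases (hg0 x).eq_or_lt with h0 | h0
  · rw [← h0, zero_pow (by omega), zero_mul]
    exact pow_two_mul_nonneg _
  have hψx : 0 < ψ x := lt_of_le_of_ne (hψ0 x) fun hc => h0.ne' (hx hc.symm)
  have h1 := Real.log_le_sub_one_of_pos (x := ψ x ^ (2 * p) / g x ^ (2 * p)) (by positivity)
  rw [Real.log_div (by positivity) (by positivity), Real.log_pow, Real.log_pow] at h1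
  push_cast at h1
  have h2 : 0 < g x ^ (2 * p) := by positivity
  calc g x ^ (2 * p) * -(2 * p * (Real.log (g x) - Real.log (ψ x)))
      ≤ g x ^ (2 * p) * (ψ x ^ (2 * p) / g x ^ (2 * p) - 1) := by
        gcongr
        linarith
    _ = ψ x ^ (2 * p) - g x ^ (2 * p) := by field_simp
    _ ≤ _ := by linarith

/-- A relative entropy with respect to `ψ^{2p} dx` is a convergent integral or `∞`. -/
lemma relEntropy_powMeasure_cases (hp : 1 ≤ p) (hg : Measurable g) (hψ : Measurable ψ)
    (hg0 : ∀ x, 0 ≤ g x) (hψ0 : ∀ x, 0 ≤ ψ x) (hfin : powMeasure B p ψ Set.univ ≠ ∞) :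
    relEntropy (powMeasure B p g) (powMeasure B p ψ) = ⊤ ∨
      (∀ᵐ x ∂(volume.restrict B), ψ x = 0 → g x = 0) ∧
      Integrable (fun x => g x ^ (2 * p) * (Real.log (g x) - Real.log (ψ x)))
        (volume.restrict B) := by
  by_cases hac : powMeasure B p g ≪ powMeasure B p ψ
  · rw [or_iff_not_imp_left, relEntropy, if_pos hac]
    intro htop
    have h := (powMeasure_absolutelyContinuous_iff hp hg hψ).1 hac
    refine ⟨h, ?_⟩
    have h1 := integrable_of_extIntegral_ne_top (log_rnDeriv_powMeasure hp hg hψ hg0 hψ0 h)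
      (by fun_prop) htop (ne_top_of_le_ne_top hfin (lintegral_neg_log_le hp hg hψ hg0 hψ0 h))
    rw [integrable_powMeasure_iff hg] at h1
    refine (h1.const_mul (2 * p : ℝ)⁻¹).congr (ae_of_all _ fun x => ?_)
    have hp0 : (p : ℝ) ≠ 0 := by exact_mod_cast (by omega : p ≠ 0)
    field_simp
  · left
    rw [relEntropy, if_neg hac]

lemma relEntropy_powMeasure_eq (hp : 1 ≤ p) (hg : Measurable g) (hψ : Measurable ψ)
    (hg0 : ∀ x, 0 ≤ g x) (hψ0 : ∀ x, 0 ≤ ψ x)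
    (h : ∀ᵐ x ∂(volume.restrict B), ψ x = 0 → g x = 0)
    (hint : Integrable (fun x => g x ^ (2 * p) * (Real.log (g x) - Real.log (ψ x)))
      (volume.restrict B)) :
    relEntropy (powMeasure B p g) (powMeasure B p ψ) =
      ((2 * p * ∫ x in B, g x ^ (2 * p) * (Real.log (g x) - Real.log (ψ x)) : ℝ) : EReal) := by
  rw [relEntropy, if_pos ((powMeasure_absolutelyContinuous_iff hp hg hψ).2 h)]
  have hint' : Integrable (fun x => 2 * p * (Real.log (g x) - Real.log (ψ x)))
      (powMeasure B p g) := by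
    rw [integrable_powMeasure_iff hg]
    refine (hint.const_mul (2 * p : ℝ)).congr (ae_of_all _ fun x => ?_)
    ring
  rw [extIntegral_eq_of_integrable (log_rnDeriv_powMeasure hp hg hψ hg0 hψ0 h) hint',
    integral_const_mul, integral_powMeasure hg]

/-- Probability measures on `B` with a density are of the form `g^{2p} dx`. -/
lemma exists_normalised_powMeasure_eq (hp : 1 ≤ p) {μ : Measure (Eu d)} [IsProbabilityMeasure μ]
    (h : μ ≪ volume.restrict B) : ∃ g : Eu d → ℝ, Normalised B p g ∧ μ = powMeasure B p g := by
  set r := μ.rnDeriv (volume.restrict B) with hr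
  have mr : Measurable r := Measure.measurable_rnDeriv _ _
  have hp0 : (p : ℝ) ≠ 0 := by exact_mod_cast (by omega : p ≠ 0)
  have e1 : ∀ᵐ x ∂(volume.restrict B),
      ENNReal.ofReal (((r x).toReal ^ (1 / (2 * p : ℝ))) ^ (2 * p)) = r x := by
    filter_upwards [Measure.rnDeriv_lt_top μ (volume.restrict B)] with x hx
    rw [← Real.rpow_natCast, ← Real.rpow_mul ENNReal.toReal_nonneg]
    have : 1 / (2 * p : ℝ) * ((2 * p : ℕ) : ℝ) = 1 := by push_cast; field_simp
    rw [this, Real.rpow_one, ENNReal.ofReal_toReal hx.ne]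
  have e2 : μ = powMeasure B p fun x => (r x).toReal ^ (1 / (2 * p : ℝ)) := by
    rw [powMeasure, withDensity_congr_ae e1, Measure.withDensity_rnDeriv_eq _ _ h]
  refine ⟨_, ⟨by fun_prop, fun x => by positivity, ?_⟩, e2⟩
  rw [lintegral_congr_ae e1, Measure.lintegral_rnDeriv h, measure_univ]

lemma powMeasure_mem_probOn {g : Eu d → ℝ} (hB : MeasurableSet B)
    (hg : ∫⁻ x in B, ENNReal.ofReal (g x ^ (2 * p)) = 1) : powMeasure B p g ∈ probOn B := by
  refine ⟨⟨?_⟩, ?_⟩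
  · rw [powMeasure, withDensity_apply _ MeasurableSet.univ, Measure.restrict_univ, hg]
  · refine withDensity_absolutelyContinuous _ _ ?_
    rw [Measure.restrict_apply hB.compl, Set.compl_inter_self, measure_empty]

end density

/-! ### The Gibbs variational principle for the Green entropy -/

section gibbs

variable {α : Type*} [MeasurableSpace α] {v : Measure α} {G : α × α → ℝ≥0∞} {f m : α → ℝ}

/-- There is equality unless `t` is `0` or `∞`. -/
lemma mul_div_mul_le {a b t : ℝ≥0∞} (hb : b ≠ ∞) : t * (a / (b * t)) ≤ a / b := by
  rcases eq_or_ne t 0 with rfl | h0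
  · simp
  rcases eq_or_ne t ∞ with rfl | ht
  · rcases eq_or_ne b 0 with rfl | hb0
    · rcases eq_or_ne a 0 with rfl | ha
      · simp
      · rw [ENNReal.div_zero ha]
        exact le_top
    · simp [ENNReal.mul_top hb0]
  · rw [← mul_div_assoc, mul_comm t a, ENNReal.mul_div_mul_right _ _ h0 ht]

lemma prod_withDensity_ofReal [SigmaFinite v] (hm : Measurable m) :
    (v.withDensity fun x => ENNReal.ofReal (m x)).prod
        (v.withDensity fun x => ENNReal.ofReal (m x)) =
      (v.prod v).withDensity fun z => ENNReal.ofReal (m z.1) * ENNReal.ofReal (m z.2) :=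
  prod_withDensity (by fun_prop) (by fun_prop)

lemma ae_withDensity_ofReal_iff (hm : Measurable m) (hm0 : ∀ x, 0 ≤ m x) {P : α → Prop} :
    (∀ᵐ x ∂(v.withDensity fun x => ENNReal.ofReal (m x)), P x) ↔ ∀ᵐ x ∂v, m x ≠ 0 → P x := by
  rw [ae_withDensity_iff (by fun_prop)]
  refine eventually_congr (Eventually.of_forall fun x => ?_)
  rw [ne_eq, ENNReal.ofReal_eq_zero, not_le, (hm0 x).lt_iff_ne, ne_comm]

lemma integrable_withDensity_ofReal_iff (hm : Measurable m) (hm0 : ∀ x, 0 ≤ m x) {F : α → ℝ} :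
    Integrable F (v.withDensity fun x => ENNReal.ofReal (m x)) ↔
      Integrable (fun x => m x * F x) v := by
  rw [integrable_withDensity_iff_integrable_smul' (by fun_prop)
    (ae_of_all _ fun _ => ENNReal.ofReal_lt_top)]
  simp_rw [ENNReal.toReal_ofReal (hm0 _), smul_eq_mul]

lemma integral_withDensity_ofReal (hm : Measurable m) (hm0 : ∀ x, 0 ≤ m x) (F : α → ℝ) :
    ∫ x, F x ∂(v.withDensity fun x => ENNReal.ofReal (m x)) = ∫ x, m x * F x ∂v := by
  rw [integral_withDensity_eq_integral_toReal_smul (by fun_prop)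
    (ae_of_all _ fun _ => ENNReal.ofReal_lt_top)]
  simp_rw [ENNReal.toReal_ofReal (hm0 _), smul_eq_mul]

/-- The integral of `a(x) + a(y)` against a measure on the square depends only on the marginals. -/
lemma integrable_add_marginals {μ : Measure α} {ν : Measure (α × α)} (h1 : ν.fst = μ)
    (h2 : ν.snd = μ) {a : α → ℝ} (ha : Integrable a μ) :
    Integrable (fun z : α × α => a z.1 + a z.2) ν ∧
      ∫ z, (a z.1 + a z.2) ∂ν = 2 * ∫ x, a x ∂μ := by
  have ha1 : Integrable a (ν.map Prod.fst) := by change Integrable a ν.fst; rwa [h1]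
  have ha2 : Integrable a (ν.map Prod.snd) := by change Integrable a ν.snd; rwa [h2]
  have i1 : Integrable (fun z : α × α => a z.1) ν := ha1.comp_measurable measurable_fst
  have i2 : Integrable (fun z : α × α => a z.2) ν := ha2.comp_measurable measurable_snd
  refine ⟨i1.add i2, ?_⟩
  rw [integral_add i1 i2, ← integral_map (by fun_prop) ha1.1, ← integral_map (by fun_prop) ha2.1]
  change ∫ x, a x ∂ν.fst + ∫ x, a x ∂ν.snd = _
  rw [h1, h2, two_mul]

/-- The lower bound in the Gibbs variational principle: for a coupling `ν` of `m dv` with itself,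
`∫ log (dν/(m dv ⊗ m dv)) - log G dν ≥ 2 ∫ m log (f/m) dv - log ∫∫ f G f`. It is Jensen's
inequality for `log`, in the form `log u ≤ u - 1` with `u = f(x) G f(y) / (c · dν/(dv ⊗ dv))`. -/
lemma le_extIntegral_log_rnDeriv_div [SigmaFinite v] (hG : Measurable G) (hf : Measurable f)
    (hm : Measurable m) (hf0 : ∀ x, 0 ≤ f x) (hm0 : ∀ x, 0 ≤ m x)
    (hfm : ∀ᵐ x ∂v, f x = 0 → m x = 0) (hm1 : ∫⁻ x, ENNReal.ofReal (m x) ∂v = 1)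
    (hT : Integrable (fun x => m x * (Real.log (f x) - Real.log (m x))) v) {c : ℝ} (hc : 0 < c)
    (hE : ∫⁻ z, ENNReal.ofReal (f z.1) * G z * ENNReal.ofReal (f z.2) ∂(v.prod v) ≤
      ENNReal.ofReal c)
    {μ : Measure α} (hμ : μ = v.withDensity fun x => ENNReal.ofReal (m x)) {ν : Measure (α × α)}
    (h1 : ν.fst = μ) (h2 : ν.snd = μ) (hac : ν ≪ μ.prod μ) :
    ((2 * ∫ x, m x * (Real.log (f x) - Real.log (m x)) ∂v - Real.log c : ℝ) : EReal) ≤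
      extIntegral ν fun z => ENNReal.log (ν.rnDeriv (μ.prod μ) z / G z) := by
  set η := ν.rnDeriv (μ.prod μ) with hη
  have mη : Measurable η := Measure.measurable_rnDeriv _ _
  by_cases htop : extIntegral ν (fun z => ENNReal.log (η z / G z)) = ⊤
  · rw [htop]; exact le_top
  have hμp : IsProbabilityMeasure μ := ⟨by
    rw [hμ, withDensity_apply _ MeasurableSet.univ, Measure.restrict_univ, hm1]⟩
  have hνp : IsProbabilityMeasure ν := ⟨by rw [← Measure.fst_univ, h1, measure_univ]⟩
  have hprod : μ.prod μ =
      (v.prod v).withDensity fun z => ENNReal.ofReal (m z.1) * ENNReal.ofReal (m z.2) := by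
    rw [hμ, prod_withDensity_ofReal hm]
  have hacv : ν ≪ v.prod v := hac.trans (hprod ▸ withDensity_absolutelyContinuous _ _)
  -- the sets on which the integrand degenerates are null sets for `ν`
  have hpos : ∀ᵐ x ∂μ, 0 < f x ∧ 0 < m x := by
    rw [hμ, ae_withDensity_ofReal_iff hm hm0]
    filter_upwards [hfm] with x hx h0
    exact ⟨(hf0 x).lt_of_ne fun h => h0 (hx h.symm), (hm0 x).lt_of_ne h0.symm⟩
  have hpos1 : ∀ᵐ z ∂ν, 0 < f z.1 ∧ 0 < m z.1 :=
    ae_of_ae_map (f := Prod.fst) (p := fun x => 0 < f x ∧ 0 < m x) (by fun_prop)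
      (by change ∀ᵐ x ∂ν.fst, _; rwa [h1])
  have hpos2 : ∀ᵐ z ∂ν, 0 < f z.2 ∧ 0 < m z.2 :=
    ae_of_ae_map (f := Prod.snd) (p := fun x => 0 < f x ∧ 0 < m x) (by fun_prop)
      (by change ∀ᵐ x ∂ν.snd, _; rwa [h2])
  have hη0 : ∀ᵐ z ∂ν, 0 < η z := Measure.rnDeriv_pos hac
  have hηt : ∀ᵐ z ∂ν, η z < ∞ := hac.ae_le (Measure.rnDeriv_lt_top _ _)
  have hGt : ∀ᵐ z ∂ν, G z ≠ ∞ := by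
    have h3 : ∀ᵐ z ∂ν, ENNReal.ofReal (f z.1) * G z * ENNReal.ofReal (f z.2) < ∞ :=
      hacv.ae_le (ae_lt_top (by fun_prop) (ne_top_of_le_ne_top ENNReal.ofReal_ne_top hE))
    filter_upwards [h3, hpos1, hpos2] with z hz hz1 hz2 hc
    rw [hc, ENNReal.mul_top (ENNReal.ofReal_pos.2 hz1.1).ne',
      ENNReal.top_mul (ENNReal.ofReal_pos.2 hz2.1).ne'] at hz
    exact lt_irrefl _ hz
  have hG0 : ∀ᵐ z ∂ν, G z ≠ 0 := by
    have h3 : ∫⁻ z, (ENNReal.log (η z / G z)).toENNReal ∂ν ≠ ∞ := fun h =>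
      htop (by rw [extIntegral, if_pos h])
    filter_upwards [ae_lt_top ((mη.div hG).ennreal_log.ereal_toENNReal) h3, hη0] with z hz hz0 hc
    rw [Pi.div_apply, hc, ENNReal.div_zero hz0.ne', ENNReal.log_top, EReal.toENNReal_top] at hz
    exact lt_irrefl _ hz
  -- the integrand is a real function `r`
  set r : α × α → ℝ := fun z => Real.log (η z / G z).toReal with hr
  have mr : Measurable r := by fun_prop
  have hlog : (fun z => ENNReal.log (η z / G z)) =ᵐ[ν] fun z => (r z : EReal) := by
    filter_upwards [hη0, hηt, hGt, hG0] with z z1 z2 z3 z4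
    exact ENNReal.log_pos_real (ENNReal.div_ne_zero.2 ⟨z1.ne', z3⟩) (ENNReal.div_ne_top z2.ne z4)
  set τ : α → ℝ := fun x => Real.log (f x) - Real.log (m x) with hτ
  have iτ : Integrable τ μ := by rwa [hμ, integrable_withDensity_ofReal_iff hm hm0]
  obtain ⟨iτ2, eτ2⟩ := integrable_add_marginals h1 h2 iτ
  have eτ : ∫ x, τ x ∂μ = ∫ x, m x * (Real.log (f x) - Real.log (m x)) ∂v := by
    rw [hμ, integral_withDensity_ofReal hm hm0]
  set U : α × α → ℝ≥0∞ := fun z => ENNReal.ofReal (f z.1) * G z * ENNReal.ofReal (f z.2) /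
    (ENNReal.ofReal (m z.1) * ENNReal.ofReal (m z.2) * ENNReal.ofReal c * η z) with hU
  have mU : Measurable U := by fun_prop
  have hU1 : ∫⁻ z, U z ∂ν ≤ 1 := by
    have e1 : ∀ z, η z * U z ≤ ENNReal.ofReal (f z.1) * G z * ENNReal.ofReal (f z.2) /
        (ENNReal.ofReal (m z.1) * ENNReal.ofReal (m z.2) * ENNReal.ofReal c) :=
      fun z => mul_div_mul_le (ENNReal.mul_ne_top (ENNReal.mul_ne_top ENNReal.ofReal_ne_top
        ENNReal.ofReal_ne_top) ENNReal.ofReal_ne_top)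
    rw [← lintegral_rnDeriv_mul hac mU.aemeasurable]
    refine (lintegral_mono e1).trans ?_
    rw [hprod, lintegral_withDensity_eq_lintegral_mul _ (by fun_prop) (by fun_prop)]
    have e2 : ∀ z : α × α, ((fun z : α × α => ENNReal.ofReal (m z.1) * ENNReal.ofReal (m z.2)) *
        fun z : α × α => ENNReal.ofReal (f z.1) * G z * ENNReal.ofReal (f z.2) /
        (ENNReal.ofReal (m z.1) * ENNReal.ofReal (m z.2) * ENNReal.ofReal c)) z ≤
        (ENNReal.ofReal c)⁻¹ * (ENNReal.ofReal (f z.1) * G z * ENNReal.ofReal (f z.2)) := by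
      intro z
      rw [Pi.mul_apply, mul_comm _ (ENNReal.ofReal c), mul_comm (ENNReal.ofReal c)⁻¹]
      exact mul_div_mul_le ENNReal.ofReal_ne_top
    refine (lintegral_mono e2).trans ?_
    rw [lintegral_const_mul _ (by fun_prop)]
    refine (mul_le_mul' le_rfl hE).trans (le_of_eq ?_)
    exact ENNReal.inv_mul_cancel (ENNReal.ofReal_pos.2 hc).ne' ENNReal.ofReal_ne_top
  have iU : Integrable (fun z => (U z).toReal) ν := integrable_toReal_of_lintegral_ne_top
    mU.aemeasurable (ne_top_of_le_ne_top ENNReal.one_ne_top hU1)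
  have eU : ∫ z, (U z).toReal ∂ν ≤ 1 := by
    rw [integral_toReal mU.aemeasurable
      (ae_lt_top mU (ne_top_of_le_ne_top ENNReal.one_ne_top hU1))]
    exact ENNReal.toReal_le_of_le_ofReal zero_le_one (by simpa using hU1)
  set R : α × α → ℝ := fun z => τ z.1 + τ z.2 - Real.log c - ((U z).toReal - 1) with hR
  have iR : Integrable R ν := (iτ2.sub (integrable_const _)).sub (iU.sub (integrable_const _))
  have hRr : ∀ᵐ z ∂ν, R z ≤ r z := by
    filter_upwards [hη0, hηt, hGt, hG0, hpos1, hpos2] with z z1 z2 z3 z4 z5 z6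
    have a1 : 0 < (η z).toReal := ENNReal.toReal_pos z1.ne' z2.ne
    have a2 : 0 < (G z).toReal := ENNReal.toReal_pos z4 z3
    have e1 : (U z).toReal = f z.1 * (G z).toReal * f z.2 / (m z.1 * m z.2 * c * (η z).toReal) := by
      simp only [hU, ENNReal.toReal_div, ENNReal.toReal_mul, ENNReal.toReal_ofReal (hf0 _),
        ENNReal.toReal_ofReal (hm0 _), ENNReal.toReal_ofReal hc.le]
    have e2 : r z = Real.log (η z).toReal - Real.log (G z).toReal := by
      simp only [hr, ENNReal.toReal_div]
      rw [Real.log_div a1.ne' a2.ne']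
    obtain ⟨p1, p2⟩ := z5
    obtain ⟨p3, p4⟩ := z6
    have h3 := Real.log_le_sub_one_of_pos (x := (U z).toReal) (by rw [e1]; positivity)
    have e3 : Real.log (U z).toReal = Real.log (f z.1) + Real.log (G z).toReal + Real.log (f z.2) -
        (Real.log (m z.1) + Real.log (m z.2) + Real.log c + Real.log (η z).toReal) := by
      rw [e1, Real.log_div (by positivity) (by positivity), Real.log_mul (by positivity) p3.ne',
        Real.log_mul p1.ne' a2.ne', Real.log_mul (by positivity) a1.ne',
        Real.log_mul (by positivity) hc.ne', Real.log_mul p2.ne' p4.ne']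
    simp only [hR, hτ]
    rw [e2]
    linarith
  have hneg : ∫⁻ z, ENNReal.ofReal (-r z) ∂ν ≠ ∞ :=
    ne_top_of_le_ne_top iR.neg.lintegral_lt_top.ne (lintegral_mono_ae (hRr.mono fun z hz =>
      ENNReal.ofReal_le_ofReal (by simpa using hz)))
  have ir : Integrable r ν := integrable_of_extIntegral_ne_top hlog mr htop hneg
  rw [extIntegral_eq_of_integrable hlog ir, EReal.coe_le_coe_iff]
  refine le_trans ?_ (integral_mono_ae iR ir hRr)
  have e4 : ∫ z, R z ∂ν = 2 * ∫ x, τ x ∂μ - Real.log c - (∫ z, (U z).toReal ∂ν - 1) := by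
    have i1 : Integrable (fun z : α × α => τ z.1 + τ z.2 - Real.log c) ν :=
      iτ2.sub (integrable_const _)
    have i2 : Integrable (fun z : α × α => (U z).toReal - 1) ν := iU.sub (integrable_const _)
    simp only [hR]
    rw [integral_sub i1 i2, integral_sub iτ2 (integrable_const _),
      integral_sub iU (integrable_const _), eτ2]
    simp
  rw [e4, ← eτ]
  linarith

/-- The measure `f(x) G(x, y) f(y) / c` on the square. If `f` is such that `f · (G f) = c m`, it is
the coupling of `m dv` with itself for which the bound in the Gibbs variational principle is
attained. -/
noncomputable def optimalCoupling (v : Measure α) (G : α × α → ℝ≥0∞) (f : α → ℝ) (c : ℝ) :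
    Measure (α × α) :=
  (v.prod v).withDensity fun z =>
    ENNReal.ofReal (f z.1) * G z * ENNReal.ofReal (f z.2) / ENNReal.ofReal c

lemma optimalCoupling_fst [SigmaFinite v] (hG : Measurable G) (hf : Measurable f) {c : ℝ}
    (hc : 0 < c) (hpot : ∀ᵐ x ∂v, ENNReal.ofReal (f x) * ∫⁻ y, G (x, y) * ENNReal.ofReal (f y) ∂v =
      ENNReal.ofReal c * ENNReal.ofReal (m x)) :
    (optimalCoupling v G f c).fst = v.withDensity fun x => ENNReal.ofReal (m x) := by
  ext s hs
  rw [Measure.fst_apply hs, optimalCoupling, withDensity_apply _ (measurable_fst hs),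
    withDensity_apply _ hs]
  have e : Prod.fst ⁻¹' s = s ×ˢ (Set.univ : Set α) := by ext; simp
  rw [e, ← Measure.prod_restrict, Measure.restrict_univ, lintegral_prod _ (by fun_prop)]
  refine lintegral_congr_ae ?_
  filter_upwards [ae_restrict_of_ae hpot] with x hx
  have e1 : ∀ y, ENNReal.ofReal (f x) * G (x, y) * ENNReal.ofReal (f y) / ENNReal.ofReal c =
      ENNReal.ofReal (f x) * (ENNReal.ofReal c)⁻¹ * (G (x, y) * ENNReal.ofReal (f y)) := by
    intro y
    rw [div_eq_mul_inv]
    ring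
  have mG : Measurable fun y => G (x, y) := hG.comp (by fun_prop)
  simp only [e1]
  rw [lintegral_const_mul _ (by fun_prop), mul_right_comm, hx, mul_right_comm,
    ENNReal.mul_inv_cancel (ENNReal.ofReal_pos.2 hc).ne' ENNReal.ofReal_ne_top, one_mul]

lemma optimalCoupling_snd [SigmaFinite v] (hsymm : ∀ x y, G (x, y) = G (y, x)) (c : ℝ) :
    (optimalCoupling v G f c).snd = (optimalCoupling v G f c).fst := by
  ext s hs
  rw [Measure.fst_apply hs, Measure.snd_apply hs, optimalCoupling,
    withDensity_apply _ (measurable_fst hs), withDensity_apply _ (measurable_snd hs),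
    ← lintegral_indicator (measurable_snd hs), ← lintegral_indicator (measurable_fst hs),
    ← lintegral_prod_swap]
  refine lintegral_congr fun z => ?_
  have : G z.swap = G z := hsymm z.2 z.1
  by_cases hz : z.1 ∈ s
  · rw [Set.indicator_of_mem (by exact hz), Set.indicator_of_mem (by exact hz), this]
    simp only [Prod.fst_swap, Prod.snd_swap]
    rw [mul_right_comm, mul_comm (ENNReal.ofReal (f z.2)), mul_right_comm]
  · rw [Set.indicator_of_notMem (by exact hz), Set.indicator_of_notMem (by exact hz)]

/-- Equality in the Gibbs variational principle. -/
lemma extIntegral_optimalCoupling [SigmaFinite v] (hG : Measurable G)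
    (hsymm : ∀ x y, G (x, y) = G (y, x)) (hf : Measurable f)
    (hm : Measurable m) (hf0 : ∀ x, 0 ≤ f x) (hm0 : ∀ x, 0 ≤ m x)
    (hfm : ∀ᵐ x ∂v, f x = 0 ↔ m x = 0) (hm1 : ∫⁻ x, ENNReal.ofReal (m x) ∂v = 1)
    (hT : Integrable (fun x => m x * (Real.log (f x) - Real.log (m x))) v) {c : ℝ} (hc : 0 < c)
    (hpot : ∀ᵐ x ∂v, ENNReal.ofReal (f x) * ∫⁻ y, G (x, y) * ENNReal.ofReal (f y) ∂v =
      ENNReal.ofReal c * ENNReal.ofReal (m x))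
    {μ : Measure α} (hμ : μ = v.withDensity fun x => ENNReal.ofReal (m x)) :
    ∃ ν : Measure (α × α), ν.fst = μ ∧ ν.snd = μ ∧ ν ≪ μ.prod μ ∧
      extIntegral ν (fun z => ENNReal.log (ν.rnDeriv (μ.prod μ) z / G z)) =
      ((2 * ∫ x, m x * (Real.log (f x) - Real.log (m x)) ∂v - Real.log c : ℝ) : EReal) := by
  set ν := optimalCoupling v G f c with hν
  have h1 : ν.fst = μ := by rw [hμ]; exact optimalCoupling_fst hG hf hc hpot
  have h2 : ν.snd = μ := by rw [hν, optimalCoupling_snd hsymm, ← hν, h1]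
  have hμp : IsProbabilityMeasure μ := ⟨by
    rw [hμ, withDensity_apply _ MeasurableSet.univ, Measure.restrict_univ, hm1]⟩
  have hνp : IsProbabilityMeasure ν := ⟨by rw [← Measure.fst_univ, h1, measure_univ]⟩
  have hprod : μ.prod μ =
      (v.prod v).withDensity fun z => ENNReal.ofReal (m z.1) * ENNReal.ofReal (m z.2) := by
    rw [hμ, prod_withDensity_ofReal hm]
  -- the density of `ν` with respect to `μ ⊗ μ`
  set D : α × α → ℝ≥0∞ := fun z => ENNReal.ofReal (f z.1 / m z.1) * G z *
    ENNReal.ofReal (f z.2 / m z.2) / ENNReal.ofReal c with hD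
  have mD : Measurable D := by fun_prop
  have hfm1 : ∀ᵐ z ∂(v.prod v), f z.1 = 0 ↔ m z.1 = 0 :=
    Measure.quasiMeasurePreserving_fst.ae hfm
  have hfm2 : ∀ᵐ z ∂(v.prod v), f z.2 = 0 ↔ m z.2 = 0 :=
    Measure.quasiMeasurePreserving_snd.ae hfm
  have hνD : ν = (μ.prod μ).withDensity D := by
    rw [hprod, ← withDensity_mul _ (by fun_prop) mD]
    refine withDensity_congr_ae ?_
    have key : ∀ x, (f x = 0 ↔ m x = 0) →
        ENNReal.ofReal (m x) * ENNReal.ofReal (f x / m x) = ENNReal.ofReal (f x) := by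
      intro x hx
      rw [← ENNReal.ofReal_mul (hm0 x)]
      by_cases h : m x = 0
      · rw [h, hx.2 h, zero_mul]
      · rw [mul_div_cancel₀ _ h]
    filter_upwards [hfm1, hfm2] with z z1 z2
    rw [Pi.mul_apply, ← key _ z1, ← key _ z2]
    simp only [hD, div_eq_mul_inv]
    ring
  have hac : ν ≪ μ.prod μ := hνD ▸ withDensity_absolutelyContinuous _ _
  have hrn : ν.rnDeriv (μ.prod μ) =ᵐ[ν] D := by
    have := Measure.rnDeriv_withDensity (μ.prod μ) mD
    rw [← hνD] at this
    exact hac.ae_le this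
  have hpos : ∀ᵐ x ∂μ, 0 < f x ∧ 0 < m x := by
    rw [hμ, ae_withDensity_ofReal_iff hm hm0]
    filter_upwards [hfm] with x hx h0
    exact ⟨(hf0 x).lt_of_ne fun h => h0 (hx.1 h.symm), (hm0 x).lt_of_ne h0.symm⟩
  have hpos1 : ∀ᵐ z ∂ν, 0 < f z.1 ∧ 0 < m z.1 :=
    ae_of_ae_map (f := Prod.fst) (p := fun x => 0 < f x ∧ 0 < m x) (by fun_prop)
      (by change ∀ᵐ x ∂ν.fst, _; rwa [h1])
  have hpos2 : ∀ᵐ z ∂ν, 0 < f z.2 ∧ 0 < m z.2 :=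
    ae_of_ae_map (f := Prod.snd) (p := fun x => 0 < f x ∧ 0 < m x) (by fun_prop)
      (by change ∀ᵐ x ∂ν.snd, _; rwa [h2])
  have hD0 : ∀ᵐ z ∂ν, 0 < D z := by
    filter_upwards [hrn, Measure.rnDeriv_pos hac] with z z1 z2
    rwa [← z1]
  have hDt : ∀ᵐ z ∂ν, D z < ∞ := by
    filter_upwards [hrn, hac.ae_le (Measure.rnDeriv_lt_top ν (μ.prod μ))] with z z1 z2
    rwa [← z1]
  set τ : α → ℝ := fun x => Real.log (f x) - Real.log (m x) with hτ
  have iτ : Integrable τ μ := by rwa [hμ, integrable_withDensity_ofReal_iff hm hm0]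
  obtain ⟨iτ2, eτ2⟩ := integrable_add_marginals h1 h2 iτ
  have eτ : ∫ x, τ x ∂μ = ∫ x, m x * (Real.log (f x) - Real.log (m x)) ∂v := by
    rw [hμ, integral_withDensity_ofReal hm hm0]
  have hlog : (fun z => ENNReal.log (ν.rnDeriv (μ.prod μ) z / G z)) =ᵐ[ν]
      fun z => ((τ z.1 + τ z.2 - Real.log c : ℝ) : EReal) := by
    filter_upwards [hrn, hD0, hDt, hpos1, hpos2] with z z0 z1 z2 ⟨p1, p2⟩ ⟨p3, p4⟩
    have q1 : 0 < f z.1 / m z.1 := by positivity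
    have q2 : 0 < f z.2 / m z.2 := by positivity
    have g0 : G z ≠ 0 := by
      intro h
      simp [hD, h] at z1
    have gt : G z ≠ ∞ := by
      intro h
      simp only [hD, h] at z2
      rw [ENNReal.mul_top (ENNReal.ofReal_pos.2 q1).ne',
        ENNReal.top_mul (ENNReal.ofReal_pos.2 q2).ne', ENNReal.top_div_of_ne_top
          ENNReal.ofReal_ne_top] at z2
      exact lt_irrefl _ z2
    have e1 : D z / G z = ENNReal.ofReal (f z.1 / m z.1 * (f z.2 / m z.2) / c) := by
      rw [ENNReal.ofReal_div_of_pos hc, ENNReal.ofReal_mul q1.le]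
      calc D z / G z = ENNReal.ofReal (f z.1 / m z.1) * ENNReal.ofReal (f z.2 / m z.2) /
            ENNReal.ofReal c * (G z * (G z)⁻¹) := by simp only [hD, div_eq_mul_inv]; ring
        _ = _ := by rw [ENNReal.mul_inv_cancel g0 gt, mul_one]
    rw [z0, e1, ENNReal.log_ofReal_of_pos (by positivity), Real.log_div (by positivity) hc.ne',
      Real.log_mul q1.ne' q2.ne', Real.log_div p1.ne' p2.ne', Real.log_div p3.ne' p4.ne']
  refine ⟨ν, h1, h2, hac, ?_⟩
  rw [extIntegral_eq_of_integrable hlog (iτ2.sub (integrable_const _)),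
    integral_sub iτ2 (integrable_const _), eτ2, eτ]
  simp

end gibbs

/-! ### The functional `J` on measures with densities -/

lemma sum_ereal_coe {ι : Type*} (s : Finset ι) (a : ι → ℝ) :
    ∑ i ∈ s, (a i : EReal) = ((∑ i ∈ s, a i : ℝ) : EReal) := by
  classical
  induction s using Finset.induction_on with
  | empty => simp
  | insert i s hi ih => rw [Finset.sum_insert hi, Finset.sum_insert hi, ih, EReal.coe_add]

lemma sum_ereal_eq_top {ι : Type*} {s : Finset ι} {a : ι → EReal} (h : ∀ i ∈ s, a i ≠ ⊥) {i : ι}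
    (hi : i ∈ s) (htop : a i = ⊤) : ∑ i ∈ s, a i = ⊤ := by
  classical
  have h1 : ∀ t ⊆ s, ∑ i ∈ t, a i ≠ ⊥ := by
    intro t ht
    induction t using Finset.induction_on with
    | empty => simp
    | insert j t hj ih =>
      rw [Finset.sum_insert hj, ne_eq, EReal.add_eq_bot_iff, not_or]
      exact ⟨h j (ht (Finset.mem_insert_self _ _)),
        ih ((Finset.subset_insert _ _).trans ht)⟩
  rw [← Finset.add_sum_erase s a hi, htop, EReal.top_add_of_ne_bot (h1 _ (Finset.erase_subset _ _))]

/-- The log-sum inequality. -/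
lemma sum_mul_log_sub_log_le {ι : Type*} (s : Finset ι) {w e : ι → ℝ} (hw : ∀ i ∈ s, 0 ≤ w i)
    (he : ∀ i ∈ s, 0 ≤ e i) (h : ∀ i ∈ s, e i = 0 → w i = 0) :
    ∑ i ∈ s, w i * (Real.log (e i) - Real.log (w i)) ≤
      (∑ i ∈ s, w i) * (Real.log (∑ i ∈ s, e i) - Real.log (∑ i ∈ s, w i)) := by
  set m := ∑ i ∈ s, w i with hm
  set f := ∑ i ∈ s, e i with hf
  rcases (Finset.sum_nonneg hw).eq_or_lt with h0 | h0
  · rw [eq_comm, Finset.sum_eq_zero_iff_of_nonneg hw] at h0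
    have : m = 0 := Finset.sum_eq_zero h0
    rw [this, zero_mul, Finset.sum_eq_zero fun i hi => by rw [h0 i hi, zero_mul]]
  have hf0 : 0 < f := by
    obtain ⟨i, hi, hwi⟩ := Finset.exists_ne_zero_of_sum_ne_zero h0.ne'
    exact ((he i hi).lt_of_ne fun hc => hwi (h i hi hc.symm)).trans_le
      (Finset.single_le_sum he hi)
  have key : ∀ i ∈ s, w i * (Real.log (e i) - Real.log (w i)) ≤
      w i * (Real.log f - Real.log m) + (e i * (m / f) - w i) := by
    intro i hi
    rcases (hw i hi).eq_or_lt with hwi | hwi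
    · rw [← hwi, zero_mul, zero_mul, zero_add, sub_zero]
      exact mul_nonneg (he i hi) (div_nonneg h0.le hf0.le)
    have hei : 0 < e i := (he i hi).lt_of_ne fun hc => hwi.ne' (h i hi hc.symm)
    have h1 := Real.log_le_sub_one_of_pos (x := e i * m / (w i * f)) (by positivity)
    rw [Real.log_div (by positivity) (by positivity), Real.log_mul hei.ne' h0.ne',
      Real.log_mul hwi.ne' hf0.ne'] at h1
    have h2 := mul_le_mul_of_nonneg_left h1 hwi.le
    have h3 : w i * (e i * m / (w i * f) - 1) = e i * (m / f) - w i := by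
      field_simp
    rw [h3] at h2
    linarith
  refine (Finset.sum_le_sum key).trans (le_of_eq ?_)
  rw [Finset.sum_add_distrib, ← Finset.sum_mul, Finset.sum_sub_distrib, ← Finset.sum_mul, ← hm,
    ← hf, mul_div_cancel₀ _ hf0.ne']
  ring

/-- The density `∑ λ_i g_i^{2p}` of the mixture of the measures `g_i^{2p} dx`. -/
noncomputable def mixDensity {d n : ℕ} (p : ℕ) (l : Fin n → ℝ) (g : Fin n → Eu d → ℝ) :
    Eu d → ℝ :=
  fun x => ∑ i, l i * g i x ^ (2 * p)

/-- The integrand of `m log (f / m)`, for `f = ∑ √λ_i g_i^{2p-1} φ_i` and `m = ∑ λ_i g_i^{2p}`. -/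
noncomputable def logRatio {d n : ℕ} (p : ℕ) (φ : Fin n → Eu d → ℝ) (l : Fin n → ℝ)
    (g : Fin n → Eu d → ℝ) : Eu d → ℝ :=
  fun x => mixDensity p l g x * (Real.log (mixFun p φ l g x) - Real.log (mixDensity p l g x))

/-- The integrand of `-(p I(λ) + ∑ λ_i H(g_i^{2p} dx | φ_i^{2p})) / (2p)`. -/
noncomputable def entropyDensity {d n : ℕ} (p : ℕ) (φ : Fin n → Eu d → ℝ) (l : Fin n → ℝ)
    (g : Fin n → Eu d → ℝ) : Eu d → ℝ :=
  fun x => ∑ i, (-(l i * Real.log (l i) / 2) * g i x ^ (2 * p) -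
    l i * (g i x ^ (2 * p) * (Real.log (g i x) - Real.log (φ i x))))

/-- The relative entropies `H(g_i^{2p} dx | φ_i^{2p})` of positive weight are finite. -/
def FiniteEntropy {d n : ℕ} (B : Set (Eu d)) (p : ℕ) (φ : Fin n → Eu d → ℝ) (l : Fin n → ℝ)
    (g : Fin n → Eu d → ℝ) : Prop :=
  ∀ i, 0 < l i → (∀ᵐ x ∂(volume.restrict B), φ i x = 0 → g i x = 0) ∧
    Integrable (fun x => g i x ^ (2 * p) * (Real.log (g i x) - Real.log (φ i x)))
      (volume.restrict B)

section functional

variable {d n p : ℕ} {B : Set (Eu d)} {φ : Fin n → Eu d → ℝ} {l : Fin n → ℝ}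
  {g : Fin n → Eu d → ℝ}

lemma measurable_mixDensity (hg : ∀ i, Measurable (g i)) : Measurable (mixDensity p l g) := by
  unfold mixDensity
  fun_prop

lemma mixDensity_nonneg (hl : l ∈ stdSimplex ℝ (Fin n)) (x : Eu d) : 0 ≤ mixDensity p l g x :=
  Finset.sum_nonneg fun i _ => mul_nonneg (hl.1 i) (pow_two_mul_nonneg _)

lemma Normalised.integrable {g : Eu d → ℝ} (hg : Normalised B p g) :
    Integrable (fun x => g x ^ (2 * p)) (volume.restrict B) := by
  have hm := hg.measurable
  refine ⟨by fun_prop, ?_⟩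
  rw [hasFiniteIntegral_iff_ofReal (ae_of_all _ fun x => pow_two_mul_nonneg _), hg.lintegral]
  exact ENNReal.one_lt_top

lemma Normalised.integral {g : Eu d → ℝ} (hg : Normalised B p g) :
    ∫ x in B, g x ^ (2 * p) = 1 := by
  have hm := hg.measurable
  rw [integral_eq_lintegral_of_nonneg_ae (ae_of_all _ fun x => pow_two_mul_nonneg _)
    (by fun_prop), hg.lintegral, ENNReal.toReal_one]

lemma lintegral_mixDensity (hl : l ∈ stdSimplex ℝ (Fin n)) (hg : ∀ i, Normalised B p (g i)) :
    ∫⁻ x in B, ENNReal.ofReal (mixDensity p l g x) = 1 := by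
  have hi : ∀ i, Integrable (fun x => l i * g i x ^ (2 * p)) (volume.restrict B) :=
    fun i => (hg i).integrable.const_mul _
  unfold mixDensity
  rw [← ofReal_integral_eq_lintegral_ofReal (integrable_finsetSum _ fun i _ => hi i)
    (ae_of_all _ (mixDensity_nonneg hl)), integral_finsetSum _ fun i _ => hi i]
  simp_rw [integral_const_mul, (hg _).integral, mul_one, hl.2, ENNReal.ofReal_one]

lemma mixture_eq (hl : l ∈ stdSimplex ℝ (Fin n)) (hg : ∀ i, Measurable (g i))
    {μ : Fin n → Measure (Eu d)} (hμ : ∀ i, 0 < l i → μ i = powMeasure B p (g i)) :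
    mixture l μ =
      (volume.restrict B).withDensity fun x => ENNReal.ofReal (mixDensity p l g x) := by
  ext s hs
  rw [mixture, Measure.finsetSum_apply, withDensity_apply _ hs]
  simp_rw [mixDensity, fun x => ENNReal.ofReal_sum_of_nonneg (s := Finset.univ)
    (f := fun i => l i * g i x ^ (2 * p)) fun i _ => mul_nonneg (hl.1 i) (pow_two_mul_nonneg _)]
  rw [lintegral_finsetSum _ fun i _ => by have := hg i; fun_prop]
  refine Finset.sum_congr rfl fun i _ => ?_
  have := hg i
  simp_rw [ENNReal.ofReal_mul (hl.1 i)]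
  rw [lintegral_const_mul _ (by fun_prop), Measure.smul_apply, smul_eq_mul]
  rcases (hl.1 i).eq_or_lt with h | h
  · rw [← h, ENNReal.ofReal_zero, zero_mul, zero_mul]
  · rw [hμ i h, powMeasure, withDensity_apply _ hs]

lemma Standing.powMeasure_ne_top (H : Standing B p φ) (i : Fin n) :
    powMeasure B p (φ i) Set.univ ≠ ∞ := by
  obtain ⟨S, C, hS, hSB, hvS, hC0, hC, hφS⟩ := H.exists_carrier
  rw [powMeasure, withDensity_apply _ MeasurableSet.univ, Measure.restrict_univ,
    setLIntegral_eq_of_support hS hSB fun x hx => by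
      rw [hφS i x hx, zero_pow (by have := H.one_le_p; omega), ENNReal.ofReal_zero]]
  refine ne_top_of_le_ne_top (b := ∫⁻ _ in S, ENNReal.ofReal (C ^ (2 * p))) ?_
    (lintegral_mono fun x => ENNReal.ofReal_le_ofReal (by gcongr; exacts [H.nonneg i x, hC i x]))
  rw [setLIntegral_const]
  exact ENNReal.mul_ne_top ENNReal.ofReal_ne_top hvS

/-- The functions `∑ √λ_i g_i^{2p-1} φ_i` are integrable. -/
lemma Standing.integrable_mixFun (H : Standing B p φ) (hl : l ∈ stdSimplex ℝ (Fin n))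
    (hg : ∀ i, Normalised B p (g i)) : Integrable (mixFun p φ l g) (volume.restrict B) := by
  obtain ⟨S, C, hS, hSB, hvS, hC0, hC, hφS⟩ := H.exists_carrier
  obtain ⟨K, hK, hnorm⟩ := exists_totalNorm_le hS hSB hvS hC hφS H.one_le_p le_rfl hvS
  refine ⟨(measurable_mixFun H.measurable fun i => (hg i).measurable).aestronglyMeasurable, ?_⟩
  rw [hasFiniteIntegral_iff_ofReal
    (ae_of_all _ (mixFun_nonneg H.nonneg fun i => (hg i).nonneg))]
  refine lt_of_le_of_lt ?_ hK.lt_top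
  have h1 := lintegral_mixFun_mul_le H.one_le_p H.measurable H.nonneg hl hg
    (h := fun _ => 1) measurable_const
  simp only [mul_one] at h1
  exact h1.trans (hnorm _ (by simp))

lemma integrable_entropyDensity (hl : l ∈ stdSimplex ℝ (Fin n)) (hg : ∀ i, Normalised B p (g i))
    (hent : FiniteEntropy B p φ l g) :
    Integrable (entropyDensity p φ l g) (volume.restrict B) ∧
      ∫ x in B, entropyDensity p φ l g x = -(simplexEntropy l / 2) - ∑ i, l i *
        ∫ x in B, g i x ^ (2 * p) * (Real.log (g i x) - Real.log (φ i x)) := by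
  have h1 : ∀ i, Integrable (fun x => -(l i * Real.log (l i) / 2) * g i x ^ (2 * p))
      (volume.restrict B) := fun i => (hg i).integrable.const_mul _
  have h2 : ∀ i, Integrable (fun x =>
      l i * (g i x ^ (2 * p) * (Real.log (g i x) - Real.log (φ i x)))) (volume.restrict B) := by
    intro i
    rcases (hl.1 i).eq_or_lt with h | h
    · rw [← h]; simp
    · exact (hent i h).2.const_mul _
  have h3 : ∀ i, Integrable (fun x => -(l i * Real.log (l i) / 2) * g i x ^ (2 * p) -
      l i * (g i x ^ (2 * p) * (Real.log (g i x) - Real.log (φ i x)))) (volume.restrict B) :=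
    fun i => (h1 i).sub (h2 i)
  refine ⟨integrable_finsetSum _ fun i _ => h3 i, ?_⟩
  unfold entropyDensity
  rw [integral_finsetSum _ fun i _ => h3 i]
  simp_rw [fun i => integral_sub (h1 i) (h2 i), integral_const_mul, (hg _).integral, mul_one]
  rw [Finset.sum_sub_distrib, simplexEntropy, Finset.sum_div, Finset.sum_neg_distrib]

lemma entropyDensity_term (hp : 1 ≤ p) {l g φ : ℝ} (hl : 0 ≤ l) (hg : 0 ≤ g) (hφ : 0 ≤ φ)
    (h : 0 < l → φ = 0 → g = 0) :
    -(l * Real.log l / 2) * g ^ (2 * p) - l * (g ^ (2 * p) * (Real.log g - Real.log φ)) =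
      l * g ^ (2 * p) * (Real.log (√l * g ^ (2 * p - 1) * φ) - Real.log (l * g ^ (2 * p))) := by
  rcases hl.eq_or_lt with h0 | h0
  · simp [← h0]
  rcases hg.eq_or_lt with h1 | h1
  · rw [← h1, zero_pow (by omega)]; simp
  have h2 : 0 < φ := hφ.lt_of_ne fun hc => h1.ne' (h h0 hc.symm)
  rw [Real.log_mul (by positivity) h2.ne', Real.log_mul (by positivity) (by positivity),
    Real.log_mul h0.ne' (by positivity), Real.log_pow, Real.log_pow, Real.log_sqrt hl,
    Nat.cast_sub (by omega)]
  push_cast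
  ring

lemma FiniteEntropy.ae_eq_zero (hl : l ∈ stdSimplex ℝ (Fin n)) (hent : FiniteEntropy B p φ l g) :
    ∀ᵐ x ∂(volume.restrict B), ∀ i, 0 < l i → φ i x = 0 → g i x = 0 := by
  rw [ae_all_iff]
  intro i
  rcases (hl.1 i).eq_or_lt with h | h
  · exact ae_of_all _ fun x hc => absurd hc (by rw [← h]; exact lt_irrefl _)
  · filter_upwards [(hent i h).1] with x hx _
    exact hx

lemma FiniteEntropy.entropyDensity_eq (H : Standing B p φ) (hl : l ∈ stdSimplex ℝ (Fin n))
    (hg : ∀ i, Normalised B p (g i)) (hent : FiniteEntropy B p φ l g) :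
    ∀ᵐ x ∂(volume.restrict B), entropyDensity p φ l g x = ∑ i, l i * g i x ^ (2 * p) *
      (Real.log (√(l i) * g i x ^ (2 * p - 1) * φ i x) - Real.log (l i * g i x ^ (2 * p))) := by
  filter_upwards [hent.ae_eq_zero hl] with x hx
  exact Finset.sum_congr rfl fun i _ =>
    entropyDensity_term H.one_le_p (hl.1 i) ((hg i).nonneg x) (H.nonneg i x) (hx i)

lemma FiniteEntropy.mixDensity_eq_zero (H : Standing B p φ) (hl : l ∈ stdSimplex ℝ (Fin n))
    (hg : ∀ i, Normalised B p (g i)) (hent : FiniteEntropy B p φ l g) :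
    ∀ᵐ x ∂(volume.restrict B), mixFun p φ l g x = 0 → mixDensity p l g x = 0 := by
  filter_upwards [hent.ae_eq_zero hl] with x hx h0
  rw [mixFun, Finset.sum_eq_zero_iff_of_nonneg fun i _ => mul_nonneg (mul_nonneg
      (Real.sqrt_nonneg _) (pow_nonneg ((hg i).nonneg x) _)) (H.nonneg i x)] at h0
  refine Finset.sum_eq_zero fun i _ => ?_
  have h1 := h0 i (Finset.mem_univ i)
  rcases (hl.1 i).eq_or_lt with h | h
  · rw [← h, zero_mul]
  · have hp := H.one_le_p
    rw [mul_eq_zero, mul_eq_zero, Real.sqrt_eq_zero (hl.1 i)] at h1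
    have : g i x = 0 := by
      rcases h1 with (h1 | h1) | h1
      · exact absurd h1 h.ne'
      · exact eq_zero_of_pow_eq_zero h1
      · exact hx i h h1
    rw [this, zero_pow (by omega), mul_zero]

lemma FiniteEntropy.entropyDensity_le (H : Standing B p φ) (hl : l ∈ stdSimplex ℝ (Fin n))
    (hg : ∀ i, Normalised B p (g i)) (hent : FiniteEntropy B p φ l g) :
    ∀ᵐ x ∂(volume.restrict B), entropyDensity p φ l g x ≤ logRatio p φ l g x := by
  filter_upwards [hent.entropyDensity_eq H hl hg, hent.ae_eq_zero hl] with x hx hx2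
  rw [hx, logRatio, mixDensity, mixFun]
  have hp := H.one_le_p
  refine sum_mul_log_sub_log_le _ (fun i _ => mul_nonneg (hl.1 i) (pow_two_mul_nonneg _))
    (fun i _ => mul_nonneg (mul_nonneg (Real.sqrt_nonneg _)
      (pow_nonneg ((hg i).nonneg x) _)) (H.nonneg i x)) fun i _ h1 => ?_
  rcases (hl.1 i).eq_or_lt with h | h
  · rw [← h, zero_mul]
  · rw [mul_eq_zero, mul_eq_zero, Real.sqrt_eq_zero (hl.1 i)] at h1
    have : g i x = 0 := by
      rcases h1 with (h1 | h1) | h1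
      · exact absurd h1 h.ne'
      · exact eq_zero_of_pow_eq_zero h1
      · exact hx2 i h h1
    rw [this, zero_pow (by omega), mul_zero]

/-- `m log (f/m)` is integrable, as it lies between the entropy density and `f`. -/
lemma FiniteEntropy.integrable_logRatio (H : Standing B p φ) (hl : l ∈ stdSimplex ℝ (Fin n))
    (hg : ∀ i, Normalised B p (g i)) (hent : FiniteEntropy B p φ l g) :
    Integrable (logRatio p φ l g) (volume.restrict B) := by
  have mm := measurable_mixDensity (p := p) (l := l) fun i => (hg i).measurable
  have mf := measurable_mixFun (p := p) (l := l) H.measurable fun i => (hg i).measurable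
  refine integrable_of_le_of_le (by unfold logRatio; fun_prop) (hent.entropyDensity_le H hl hg) ?_
    (integrable_entropyDensity hl hg hent).1 (H.integrable_mixFun hl hg)
  filter_upwards [hent.mixDensity_eq_zero H hl hg] with x hx
  have hf0 := mixFun_nonneg (p := p) (l := l) H.nonneg (fun i => (hg i).nonneg) x
  rw [logRatio]
  rcases (mixDensity_nonneg (p := p) (g := g) hl x).eq_or_lt with h | h
  · rw [← h, zero_mul]; exact hf0
  have hf : 0 < mixFun p φ l g x := hf0.lt_of_ne fun hc => h.ne' (hx hc.symm)
  rw [← Real.log_div hf.ne' h.ne']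
  calc _ ≤ mixDensity p l g x * (mixFun p φ l g x / mixDensity p l g x - 1) := by
        gcongr; exact Real.log_le_sub_one_of_pos (by positivity)
    _ = mixFun p φ l g x - mixDensity p l g x := by field_simp
    _ ≤ _ := by linarith

/-- The functional `J` in terms of the densities. -/
lemma FiniteEntropy.jointFunctional_eq (H : Standing B p φ) (hl : l ∈ stdSimplex ℝ (Fin n))
    (hg : ∀ i, Normalised B p (g i)) (hent : FiniteEntropy B p φ l g)
    {μ : Fin n → Measure (Eu d)} (hμ : ∀ i, 0 < l i → μ i = powMeasure B p (g i)) :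
    jointFunctional B p φ (l, μ) = ((-(2 * p * ∫ x in B, entropyDensity p φ l g x) : ℝ) : EReal) +
      ((p : ℝ) : EReal) * greenEntropy B
        ((volume.restrict B).withDensity fun x => ENNReal.ofReal (mixDensity p l g x)) := by
  have e : entropyPart B p φ l μ = ((∑ i, l i * (2 * p *
      ∫ x in B, g i x ^ (2 * p) * (Real.log (g i x) - Real.log (φ i x))) : ℝ) : EReal) := by
    rw [entropyPart, ← sum_ereal_coe]
    refine Finset.sum_congr rfl fun i _ => ?_
    rcases (hl.1 i).eq_or_lt with h | h
    · rw [← h]; simp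
    · rw [hμ i h, relEntropy_powMeasure_eq H.one_le_p (hg i).measurable (H.measurable i)
        (hg i).nonneg (H.nonneg i) (hent i h).1 (hent i h).2, ← EReal.coe_mul]
  rw [jointFunctional, innerFunctional, e, if_neg (EReal.coe_ne_top _),
    mixture_eq hl (fun i => (hg i).measurable) hμ, ← add_assoc, ← EReal.coe_add]
  congr 2
  rw [(integrable_entropyDensity hl hg hent).2, mul_sub, Finset.mul_sum]
  simp only [mul_left_comm (l _)]
  ring

/-- If `J(λ, μ)` is finite, the measures `μ_i` of positive weight have densities `g_i^{2p}` of
finite entropy. -/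
lemma exists_finiteEntropy (H : Standing B p φ) (hl : l ∈ stdSimplex ℝ (Fin n))
    {μ : Fin n → Measure (Eu d)} (hμ : ∀ i, μ i ∈ probOn B)
    (hJ : jointFunctional B p φ (l, μ) ≠ ⊤) :
    ∃ g : Fin n → Eu d → ℝ, (∀ i, Normalised B p (g i)) ∧ FiniteEntropy B p φ l g ∧
      ∀ i, 0 < l i → μ i = powMeasure B p (g i) := by
  obtain ⟨g₀, hg₀⟩ := exists_normalised H.one_le_p H.isOpen H.nonempty
  have key : ∀ i, relEntropy (μ i) (powMeasure B p (φ i)) = ⊤ ∨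
      (∃ r : ℝ, relEntropy (μ i) (powMeasure B p (φ i)) = r) ∧ ∃ g, Normalised B p g ∧
        μ i = powMeasure B p g ∧ (∀ᵐ x ∂(volume.restrict B), φ i x = 0 → g x = 0) ∧
        Integrable (fun x => g x ^ (2 * p) * (Real.log (g x) - Real.log (φ i x)))
          (volume.restrict B) := by
    intro i
    have := (hμ i).1
    by_cases hac : μ i ≪ powMeasure B p (φ i)
    · obtain ⟨g, hg, e⟩ := exists_normalised_powMeasure_eq (B := B) H.one_le_p
        (hac.trans (withDensity_absolutelyContinuous _ _))
      rcases relEntropy_powMeasure_cases H.one_le_p hg.measurable (H.measurable i) hg.nonneg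
        (H.nonneg i) (H.powMeasure_ne_top i) with h | h
      · left; rw [e, h]
      · have h1 := relEntropy_powMeasure_eq H.one_le_p hg.measurable (H.measurable i)
          hg.nonneg (H.nonneg i) h.1 h.2
        exact Or.inr ⟨⟨_, by rw [e, h1]⟩, g, hg, e, h⟩
    · left; rw [relEntropy, if_neg hac]
  have hne : ∀ i, 0 < l i → relEntropy (μ i) (powMeasure B p (φ i)) ≠ ⊤ := by
    intro i hi htop
    apply hJ
    have : entropyPart B p φ l μ = ⊤ := by
      refine sum_ereal_eq_top (fun j _ => ?_) (Finset.mem_univ i)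
        (by rw [htop, EReal.coe_mul_top_of_pos hi])
      rcases (hl.1 j).eq_or_lt with h | h
      · rw [← h]; simp
      rcases key j with h1 | ⟨⟨r, h1⟩, -⟩
      · rw [h1, EReal.coe_mul_top_of_pos h]; simp
      · rw [h1, ← EReal.coe_mul]; exact EReal.coe_ne_bot _
    rw [jointFunctional, innerFunctional, if_pos this, EReal.coe_add_top]
  have hex : ∀ i, ∃ g, Normalised B p g ∧ (0 < l i → μ i = powMeasure B p g ∧
      (∀ᵐ x ∂(volume.restrict B), φ i x = 0 → g x = 0) ∧
        Integrable (fun x => g x ^ (2 * p) * (Real.log (g x) - Real.log (φ i x)))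
          (volume.restrict B)) := by
    intro i
    by_cases hi : 0 < l i
    · obtain ⟨-, g, hg, h⟩ := (key i).resolve_left (hne i hi)
      exact ⟨g, hg, fun _ => h⟩
    · exact ⟨g₀, hg₀, fun h => absurd h hi⟩
  choose g hg h using hex
  exact ⟨g, hg, fun i hi => (h i hi).2, fun i hi => (h i hi).1⟩

end functional

/-! ### Comparison of `J` with the Green energy -/

section comparison

variable {d n p : ℕ} {B : Set (Eu d)} {φ : Fin n → Eu d → ℝ} {l : Fin n → ℝ}
  {g : Fin n → Eu d → ℝ}

lemma mutualEnergy_eq_lintegral_prod (hB : IsOpen B) {u v : Eu d → ℝ≥0∞} (hu : Measurable u)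
    (hv : Measurable v) : mutualEnergy B u v = ∫⁻ z, u z.1 * green B z.1 z.2 * v z.2
      ∂((volume.restrict B).prod (volume.restrict B)) := by
  have mg := measurable_green hB
  rw [lintegral_prod _ (by fun_prop)]
  refine lintegral_congr fun x => ?_
  have mgx : Measurable fun y => green B x y := mg.comp (f := fun y => (x, y)) (by fun_prop)
  rw [potential, ← lintegral_const_mul _ (by fun_prop)]
  simp only [mul_assoc]

lemma Standing.totalNorm_potential_ne_top (H : Standing B p φ) :
    ∃ K : ℝ≥0∞, K ≠ ∞ ∧ ∀ l ∈ stdSimplex ℝ (Fin n), ∀ g : Fin n → Eu d → ℝ,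
      (∀ i, Normalised B p (g i)) →
        totalNorm B p φ (potential B fun y => ENNReal.ofReal (mixFun p φ l g y)) ≤ K := by
  obtain ⟨S, C, hS, hSB, hvS, hC0, hC, hφS⟩ := H.exists_carrier
  obtain ⟨r, hr, D, hD, hpot⟩ := H.exists_potential_le hS hSB hvS hφS
  obtain ⟨K, hK, hnorm⟩ := exists_totalNorm_le hS hSB hvS hC hφS H.one_le_p hr.le hD
  exact ⟨K, hK, fun l hl g hg => hnorm _ (hpot l hl g hg)⟩

lemma Standing.measurable_ofReal_mixFun (H : Standing B p φ) (hg : ∀ i, Normalised B p (g i)) :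
    Measurable fun y => ENNReal.ofReal (mixFun p φ l g y) :=
  (measurable_mixFun H.measurable fun i => (hg i).measurable).ennreal_ofReal

lemma Standing.mixEnergy_ne_top (H : Standing B p φ) (hl : l ∈ stdSimplex ℝ (Fin n))
    (hg : ∀ i, Normalised B p (g i)) : mixEnergy B p φ l g ≠ ∞ := by
  obtain ⟨K, hK, h⟩ := H.totalNorm_potential_ne_top
  exact ne_top_of_le_ne_top hK ((lintegral_mixFun_mul_le H.one_le_p H.measurable H.nonneg hl hg
    (measurable_potential H.isOpen (H.measurable_ofReal_mixFun hg))).trans (h l hl g hg))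

/-- Densities of finite entropy have positive Green energy. -/
lemma FiniteEntropy.mixEnergy_pos (H : Standing B p φ) (hl : l ∈ stdSimplex ℝ (Fin n))
    (hg : ∀ i, Normalised B p (g i)) (hent : FiniteEntropy B p φ l g) :
    0 < mixEnergy B p φ l g := by
  refine mutualEnergy_pos H.isOpen (H.measurable_ofReal_mixFun hg) fun h0 => ?_
  have h1 := lintegral_mixDensity hl hg
  rw [lintegral_congr_ae (g := fun _ => 0) ?_, lintegral_zero] at h1
  · exact zero_ne_one h1
  filter_upwards [h0, hent.mixDensity_eq_zero H hl hg] with x hx1 hx2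
  rw [hx2, ENNReal.ofReal_zero]
  exact le_antisymm (ENNReal.ofReal_eq_zero.1 hx1)
    (mixFun_nonneg H.nonneg (fun i => (hg i).nonneg) x)

/-- The upper bound for `-J` by the Green energy. -/
lemma FiniteEntropy.le_jointFunctional (H : Standing B p φ) (hl : l ∈ stdSimplex ℝ (Fin n))
    (hg : ∀ i, Normalised B p (g i)) (hent : FiniteEntropy B p φ l g)
    {μ : Fin n → Measure (Eu d)} (hμ : ∀ i, 0 < l i → μ i = powMeasure B p (g i)) :
    ((-(p * Real.log (mixEnergy B p φ l g).toReal) : ℝ) : EReal) ≤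
      jointFunctional B p φ (l, μ) := by
  set c := (mixEnergy B p φ l g).toReal with hc
  have hct := H.mixEnergy_ne_top hl hg
  have hc0 : 0 < c := ENNReal.toReal_pos (hent.mixEnergy_pos H hl hg).ne' hct
  have hT := hent.integrable_logRatio H hl hg
  have hle : ∫ x in B, entropyDensity p φ l g x ≤ ∫ x in B, logRatio p φ l g x :=
    integral_mono_ae (integrable_entropyDensity hl hg hent).1 hT (hent.entropyDensity_le H hl hg)
  have hG : ((2 * (∫ x in B, logRatio p φ l g x) - Real.log c : ℝ) : EReal) ≤ greenEntropy B
      ((volume.restrict B).withDensity fun x => ENNReal.ofReal (mixDensity p l g x)) := by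
    refine le_iInf fun ν => le_iInf fun h1 => le_iInf fun h2 => ?_
    split_ifs with hac
    · refine le_extIntegral_log_rnDeriv_div (G := fun z => green B z.1 z.2)
        (measurable_green H.isOpen) (measurable_mixFun H.measurable fun i => (hg i).measurable)
        (measurable_mixDensity fun i => (hg i).measurable)
        (mixFun_nonneg H.nonneg fun i => (hg i).nonneg) (mixDensity_nonneg hl)
        (hent.mixDensity_eq_zero H hl hg) (lintegral_mixDensity hl hg) hT hc0 ?_ rfl h1 h2 hac
      rw [← mutualEnergy_eq_lintegral_prod H.isOpen (H.measurable_ofReal_mixFun hg)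
        (H.measurable_ofReal_mixFun hg), hc, ENNReal.ofReal_toReal hct]
      rfl
    · exact le_top
  rw [hent.jointFunctional_eq H hl hg hμ]
  have hp0 : (0 : EReal) ≤ ((p : ℝ) : EReal) := by
    rw [← EReal.coe_zero, EReal.coe_le_coe_iff]; positivity
  refine le_trans ?_ (add_le_add_right (mul_le_mul_of_nonneg_left hG hp0) _)
  rw [← EReal.coe_mul, ← EReal.coe_add, EReal.coe_le_coe_iff]
  have h2 : (0 : ℝ) ≤ p := by positivity
  nlinarith [mul_le_mul_of_nonneg_left hle h2]

/-- The pair `(λ, g)` maximises the Green energy among all nonnegative normalised functions. -/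
structure IsMixMax (B : Set (Eu d)) (p : ℕ) (φ : Fin n → Eu d → ℝ) (l : Fin n → ℝ)
    (g : Fin n → Eu d → ℝ) : Prop where
  mem : l ∈ stdSimplex ℝ (Fin n)
  normalised : ∀ i, Normalised B p (g i)
  le : ∀ l' ∈ stdSimplex ℝ (Fin n), ∀ g' : Fin n → Eu d → ℝ, (∀ i, Normalised B p (g' i)) →
    mixEnergy B p φ l' g' ≤ mixEnergy B p φ l g

/-- The Euler–Lagrange equations for a maximiser: `φ_i h = ρ √λ_i g_i`, where `h` is the potential
of `∑ √λ_i g_i^{2p-1} φ_i` and `ρ` the maximal energy. Indeed `(λ, g)` attains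
`ρ ≤ ‖(φ_i h)_i‖`, and by duality and the Cauchy–Schwarz inequality this norm is at most `ρ`. -/
theorem IsMixMax.eulerLagrange (H : Standing B p φ) (hM : IsMixMax B p φ l g)
    (h0 : mixEnergy B p φ l g ≠ 0) (i : Fin n) :
    ∀ᵐ x ∂(volume.restrict B), ENNReal.ofReal (φ i x) *
        potential B (fun y => ENNReal.ofReal (mixFun p φ l g y)) x =
      mixEnergy B p φ l g * ENNReal.ofReal (√(l i) * g i x) := by
  set f : Eu d → ℝ≥0∞ := fun y => ENNReal.ofReal (mixFun p φ l g y) with hf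
  have mf : Measurable f := H.measurable_ofReal_mixFun hM.normalised
  have mh := measurable_potential H.isOpen mf
  obtain ⟨K, hK, hKb⟩ := H.totalNorm_potential_ne_top
  have ht : totalNorm B p φ (potential B f) ≠ ∞ :=
    ne_top_of_le_ne_top hK (hKb l hM.mem g hM.normalised)
  have hle : mixEnergy B p φ l g ≤ totalNorm B p φ (potential B f) :=
    lintegral_mixFun_mul_le H.one_le_p H.measurable H.nonneg hM.mem hM.normalised mh
  have hn0 : totalNorm B p φ (potential B f) ≠ 0 := fun h => h0 (le_zero_iff.1 (h ▸ hle))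
  obtain ⟨l', hl', g', hg', e⟩ := exists_lintegral_mixFun_mul_eq H.one_le_p H.isOpen H.nonempty
    H.measurable H.nonneg mh hn0 ht
  have hge : totalNorm B p φ (potential B f) ≤ mixEnergy B p φ l g := by
    rw [← e]
    refine (mutualEnergy_le H.isOpen (H.measurable_ofReal_mixFun hg') mf).trans ?_
    calc _ ≤ mixEnergy B p φ l g ^ (1 / 2 : ℝ) * mixEnergy B p φ l g ^ (1 / 2 : ℝ) :=
          mul_le_mul' (ENNReal.rpow_le_rpow (hM.le l' hl' g' hg') (by norm_num)) le_rfl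
      _ = mixEnergy B p φ l g := by
          rw [← ENNReal.rpow_add_of_nonneg _ _ (by norm_num) (by norm_num)]; norm_num
  have heq := le_antisymm hle hge
  rw [heq]
  exact ae_eq_of_lintegral_mixFun_mul_eq H.one_le_p H.measurable H.nonneg hM.mem hM.normalised mh
    hn0 ht heq i

/-- At almost every point, the vectors `(φ_i)` and `(√λ_i g_i)` of a maximiser are proportional,
unless the latter vanishes. -/
lemma IsMixMax.proportional (H : Standing B p φ) (hM : IsMixMax B p φ l g)
    (h0 : mixEnergy B p φ l g ≠ 0) :
    ∀ᵐ x ∂(volume.restrict B), (∀ i, √(l i) * g i x = 0) ∨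
      0 < (potential B (fun y => ENNReal.ofReal (mixFun p φ l g y)) x).toReal ∧
      ∀ i, φ i x = (mixEnergy B p φ l g).toReal /
        (potential B (fun y => ENNReal.ofReal (mixFun p φ l g y)) x).toReal *
        (√(l i) * g i x) := by
  have hr := H.mixEnergy_ne_top hM.mem hM.normalised
  filter_upwards [ae_all_iff.2 fun i => hM.eulerLagrange H h0 i] with x hx
  set h := potential B (fun y => ENNReal.ofReal (mixFun p φ l g y)) x
  have hw : ∀ i, 0 ≤ √(l i) * g i x :=
    fun i => mul_nonneg (Real.sqrt_nonneg _) ((hM.normalised i).nonneg x)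
  have key : ∀ i, ENNReal.ofReal (φ i x) * h = 0 → √(l i) * g i x = 0 := by
    intro i hi
    rw [hx i, mul_eq_zero, or_iff_right h0, ENNReal.ofReal_eq_zero] at hi
    exact le_antisymm hi (hw i)
  by_cases hh0 : h = 0
  · exact Or.inl fun i => key i (by rw [hh0, mul_zero])
  by_cases hht : h = ∞
  · refine Or.inl fun i => key i ?_
    by_contra hc
    have h1 : ENNReal.ofReal (φ i x) ≠ 0 := fun h => hc (by rw [h, zero_mul])
    have h2 := hx i
    rw [hht, ENNReal.mul_top h1] at h2
    exact ENNReal.mul_ne_top hr ENNReal.ofReal_ne_top h2.symm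
  have hh : 0 < h.toReal := ENNReal.toReal_pos hh0 hht
  refine Or.inr ⟨hh, fun i => ?_⟩
  have h1 := congrArg ENNReal.toReal (hx i)
  rw [ENNReal.toReal_mul, ENNReal.toReal_mul, ENNReal.toReal_ofReal (H.nonneg i x),
    ENNReal.toReal_ofReal (hw i)] at h1
  rw [div_mul_eq_mul_div, eq_div_iff hh.ne', h1]

lemma pow_mul_abs_log_le {k : ℕ} (hk : 1 ≤ k) {r : ℝ} (hr : (k : ℝ) < r) {t : ℝ} (ht : 0 ≤ t) :
    t ^ k * |Real.log t| ≤ (1 + 1 / (r - k)) * (1 + t ^ r) := by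
  have hε : 0 < r - k := by linarith
  have h1 : 0 ≤ t ^ r := Real.rpow_nonneg ht _
  have h2 : 0 ≤ 1 / (r - k) := by positivity
  rcases ht.eq_or_lt with h0 | h0
  · rw [← h0, zero_pow (by omega), zero_mul]
    rw [← h0] at h1
    positivity
  rcases le_total t 1 with h | h
  · have h3 : |Real.log t| ≤ t⁻¹ := by
      rw [abs_of_nonpos (Real.log_nonpos ht h), ← Real.log_inv]
      have := Real.log_le_sub_one_of_pos (inv_pos.2 h0)
      linarith
    have h4 : t ^ k * |Real.log t| ≤ 1 := by
      obtain ⟨j, rfl⟩ : ∃ j, k = j + 1 := ⟨k - 1, by omega⟩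
      calc _ ≤ t ^ (j + 1) * t⁻¹ := by gcongr
        _ = t ^ j := by rw [pow_succ, mul_assoc, mul_inv_cancel₀ h0.ne', mul_one]
        _ ≤ 1 := pow_le_one₀ ht h
    nlinarith [mul_nonneg h2 h1]
  · have h3 : |Real.log t| ≤ t ^ (r - k) / (r - k) := by
      rw [abs_of_nonneg (Real.log_nonneg h)]
      exact Real.log_le_rpow_div ht hε
    have h4 : t ^ k * |Real.log t| ≤ 1 / (r - k) * t ^ r := by
      calc _ ≤ t ^ k * (t ^ (r - k) / (r - k)) := by gcongr
        _ = 1 / (r - k) * (t ^ (k : ℝ) * t ^ (r - k)) := by rw [Real.rpow_natCast]; ring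
        _ = _ := by rw [← Real.rpow_add h0]; congr 2; ring
    nlinarith

/-- The measures of a maximiser have finite relative entropies: by the Euler–Lagrange equations,
their densities are multiples of `(φ_i h)^{2p}`, and `h` belongs to `L^r` for some `r > 2p`. -/
lemma IsMixMax.finiteEntropy (H : Standing B p φ) (hM : IsMixMax B p φ l g)
    (h0 : mixEnergy B p φ l g ≠ 0) : FiniteEntropy B p φ l g := by
  intro i hi
  obtain ⟨S, C, hS, hSB, hvS, hC0, hC, hφS⟩ := H.exists_carrier
  obtain ⟨r, hr, D, hD, hpot⟩ := H.exists_potential_le hS hSB hvS hφS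
  set h := potential B (fun y => ENNReal.ofReal (mixFun p φ l g y)) with hh
  have mh : Measurable h :=
    measurable_potential H.isOpen (H.measurable_ofReal_mixFun hM.normalised)
  set ρ := (mixEnergy B p φ l g).toReal with hρ
  have hρ0 : 0 < ρ := ENNReal.toReal_pos h0 (H.mixEnergy_ne_top hM.mem hM.normalised)
  have hsl : 0 < √(l i) := Real.sqrt_pos.2 hi
  have hp := H.one_le_p
  have hzero : ∀ᵐ x ∂(volume.restrict B), φ i x = 0 → g i x = 0 := by
    filter_upwards [hM.proportional H h0] with x hx hφ
    rcases hx with hx | ⟨hx1, hx⟩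
    · exact (mul_eq_zero.1 (hx i)).resolve_left hsl.ne'
    · have := hx i
      rw [hφ, eq_comm, mul_eq_zero, mul_eq_zero] at this
      exact (this.resolve_left (div_pos hρ0 hx1).ne').resolve_left hsl.ne'
  refine ⟨hzero, ?_⟩
  set A : ℝ := (C / (ρ * √(l i))) ^ (2 * p) * (1 + 1 / (r - (2 * p : ℕ))) with hA
  have mg := (hM.normalised i).measurable
  have mφ := H.measurable i
  have i1 : Integrable (fun x => |Real.log (ρ * √(l i))| * g i x ^ (2 * p)) (volume.restrict B) :=
    (hM.normalised i).integrable.const_mul _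
  have i2 : Integrable (S.indicator fun x => A * (1 + (h x).toReal ^ r)) (volume.restrict B) := by
    rw [integrable_indicator_iff hS, IntegrableOn, Measure.restrict_restrict hS,
      Set.inter_eq_self_of_subset_left hSB]
    have hvS' : IsFiniteMeasure (volume.restrict S) := ⟨by simpa using hvS.lt_top⟩
    refine ((integrable_const _).add ?_).const_mul A
    have := integrable_toReal_of_lintegral_ne_top (μ := volume.restrict S)
      (f := fun x => h x ^ r) (by fun_prop)
      (ne_top_of_le_ne_top hD (hpot l hM.mem g hM.normalised))
    simpa only [ENNReal.toReal_rpow] using this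
  refine (i1.add i2).mono' (by fun_prop) ?_
  filter_upwards [hM.proportional H h0, hzero] with x hx hz
  have hg0 := (hM.normalised i).nonneg x
  have hr' : ((2 * p : ℕ) : ℝ) < r := by push_cast; exact hr
  have hA0 : 0 ≤ A := by
    have : 0 < r - (2 * p : ℕ) := by linarith
    positivity
  have hind : 0 ≤ S.indicator (fun x => A * (1 + (h x).toReal ^ r)) x :=
    Set.indicator_nonneg (fun y _ => by positivity) x
  rw [Pi.add_apply]
  rcases hg0.eq_or_lt with hgx | hgx
  · rw [← hgx, zero_pow (by omega), zero_mul, norm_zero]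
    simpa using hind
  have hφx : φ i x ≠ 0 := fun hc => hgx.ne' (hz hc)
  have hxS : x ∈ S := by
    by_contra hc
    exact hφx (hφS i x hc)
  obtain ⟨hhx, hx⟩ := hx.resolve_left fun hc => (mul_pos hsl hgx).ne' (hc i)
  have hφi : φ i x = ρ / (h x).toReal * (√(l i) * g i x) := hx i
  change 0 < (h x).toReal at hhx
  have hgi : g i x = φ i x / (ρ * √(l i)) * (h x).toReal := by
    rw [hφi]
    field_simp
  have hlog : Real.log (g i x) - Real.log (φ i x) =
      Real.log (h x).toReal - Real.log (ρ * √(l i)) := by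
    rw [hgi, Real.log_mul (by positivity) hhx.ne', Real.log_div hφx (by positivity)]
    ring
  rw [Set.indicator_of_mem hxS, norm_mul, Real.norm_of_nonneg (pow_two_mul_nonneg _), hlog]
  have h3 : g i x ^ (2 * p) * |Real.log (h x).toReal| ≤ A * (1 + (h x).toReal ^ r) := by
    rw [hgi, mul_pow, mul_assoc, hA, mul_assoc]
    refine mul_le_mul ?_ (pow_mul_abs_log_le (by omega) hr' hhx.le) (by positivity)
      (by positivity)
    have := H.nonneg i x
    gcongr
    exact hC i x
  calc g i x ^ (2 * p) * ‖Real.log (h x).toReal - Real.log (ρ * √(l i))‖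
      ≤ g i x ^ (2 * p) * (|Real.log (h x).toReal| + |Real.log (ρ * √(l i))|) := by
        gcongr
        exact norm_sub_le _ _
    _ ≤ _ := by linarith

/-- The value of `J` at the measures of a maximiser. -/
theorem IsMixMax.jointFunctional_le (H : Standing B p φ) (hM : IsMixMax B p φ l g)
    (h0 : mixEnergy B p φ l g ≠ 0) :
    jointFunctional B p φ (l, fun i => powMeasure B p (g i)) ≤
      ((-(p * Real.log (mixEnergy B p φ l g).toReal) : ℝ) : EReal) := by
  set ρ := (mixEnergy B p φ l g).toReal with hρ
  have hρt := H.mixEnergy_ne_top hM.mem hM.normalised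
  have hρ0 : 0 < ρ := ENNReal.toReal_pos h0 hρt
  have hl := hM.mem
  have hg := hM.normalised
  have hp := H.one_le_p
  have hent := hM.finiteEntropy H h0
  have hT := hent.integrable_logRatio H hl hg
  have hw : ∀ x, (∀ i, √(l i) * g i x = 0) → ∀ i, l i * g i x ^ (2 * p) = 0 := by
    intro x hx i
    rcases mul_eq_zero.1 (hx i) with h | h
    · rw [(Real.sqrt_eq_zero (hl.1 i)).1 h, zero_mul]
    · rw [h, zero_pow (by omega), mul_zero]
  have hk : ∀ x i, √(l i) * g i x ^ (2 * p - 1) * (√(l i) * g i x) = l i * g i x ^ (2 * p) := by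
    intro x i
    have e : g i x ^ (2 * p) = g i x ^ (2 * p - 1) * g i x := by
      rw [← pow_succ]; congr 1; omega
    rw [e]
    nth_rewrite 3 [← Real.mul_self_sqrt (hl.1 i)]
    ring
  -- where `E_i = k W_i` for all `i`, there is equality in the log-sum inequality
  have hlogk : ∀ k w : ℝ, 0 < k → 0 ≤ w → w * (Real.log (k * w) - Real.log w) = w * Real.log k := by
    intro k w hk hw
    rcases hw.eq_or_lt with h | h
    · rw [← h, zero_mul, zero_mul]
    · rw [Real.log_mul hk.ne' h.ne']; ring
  have hprop : ∀ᵐ x ∂(volume.restrict B), mixFun p φ l g x = 0 ∧ mixDensity p l g x = 0 ∧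
        entropyDensity p φ l g x = logRatio p φ l g x ∨
      ∃ k : ℝ, 0 < k ∧ mixFun p φ l g x = k * mixDensity p l g x ∧
        entropyDensity p φ l g x = logRatio p φ l g x := by
    filter_upwards [hM.proportional H h0, hent.entropyDensity_eq H hl hg] with x hx he
    rcases hx with hx | ⟨hx1, hx⟩
    · have hm : mixDensity p l g x = 0 := Finset.sum_eq_zero fun i _ => hw x hx i
      refine Or.inl ⟨Finset.sum_eq_zero fun i _ => ?_, hm, ?_⟩
      · rcases mul_eq_zero.1 (hx i) with h | h
        · rw [h, zero_mul, zero_mul]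
        · rw [h, zero_pow (by omega), mul_zero, zero_mul]
      · rw [he, logRatio, hm, zero_mul]
        exact Finset.sum_eq_zero fun i _ => by rw [hw x hx i, zero_mul]
    · set k := ρ / (potential B (fun y => ENNReal.ofReal (mixFun p φ l g y)) x).toReal
      have hk0 : 0 < k := div_pos hρ0 hx1
      have hE : ∀ i, √(l i) * g i x ^ (2 * p - 1) * φ i x = k * (l i * g i x ^ (2 * p)) := by
        intro i
        rw [hx i, ← hk x i]
        ring
      have hf : mixFun p φ l g x = k * mixDensity p l g x := by
        rw [mixFun, mixDensity, Finset.mul_sum]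
        exact Finset.sum_congr rfl fun i _ => hE i
      refine Or.inr ⟨k, hk0, hf, ?_⟩
      rw [he, logRatio, hf, hlogk k _ hk0 (mixDensity_nonneg hl x), mixDensity, Finset.sum_mul]
      refine Finset.sum_congr rfl fun i _ => ?_
      rw [hE i, hlogk k _ hk0 (mul_nonneg (hl.1 i) (pow_two_mul_nonneg _))]
  have hpot : ∀ᵐ x ∂(volume.restrict B), ENNReal.ofReal (mixFun p φ l g x) *
      potential B (fun y => ENNReal.ofReal (mixFun p φ l g y)) x =
        ENNReal.ofReal ρ * ENNReal.ofReal (mixDensity p l g x) := by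
    filter_upwards [ae_all_iff.2 fun i => hM.eulerLagrange H h0 i] with x hx
    rw [ofReal_mixFun H.nonneg fun i => (hg i).nonneg, mixDensity,
      ENNReal.ofReal_sum_of_nonneg fun i _ => mul_nonneg (hl.1 i) (pow_two_mul_nonneg _),
      Finset.sum_mul, Finset.mul_sum, hρ, ENNReal.ofReal_toReal hρt]
    refine Finset.sum_congr rfl fun i _ => ?_
    rw [mul_assoc, mul_assoc, hx i, ← hk x i, ENNReal.ofReal_mul (mul_nonneg (Real.sqrt_nonneg _)
      (pow_nonneg ((hg i).nonneg x) _)), ENNReal.ofReal_mul (q := g i x ^ (2 * p - 1))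
      (Real.sqrt_nonneg _)]
    ring
  obtain ⟨ν, h1, h2, hac, hν⟩ := extIntegral_optimalCoupling (v := volume.restrict B)
    (G := fun z => green B z.1 z.2)
    (measurable_green H.isOpen) (fun x y => green_symm B x y)
    (measurable_mixFun H.measurable fun i => (hg i).measurable)
    (measurable_mixDensity fun i => (hg i).measurable)
    (mixFun_nonneg H.nonneg fun i => (hg i).nonneg) (mixDensity_nonneg hl)
    (by
      filter_upwards [hprop] with x hx
      rcases hx with ⟨e1, e2, -⟩ | ⟨k, hk, e, -⟩
      · rw [e1, e2]
      · rw [e, mul_eq_zero, or_iff_right hk.ne'])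
    (lintegral_mixDensity hl hg) hT hρ0 hpot rfl
  have hG : greenEntropy B
      ((volume.restrict B).withDensity fun x => ENNReal.ofReal (mixDensity p l g x)) ≤
      ((2 * (∫ x in B, logRatio p φ l g x) - Real.log ρ : ℝ) : EReal) := by
    refine (iInf_le _ ν).trans ((iInf_le _ h1).trans ((iInf_le _ h2).trans ?_))
    rw [if_pos hac, hν]
    rfl
  rw [hent.jointFunctional_eq H hl hg fun i _ => rfl]
  have hp0 : (0 : EReal) ≤ ((p : ℝ) : EReal) := by
    rw [← EReal.coe_zero, EReal.coe_le_coe_iff]; positivity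
  refine (add_le_add_right (mul_le_mul_of_nonneg_left hG hp0) _).trans ?_
  have he : ∫ x in B, entropyDensity p φ l g x = ∫ x in B, logRatio p φ l g x :=
    integral_congr_ae (hprop.mono fun x hx => by
      rcases hx with ⟨-, -, e⟩ | ⟨k, -, -, e⟩ <;> exact e)
  rw [← EReal.coe_mul, ← EReal.coe_add, EReal.coe_le_coe_iff, he]
  linarith

/-- On a connected domain, all weights of a maximiser are positive. -/
lemma IsMixMax.weight_pos (H : Standing B p φ) (hM : IsMixMax B p φ l g)
    (h0 : mixEnergy B p φ l g ≠ 0) (hc : IsPreconnected B) {i : Fin n}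
    (hi : ¬ φ i =ᵐ[volume] 0) : 0 < l i := by
  refine (hM.mem.1 i).lt_of_ne fun hl => hi ?_
  have mf : Measurable fun y => ENNReal.ofReal (mixFun p φ l g y) :=
    H.measurable_ofReal_mixFun hM.normalised
  have hne : ¬ (fun y => ENNReal.ofReal (mixFun p φ l g y)) =ᵐ[volume.restrict B] 0 := by
    intro h
    apply h0
    rw [mixEnergy_eq_lintegral, lintegral_congr_ae (g := fun _ => 0), lintegral_zero]
    filter_upwards [h] with x hx
    rw [hx, Pi.zero_apply, zero_mul]
  have h1 := hM.eulerLagrange H h0 i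
  rw [ae_restrict_iff' H.isOpen.measurableSet] at h1
  filter_upwards [h1] with x hx
  by_cases hxB : x ∈ B
  · have h2 := hx hxB
    rw [← hl, Real.sqrt_zero, zero_mul, ENNReal.ofReal_zero, mul_zero, mul_eq_zero,
      or_iff_left (potential_pos H.isOpen hc mf hne hxB).ne', ENNReal.ofReal_eq_zero] at h2
    exact le_antisymm h2 (H.nonneg i x)
  · exact image_eq_zero_of_notMem_tsupport fun h => hxB ((H.supp i).2 h)

end comparison

/-! ### Elements of `L^{2p}(B)` and their energies -/

section classes

variable {d n p : ℕ} {B : Set (Eu d)} {φ : Fin n → Eu d → ℝ} {l : Fin n → ℝ}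

lemma ofReal_pow_eq_enorm (t : ℝ) : ENNReal.ofReal (t ^ (2 * p)) = ‖t‖ₑ ^ (2 * p) := by
  rw [← (even_two_mul p).pow_abs, ENNReal.ofReal_pow (abs_nonneg _), Real.enorm_eq_ofReal_abs]

lemma eLpNorm_two_mul (hp : 1 ≤ p) (g : Eu d → ℝ) :
    eLpNorm g ((2 * p : ℕ) : ℝ≥0∞) (volume.restrict B) =
      (∫⁻ x in B, ENNReal.ofReal (g x ^ (2 * p))) ^ (1 / ((2 * p : ℕ) : ℝ)) := by
  rw [eLpNorm_eq_lintegral_rpow_enorm_toReal (by exact_mod_cast (by omega : 2 * p ≠ 0))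
    (ENNReal.natCast_ne_top _), ENNReal.toReal_natCast]
  simp only [ENNReal.rpow_natCast, ofReal_pow_eq_enorm]

lemma normalised_abs (hp : 1 ≤ p) {u : L2p B p} (hu : ‖u‖ = 1) :
    Normalised B p fun x => |u x| := by
  refine ⟨(Lp.stronglyMeasurable u).measurable.abs, fun x => abs_nonneg _, ?_⟩
  simp_rw [(even_two_mul p).pow_abs]
  rw [Lp.norm_def, ENNReal.toReal_eq_one_iff, eLpNorm_two_mul hp] at hu
  have hp0 : ((2 * p : ℕ) : ℝ) ≠ 0 := by exact_mod_cast (by omega : 2 * p ≠ 0)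
  have := congrArg (fun t => t ^ ((2 * p : ℕ) : ℝ)) hu
  simpa only [← ENNReal.rpow_mul, one_div_mul_cancel hp0, ENNReal.rpow_one, ENNReal.one_rpow]
    using this

lemma Normalised.exists_class (hp : 1 ≤ p) {g : Eu d → ℝ} (hg : Normalised B p g) :
    ∃ u : L2p B p, u =ᵐ[volume.restrict B] g ∧ ‖u‖ = 1 ∧ 0 ≤ u := by
  have h1 : eLpNorm g ((2 * p : ℕ) : ℝ≥0∞) (volume.restrict B) = 1 := by
    rw [eLpNorm_two_mul hp, hg.lintegral, ENNReal.one_rpow]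
  have hL : MemLp g ((2 * p : ℕ) : ℝ≥0∞) (volume.restrict B) :=
    ⟨hg.measurable.aestronglyMeasurable, by rw [h1]; exact ENNReal.one_lt_top⟩
  refine ⟨hL.toLp g, hL.coeFn_toLp, by rw [Lp.norm_toLp, h1, ENNReal.toReal_one], ?_⟩
  rw [← Lp.coeFn_nonneg]
  filter_upwards [hL.coeFn_toLp] with x hx
  rw [hx]
  exact hg.nonneg x

lemma powMeasure_congr {g g' : Eu d → ℝ} (h : g =ᵐ[volume.restrict B] g') :
    powMeasure B p g = powMeasure B p g' :=
  withDensity_congr_ae (h.mono fun x hx => by dsimp only; rw [hx])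

lemma toMeasure_eq_abs (u : L2p B p) : toMeasure u = powMeasure B p fun x => |u x| := by
  unfold toMeasure powMeasure
  simp_rw [(even_two_mul p).pow_abs]

/-- A nonnegative element of `L^{2p}(B)` is determined by the measure `g^{2p} dx`. -/
lemma eq_of_toMeasure_eq (hp : 1 ≤ p) {u w : L2p B p} (hu : 0 ≤ u) (hw : 0 ≤ w)
    (h : toMeasure u = toMeasure w) : u = w := by
  have mu := (Lp.stronglyMeasurable u).measurable
  have mw := (Lp.stronglyMeasurable w).measurable
  have h1 := (withDensity_eq_iff_of_sigmaFinite (by fun_prop) (by fun_prop)).1 h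
  refine Lp.ext ?_
  filter_upwards [h1, (Lp.coeFn_nonneg u).2 hu, (Lp.coeFn_nonneg w).2 hw] with x hx hux hwx
  rw [ENNReal.ofReal_eq_ofReal_iff (pow_two_mul_nonneg _) (pow_two_mul_nonneg _)] at hx
  exact (pow_left_inj₀ hux hwx (by omega)).1 hx

lemma measurable_energyDensity (hB : IsOpen B) {h : Eu d → ℝ} (hh : Measurable h) :
    Measurable (energyDensity B h) := by
  have := measurable_green hB
  unfold energyDensity
  fun_prop

lemma abs_combination_le (hφ : ∀ i x, 0 ≤ φ i x) (x : (Fin n → ℝ) × (Fin n → L2p B p)) (y : Eu d) :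
    |combination φ x y| ≤ mixFun p φ x.1 (fun i z => |x.2 i z|) y := by
  refine (Finset.abs_sum_le_sum_abs _ _).trans (le_of_eq (Finset.sum_congr rfl fun i _ => ?_))
  rw [abs_mul, abs_mul, abs_pow, abs_of_nonneg (Real.sqrt_nonneg _), abs_of_nonneg (hφ i y)]

lemma measurable_combination (hφ : ∀ i, Measurable (φ i)) (x : (Fin n → ℝ) × (Fin n → L2p B p)) :
    Measurable (combination φ x) :=
  measurable_mixFun (p := p) (l := x.1) (g := fun i => x.2 i) hφ
    fun i => (Lp.stronglyMeasurable (x.2 i)).measurable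

lemma lintegral_enorm_energyDensity_le (H : Standing B p φ)
    {x : (Fin n → ℝ) × (Fin n → L2p B p)} (hx : x ∈ admissibleFunctions n B p) :
    ∫⁻ z, ‖energyDensity B (combination φ x) z‖ₑ
        ∂((volume.restrict B).prod (volume.restrict B)) ≤
      mixEnergy B p φ x.1 fun i y => |x.2 i y| := by
  have hg := fun i => normalised_abs H.one_le_p (hx.2 i)
  rw [mixEnergy, mutualEnergy_eq_lintegral_prod H.isOpen (H.measurable_ofReal_mixFun hg)
    (H.measurable_ofReal_mixFun hg)]
  refine lintegral_mono fun z => ?_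
  rw [energyDensity, enorm_mul, enorm_mul]
  have h1 := fun y => ENNReal.ofReal_le_ofReal (abs_combination_le H.nonneg x y)
  simp_rw [← Real.enorm_eq_ofReal_abs] at h1
  gcongr
  · exact h1 _
  · rw [Real.enorm_eq_ofReal ENNReal.toReal_nonneg]
    exact ENNReal.ofReal_toReal_le
  · exact h1 _

lemma integrable_energyDensity (H : Standing B p φ) {x : (Fin n → ℝ) × (Fin n → L2p B p)}
    (hx : x ∈ admissibleFunctions n B p) :
    Integrable (energyDensity B (combination φ x))
      ((volume.restrict B).prod (volume.restrict B)) :=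
  ⟨(measurable_energyDensity H.isOpen (measurable_combination H.measurable x)).aestronglyMeasurable,
    (lintegral_enorm_energyDensity_le H hx).trans_lt
      (H.mixEnergy_ne_top hx.1 fun i => normalised_abs H.one_le_p (hx.2 i)).lt_top⟩

lemma energySq_le (H : Standing B p φ) {x : (Fin n → ℝ) × (Fin n → L2p B p)}
    (hx : x ∈ admissibleFunctions n B p) :
    energySq B (combination φ x) ≤ (mixEnergy B p φ x.1 fun i y => |x.2 i y|).toReal := by
  refine (Real.le_norm_self _).trans ((norm_integral_le_lintegral_norm _).trans ?_)
  refine ENNReal.toReal_mono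
    (H.mixEnergy_ne_top hx.1 fun i => normalised_abs H.one_le_p (hx.2 i)) ?_
  simp_rw [ofReal_norm]
  exact lintegral_enorm_energyDensity_le H hx

lemma mixFun_congr {g g' : Fin n → Eu d → ℝ} (h : ∀ i, g i =ᵐ[volume.restrict B] g' i) :
    mixFun p φ l g =ᵐ[volume.restrict B] mixFun p φ l g' := by
  filter_upwards [ae_all_iff.2 h] with x hx
  exact Finset.sum_congr rfl fun i _ => by rw [hx i]

lemma energySq_congr {h h' : Eu d → ℝ} (e : h =ᵐ[volume.restrict B] h') :
    energySq B h = energySq B h' := by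
  refine integral_congr_ae ?_
  filter_upwards [Measure.quasiMeasurePreserving_fst.ae e,
    Measure.quasiMeasurePreserving_snd.ae e] with z z1 z2
  rw [energyDensity, energyDensity, z1, z2]

/-- For nonnegative functions, the energy as a Bochner integral is the energy as a Lebesgue
integral; the set where the Green function is infinite does not contribute. -/
lemma energySq_eq_mixEnergy (H : Standing B p φ) (hl : l ∈ stdSimplex ℝ (Fin n))
    {g : Fin n → Eu d → ℝ} (hg : ∀ i, Normalised B p (g i)) :
    energySq B (mixFun p φ l g) = (mixEnergy B p φ l g).toReal := by
  have mf := measurable_mixFun (p := p) (l := l) H.measurable fun i => (hg i).measurable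
  have hf0 := mixFun_nonneg (p := p) (l := l) H.nonneg fun i => (hg i).nonneg
  have mg := measurable_green H.isOpen
  have e := mutualEnergy_eq_lintegral_prod H.isOpen (H.measurable_ofReal_mixFun (l := l) hg)
    (H.measurable_ofReal_mixFun (l := l) hg)
  rw [energySq, integral_eq_lintegral_of_nonneg_ae (f := energyDensity B (mixFun p φ l g))
    (ae_of_all _ fun z => mul_nonneg (mul_nonneg (hf0 _) ENNReal.toReal_nonneg) (hf0 _))
    (measurable_energyDensity H.isOpen mf).aestronglyMeasurable, mixEnergy, e]
  congr 1
  have hfin : ∀ᵐ z ∂((volume.restrict B).prod (volume.restrict B)),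
      ENNReal.ofReal (mixFun p φ l g z.1) * green B z.1 z.2 * ENNReal.ofReal (mixFun p φ l g z.2)
        < ∞ := by
    refine ae_lt_top (by fun_prop) ?_
    rw [← e]
    exact H.mixEnergy_ne_top hl hg
  refine lintegral_congr_ae ?_
  filter_upwards [hfin] with z hz
  rw [energyDensity, ENNReal.ofReal_mul (mul_nonneg (hf0 _) ENNReal.toReal_nonneg),
    ENNReal.ofReal_mul (hf0 _)]
  by_cases hG : green B z.1 z.2 = ∞
  · rw [hG] at hz ⊢
    rcases eq_or_ne (ENNReal.ofReal (mixFun p φ l g z.1)) 0 with h | h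
    · rw [h]; simp
    rcases eq_or_ne (ENNReal.ofReal (mixFun p φ l g z.2)) 0 with h' | h'
    · rw [h']; simp
    rw [ENNReal.mul_top h, ENNReal.top_mul h'] at hz
    exact absurd hz (lt_irrefl _)
  · rw [ENNReal.ofReal_toReal hG]

/-- The energy of the element of `L^{2p}(B)^n` given by normalised nonnegative functions. -/
lemma energySq_eq_of_ae_eq (H : Standing B p φ) {x : (Fin n → ℝ) × (Fin n → L2p B p)}
    (hl : x.1 ∈ stdSimplex ℝ (Fin n)) {g : Fin n → Eu d → ℝ} (hg : ∀ i, Normalised B p (g i))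
    (h : ∀ i, x.2 i =ᵐ[volume.restrict B] g i) :
    energySq B (combination φ x) = (mixEnergy B p φ x.1 g).toReal := by
  rw [← energySq_eq_mixEnergy H hl hg]
  exact energySq_congr (mixFun_congr h)

end classes

/-! ### The two variational problems -/

section variational

variable {d n p : ℕ} {B : Set (Eu d)} {φ : Fin n → Eu d → ℝ} {l : Fin n → ℝ}

lemma Standing.exists_isMixMax (H : Standing B p φ) : ∃ l g, IsMixMax B p φ l g := by
  obtain ⟨l, hl, g, hg, -, h⟩ := H.exists_mixEnergy_max
  exact ⟨l, g, hl, hg, h⟩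

lemma IsMixMax.exists_isMaximiser (H : Standing B p φ) {g : Fin n → Eu d → ℝ}
    (hM : IsMixMax B p φ l g) : ∃ u : Fin n → L2p B p, (∀ i, 0 ≤ u i) ∧
      (∀ i, u i =ᵐ[volume.restrict B] g i) ∧ (l, u) ∈ maximisers B p φ ∧
      energySq B (combination φ (l, u)) = (mixEnergy B p φ l g).toReal := by
  choose u hu hn hu0 using fun i => (hM.normalised i).exists_class H.one_le_p
  have e := energySq_eq_of_ae_eq (x := (l, u)) H hM.mem hM.normalised hu
  refine ⟨u, hu0, hu, ⟨⟨hM.mem, hn⟩, fun y hy => ?_⟩, e⟩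
  rw [Set.mem_ofPred_eq]
  dsimp only
  rw [e]
  exact (energySq_le H hy).trans (ENNReal.toReal_mono
    (H.mixEnergy_ne_top hM.mem hM.normalised)
    (hM.le y.1 hy.1 _ fun i => normalised_abs H.one_le_p (hy.2 i)))

lemma rho_eq_of_mem_maximisers {x : (Fin n → ℝ) × (Fin n → L2p B p)}
    (hx : x ∈ maximisers B p φ) : energySq B (combination φ x) = rho B p φ := by
  have : IsGreatest ((fun x => energySq B (combination φ x)) '' admissibleFunctions n B p)
      (energySq B (combination φ x)) :=
    ⟨⟨x, hx.1, rfl⟩, by rintro _ ⟨y, hy, rfl⟩; exact hx.2 hy⟩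
  exact this.csSup_eq.symm

lemma IsMixMax.rho_eq (H : Standing B p φ) {g : Fin n → Eu d → ℝ}
    (hM : IsMixMax B p φ l g) : rho B p φ = (mixEnergy B p φ l g).toReal := by
  obtain ⟨u, -, -, h, e⟩ := hM.exists_isMaximiser H
  rw [← e, rho_eq_of_mem_maximisers h]

/-- The absolute values of a maximiser again form a maximiser. -/
lemma isMixMax_abs (H : Standing B p φ) {x : (Fin n → ℝ) × (Fin n → L2p B p)}
    (hx : x ∈ maximisers B p φ) : IsMixMax B p φ x.1 fun i y => |x.2 i y| := by
  have hg := fun i => normalised_abs H.one_le_p (hx.1.2 i)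
  obtain ⟨l, g, hM⟩ := H.exists_isMixMax
  refine ⟨hx.1.1, hg, fun l' hl' g' hg' => (hM.le l' hl' g' hg').trans ?_⟩
  rw [← ENNReal.toReal_le_toReal (H.mixEnergy_ne_top hM.mem hM.normalised)
    (H.mixEnergy_ne_top hx.1.1 hg), ← hM.rho_eq H, ← rho_eq_of_mem_maximisers hx]
  exact energySq_le H hx.1

/-- `J ≥ -p log ρ`. -/
lemma Standing.le_jointFunctional (H : Standing B p φ)
    {y : (Fin n → ℝ) × (Fin n → Measure (Eu d))} (hy : y ∈ admissibleMeasures n B) :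
    -(((p : ℝ) : EReal) * ENNReal.log (ENNReal.ofReal (rho B p φ))) ≤ jointFunctional B p φ y := by
  obtain ⟨l, g₀, hM⟩ := H.exists_isMixMax
  by_cases htop : jointFunctional B p φ y = ⊤
  · rw [htop]; exact le_top
  obtain ⟨g, hg, hent, hμ⟩ := exists_finiteEntropy H hy.1 hy.2 htop
  refine le_trans ?_ (hent.le_jointFunctional H hy.1 hg hμ)
  have h1 := hent.mixEnergy_pos H hy.1 hg
  have h2 := hM.le y.1 hy.1 g hg
  have h3 := H.mixEnergy_ne_top hM.mem hM.normalised
  have h4 := ENNReal.toReal_pos h1.ne' (ne_top_of_le_ne_top h3 h2)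
  have h5 := ENNReal.toReal_mono h3 h2
  rw [hM.rho_eq H, ENNReal.log_ofReal_of_pos (h4.trans_le h5), ← EReal.coe_mul, ← EReal.coe_neg,
    EReal.coe_le_coe_iff]
  gcongr

lemma IsMixMax.jointFunctional_eq (H : Standing B p φ) {g : Fin n → Eu d → ℝ}
    (hM : IsMixMax B p φ l g) : jointFunctional B p φ (l, fun i => powMeasure B p (g i)) =
      -(((p : ℝ) : EReal) * ENNReal.log (ENNReal.ofReal (rho B p φ))) := by
  refine le_antisymm ?_ (H.le_jointFunctional ⟨hM.mem, fun i =>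
    powMeasure_mem_probOn H.isOpen.measurableSet (hM.normalised i).lintegral⟩)
  have hp : (0 : ℝ) < p := by exact_mod_cast H.one_le_p
  rw [hM.rho_eq H]
  rcases eq_or_ne (mixEnergy B p φ l g) 0 with h0 | h0
  · rw [h0, ENNReal.toReal_zero, ENNReal.ofReal_zero, ENNReal.log_zero,
      EReal.coe_mul_bot_of_pos hp, EReal.neg_bot]
    exact le_top
  · refine (hM.jointFunctional_le H h0).trans (le_of_eq ?_)
    rw [ENNReal.log_ofReal_of_pos
      (ENNReal.toReal_pos h0 (H.mixEnergy_ne_top hM.mem hM.normalised)), ← EReal.coe_mul,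
      ← EReal.coe_neg]

/-- The iterated infimum in the definition of `W` is the infimum of `J`. -/
lemma W_eq_neg {c : EReal} (hle : ∀ y ∈ admissibleMeasures n B, c ≤ jointFunctional B p φ y)
    {y : (Fin n → ℝ) × (Fin n → Measure (Eu d))} (hy : y ∈ admissibleMeasures n B)
    (he : jointFunctional B p φ y = c) : W B p φ = -c := by
  rw [W, neg_inj]
  refine le_antisymm ?_ (le_iInf fun l => le_iInf fun hl => ?_)
  · refine (iInf_le _ y.1).trans ((iInf_le _ hy.1).trans ?_)
    rw [mixedRate, sub_eq_add_neg, neg_neg, ← he]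
    exact add_le_add_right ((iInf_le _ y.2).trans (iInf_le _ hy.2)) _
  · rw [mixedRate, sub_eq_add_neg, neg_neg]
    have h1 : c - ((p * simplexEntropy l : ℝ) : EReal) ≤
        ⨅ (μ : Fin n → Measure (Eu d)) (_ : ∀ i, μ i ∈ probOn B), innerFunctional B p φ l μ :=
      le_iInf fun μ => le_iInf fun hμ => EReal.sub_le_of_le_add' (hle (l, μ) ⟨hl, hμ⟩)
    rw [add_comm]
    rwa [EReal.sub_le_iff_le_add (.inl (EReal.coe_ne_bot _)) (.inl (EReal.coe_ne_top _))] at h1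

/-- `W = p log ρ`. -/
theorem Standing.W_eq (H : Standing B p φ) :
    W B p φ = ((p : ℝ) : EReal) * ENNReal.log (ENNReal.ofReal (rho B p φ)) := by
  obtain ⟨l, g, hM⟩ := H.exists_isMixMax
  rw [W_eq_neg (fun y hy => H.le_jointFunctional hy) ⟨hM.mem, fun i =>
    powMeasure_mem_probOn H.isOpen.measurableSet (hM.normalised i).lintegral⟩
    (hM.jointFunctional_eq H), neg_neg]

lemma IsMixMax.mem_minimisers (H : Standing B p φ) {g : Fin n → Eu d → ℝ}
    (hM : IsMixMax B p φ l g) : (l, fun i => powMeasure B p (g i)) ∈ minimisers B p φ :=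
  ⟨⟨hM.mem, fun i => powMeasure_mem_probOn H.isOpen.measurableSet (hM.normalised i).lintegral⟩,
    fun y hy => by
      rw [Set.mem_ofPred_eq, hM.jointFunctional_eq H]
      exact H.le_jointFunctional hy⟩

lemma Standing.jointFunctional_eq_of_mem_minimisers (H : Standing B p φ)
    {y : (Fin n → ℝ) × (Fin n → Measure (Eu d))} (hy : y ∈ minimisers B p φ) :
    jointFunctional B p φ y =
      -(((p : ℝ) : EReal) * ENNReal.log (ENNReal.ofReal (rho B p φ))) := by
  obtain ⟨l, g, hM⟩ := H.exists_isMixMax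
  refine le_antisymm ?_ (H.le_jointFunctional hy.1)
  rw [← hM.jointFunctional_eq H]
  exact hy.2 (hM.mem_minimisers H).1

/-- The maximal energy is positive unless all `φ_i` vanish. -/
lemma IsMixMax.mixEnergy_ne_zero (H : Standing B p φ) {g : Fin n → Eu d → ℝ}
    (hM : IsMixMax B p φ l g) {i : Fin n} (hi : ¬ φ i =ᵐ[volume] 0) :
    mixEnergy B p φ l g ≠ 0 := by
  obtain ⟨S, C, hS, hSB, hvS, hC0, hC, hφS⟩ := H.exists_carrier
  obtain ⟨K, hK, hnorm⟩ := exists_totalNorm_le hS hSB hvS hC hφS H.one_le_p le_rfl hvS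
  have hp := H.one_le_p
  have mφ := H.measurable i
  have ht : totalNorm B p φ (fun _ => 1) ≠ ∞ := ne_top_of_le_ne_top hK (hnorm _ (by simp))
  have h0 : totalNorm B p φ (fun _ => 1) ≠ 0 := by
    intro h
    have h1 : weightedNorm B p (φ i) (fun _ => 1) = 0 :=
      le_zero_iff.1 (h ▸ weightedNorm_le_totalNorm φ _ i)
    have h2 := weightedNorm_pow hp (B := B) (φ i) (fun _ => 1)
    rw [h1, zero_pow (by omega), eq_comm, lintegral_eq_zero_iff (by fun_prop),
      EventuallyEq, ae_restrict_iff' H.isOpen.measurableSet] at h2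
    refine hi (h2.mono fun x hx => ?_)
    by_cases hxB : x ∈ B
    · have h3 := eq_zero_of_pow_eq_zero (hx hxB)
      rw [mul_one, ENNReal.ofReal_eq_zero] at h3
      exact le_antisymm h3 (H.nonneg i x)
    · exact hφS i x fun h => hxB (hSB h)
  obtain ⟨l', hl', g', hg', e⟩ := exists_lintegral_mixFun_mul_eq hp H.isOpen H.nonempty
    H.measurable H.nonneg measurable_const h0 ht
  refine (lt_of_lt_of_le ?_ (hM.le l' hl' g' hg')).ne'
  refine mutualEnergy_pos H.isOpen (H.measurable_ofReal_mixFun hg') fun hc => h0 ?_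
  rw [← e, lintegral_congr_ae (g := fun _ => 0), lintegral_zero]
  filter_upwards [hc] with x hx
  rw [hx, Pi.zero_apply, zero_mul]

/-- Minimisers of `J` have densities that maximise the energy. -/
lemma Standing.exists_isMixMax_of_mem_minimisers (H : Standing B p φ) {i : Fin n}
    (hi : ¬ φ i =ᵐ[volume] 0) {y : (Fin n → ℝ) × (Fin n → Measure (Eu d))}
    (hy : y ∈ minimisers B p φ) :
    ∃ g : Fin n → Eu d → ℝ, IsMixMax B p φ y.1 g ∧
      ∀ i, 0 < y.1 i → y.2 i = powMeasure B p (g i) := by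
  obtain ⟨l, g₀, hM⟩ := H.exists_isMixMax
  have hp : (0 : ℝ) < p := by exact_mod_cast H.one_le_p
  have h3 := H.mixEnergy_ne_top hM.mem hM.normalised
  have hρ := ENNReal.toReal_pos (hM.mixEnergy_ne_zero H hi) h3
  have hJ := H.jointFunctional_eq_of_mem_minimisers hy
  rw [hM.rho_eq H, ENNReal.log_ofReal_of_pos hρ, ← EReal.coe_mul, ← EReal.coe_neg] at hJ
  obtain ⟨g, hg, hent, hμ⟩ := exists_finiteEntropy (l := y.1) (μ := y.2) H hy.1.1 hy.1.2
    (by rw [hJ]; exact EReal.coe_ne_top _)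
  refine ⟨g, ⟨hy.1.1, hg, fun l' hl' g' hg' => (hM.le l' hl' g' hg').trans ?_⟩, hμ⟩
  have h1 := hent.le_jointFunctional H hy.1.1 hg hμ
  have h2 := H.mixEnergy_ne_top hy.1.1 hg
  rw [hJ, EReal.coe_le_coe_iff, neg_le_neg_iff, mul_le_mul_iff_right₀ hp, Real.log_le_log_iff hρ
    (ENNReal.toReal_pos (hent.mixEnergy_pos H hy.1.1 hg).ne' h2)] at h1
  exact (ENNReal.toReal_le_toReal h3 h2).1 h1

/-- Minimisers of `J` come from nonnegative maximisers of the energy. -/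
lemma Standing.exists_maximiser_of_mem_minimisers (H : Standing B p φ) {i : Fin n}
    (hi : ¬ φ i =ᵐ[volume] 0) {y : (Fin n → ℝ) × (Fin n → Measure (Eu d))}
    (hy : y ∈ minimisers B p φ) :
    ∃ u : Fin n → L2p B p, (∀ i, 0 ≤ u i) ∧ (y.1, u) ∈ maximisers B p φ ∧
      ∀ i, 0 < y.1 i → y.2 i = toMeasure (u i) := by
  obtain ⟨g, hM, hμ⟩ := H.exists_isMixMax_of_mem_minimisers hi hy
  obtain ⟨u, hu0, hu, hmax, -⟩ := hM.exists_isMaximiser H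
  exact ⟨u, hu0, hmax, fun i hi => (hμ i hi).trans (powMeasure_congr (hu i)).symm⟩

lemma Standing.toMeasure_mem_minimisers (H : Standing B p φ)
    {x : (Fin n → ℝ) × (Fin n → L2p B p)} (hx : x ∈ maximisers B p φ) :
    (x.1, fun i => toMeasure (x.2 i)) ∈ minimisers B p φ := by
  simp_rw [toMeasure_eq_abs]
  exact (isMixMax_abs H hx).mem_minimisers H

/-- On a connected domain all weights are positive, so the correspondence is one-to-one. -/
lemma Standing.bijOn (H : Standing B p φ) (hc : IsConnected B) (hφ : ∀ i, ¬ φ i =ᵐ[volume] 0) :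
    Set.BijOn (fun x : (Fin n → ℝ) × (Fin n → L2p B p) => (x.1, fun i => toMeasure (x.2 i)))
      {x | x ∈ maximisers B p φ ∧ ∀ i, 0 ≤ x.2 i} (minimisers B p φ) := by
  refine ⟨fun x hx => H.toMeasure_mem_minimisers hx.1, fun x hx y hy h => ?_, fun y hy => ?_⟩
  · have h' := Prod.mk.inj h
    exact Prod.ext h'.1 (funext fun i =>
      eq_of_toMeasure_eq H.one_le_p (hx.2 i) (hy.2 i) (congrFun h'.2 i))
  · have i₀ : Fin n := ⟨0, H.one_le_n⟩
    obtain ⟨u, hu0, hmax, hμ⟩ := H.exists_maximiser_of_mem_minimisers (hφ i₀) hy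
    refine ⟨(y.1, u), ⟨hmax, hu0⟩, Prod.ext rfl (funext fun i => (hμ i ?_).symm)⟩
    have hM := isMixMax_abs H hmax
    exact hM.weight_pos H (hM.mixEnergy_ne_zero H (hφ i)) hc.isPreconnected (hφ i)

end variational

end GreenVar

theorem proposition4p2 (d n p : ℕ) (hd : 1 ≤ d) (hn : 1 ≤ n) (hp : 1 ≤ p)
    (hpd : (p : ℤ) * ((d : ℤ) - 2) < (d : ℤ))
    (B : Set (GreenVar.Eu d)) (hBopen : IsOpen B) (hBne : B.Nonempty)
    (hBbdd : d ≤ 2 → Bornology.IsBounded B)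
    (φ : Fin n → GreenVar.Eu d → ℝ)
    (hφmeas : ∀ i, Measurable (φ i)) (hφnonneg : ∀ i x, 0 ≤ φ i x)
    (hφbdd : ∀ i, ∃ C : ℝ, ∀ x, φ i x ≤ C)
    (hφsupp : ∀ i, HasCompactSupport (φ i) ∧ tsupport (φ i) ⊆ B) :
    -- the energies in the definition of `ρ(φ)` are absolutely convergent integrals
    (∀ x ∈ GreenVar.admissibleFunctions n B p,
      Integrable (GreenVar.energyDensity B (GreenVar.combination φ x))
        ((volume.restrict B).prod (volume.restrict B))) ∧
    -- `W(φ) = p log ρ(φ)`, where `log 0 = -∞`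
    GreenVar.W B p φ
      = ((p : ℝ) : EReal) * ENNReal.log (ENNReal.ofReal (GreenVar.rho B p φ)) ∧
    -- the minimum is attained, and its value is `-W(φ)`
    (GreenVar.minimisers B p φ).Nonempty ∧
    (∀ x ∈ GreenVar.minimisers B p φ, -GreenVar.jointFunctional B p φ x = GreenVar.W B p φ) ∧
    -- the maximum is attained, and its value is `ρ(φ)`
    (GreenVar.maximisers B p φ).Nonempty ∧
    (∀ x ∈ GreenVar.maximisers B p φ,
      GreenVar.energySq B (GreenVar.combination φ x) = GreenVar.rho B p φ) ∧
    -- maximisers yield minimisers through `dμ_i/dx = g_i^{2p}`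
    (∀ x ∈ GreenVar.maximisers B p φ,
      (x.1, fun i => GreenVar.toMeasure (x.2 i)) ∈ GreenVar.minimisers B p φ) ∧
    -- unless all `φ_i` vanish a.e., every minimiser arises so from a nonnegative maximiser, up to
    -- those components `i` that have weight `λ_i = 0` and do not enter the functionals
    ((∃ i, ¬ φ i =ᵐ[volume] 0) → ∀ x ∈ GreenVar.minimisers B p φ, ∃ g : Fin n → GreenVar.L2p B p,
      (∀ i, 0 ≤ g i) ∧ (x.1, g) ∈ GreenVar.maximisers B p φ ∧
        ∀ i, 0 < x.1 i → x.2 i = GreenVar.toMeasure (g i)) ∧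
    -- if `B` is connected and no `φ_i` vanishes a.e., this is a one-to-one correspondence
    (IsConnected B → (∀ i, ¬ φ i =ᵐ[volume] 0) →
      Set.BijOn (fun x : (Fin n → ℝ) × (Fin n → GreenVar.L2p B p) =>
          (x.1, fun i => GreenVar.toMeasure (x.2 i)))
        {x | x ∈ GreenVar.maximisers B p φ ∧ ∀ i, 0 ≤ x.2 i}
        (GreenVar.minimisers B p φ)) := by
  have H : GreenVar.Standing B p φ :=
    ⟨hd, hn, hp, hpd, hBopen, hBne, hBbdd, hφmeas, hφnonneg, hφbdd, hφsupp⟩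
  obtain ⟨l, g, hM⟩ := H.exists_isMixMax
  refine ⟨fun x hx => GreenVar.integrable_energyDensity H hx, H.W_eq, ⟨_, hM.mem_minimisers H⟩,
    fun x hx => ?_, ?_, fun x hx => GreenVar.rho_eq_of_mem_maximisers hx,
    fun x hx => H.toMeasure_mem_minimisers hx, ?_, fun hc hφ => H.bijOn hc hφ⟩
  · rw [H.W_eq, H.jointFunctional_eq_of_mem_minimisers hx, neg_neg]
  · obtain ⟨u, -, -, hu, -⟩ := hM.exists_isMaximiser H
    exact ⟨_, hu⟩
  · rintro ⟨i, hi⟩ x hx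
    exact H.exists_maximiser_of_mem_minimisers hi hx
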